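/- Let $X$ be a set with a $\sigma$-algebra $\mathcal S$, let $\mathcal H,\mathcal K$ be complex Hilbert spaces, and let $W_1\subseteq B(\mathcal H)$, $W_2\subseteq B(\mathcal K)$ be von Neumann algebras. Let $(W_1)_p=\{P\in W_1: P=P^*=P^2\}$ be the set of hermitian projections of $W_1$, and let $B(W_1,W_2)$ be the Banach space of bounded linear maps $W_1\to W_2$. A *positive operator-valued measure* $E:\mathcal S\to W_2$ is a set function whose values are positive operators and which is countably additive in the strong operator topology; it is a *spectral measure* if moreover all its values are hermitian projections ($E(X)=\mathrm{id}$ is not required). For $M:\mathcal S\to B(W_1,W_2)$ and $A\in W_1$ put $M_A(\Delta):=M(\Delta)(A)$. The set function $M$ is a *non-negative measure* if $M_A$ is a positive operator-valued measure for every positive $A\in W_1$. A non-negative measure $M$ is a *non-negative spectral measure* if $M_P$ is a spectral measure for every $P\in(W_1)_p$ and $M_P(\Delta_1)M_Q(\Delta_2)=M_{PQ}(\Delta_1\cap\Delta_2)$ for all $P,Q\in(W_1)_p$ and $\Delta_1,\Delta_2\in\mathcal S$. Let $\{F_P\}_{P\in(W_1)_p}$ be a family of spectral measures $F_P:\mathcal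 S\to W_2$. **Theorem.** There is a unique non-negative spectral measure $M:\mathcal S\to B(W_1,W_2)$ such that $M_P=F_P$ for all $P\in(W_1)_p$ if and only if the following three conditions hold. 1. For all $n,m\ge 0$, all $P_i,Q_j\in(W_1)_p$, all real $\lambda_i,\mu_j$ with $\sum_{i=1}^n\lambda_iP_i=\sum_{j=1}^m\mu_jQ_j$, and all $\Delta\in\mathcal S$, $$\sum_{i=1}^n\lambda_iF_{P_i}(\Delta)=\sum_{j=1}^m\mu_jF_{Q_j}(\Delta).$$ 2. For each $\Delta\in\mathcal S$ there is a constant $k_\Delta>0$ such that $\|F_P(\Delta)\|\le k_\Delta$ for all $P\in(W_1)_p$. 3. For all $P,Q\in(W_1)_p$ and all $\Delta_1,\Delta_2\in\mathcal S$, $$F_P(\Delta_1)\,F_Q(\Delta_2)=M_{PQ}(\Delta_1\cap\Delta_2).$$ In condition 3, where $PQ$ need not be a projection, $M_A(\Delta)$ is defined from the family $\{F_P\}$ as follows. For positive $A\in W_1$, with $E_A(a,b]$ the spectral projection of $A$ for the interval $(a,b]$, $$M_A(\Delta):=\lim_{\ell\to\infty}\ \sum_{k=0}^{\lceil 2^\ell\|A\|\rceil}\frac{k}{2^\ell}\,F_{E_A\left(\frac{k-1}{2^\ell},\frac{k}{2^\ell}\right]}(\Delta)$$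 in the operator norm (the limit of the family along Riemann sums of the spectral resolution of $A$; it exists when conditions 1 and 2 hold). For general $A\in W_1$, with $\operatorname{Re}A=\frac{A+A^*}{2}$, $\operatorname{Im}A=\frac{i(A^*-A)}{2}$ and positive and negative parts denoted by $\pm$, $$M_A:=M_{(\operatorname{Re}A)_+}-M_{(\operatorname{Re}A)_-}+i\left(M_{(\operatorname{Im}A)_+}-M_{(\operatorname{Im}A)_-}\right).$$ -/

import Mathlib

open Filter Topology
open scoped ComplexStarModule

/-- A von Neumann algebra is closed under multiplication by complex scalars, so it is a normed
complex vector space with the operator norm. -/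
instance VonNeumannAlgebra.instSMulMemClass {H : Type*} [NormedAddCommGroup H]
    [InnerProductSpace ℂ H] [CompleteSpace H] :
    SMulMemClass (VonNeumannAlgebra H) ℂ (H →L[ℂ] H) where
  smul_mem {s} c _ ha := s.toStarSubalgebra.smul_mem ha c

namespace SpectralFamily

/-- The members of the `σ`-algebra of `X`. -/
abbrev MSet (X : Type*) [MeasurableSpace X] : Type _ := Subtype (MeasurableSet : Set X → Prop)

section Basic

variable {X : Type*} [MeasurableSpace X]
  {H : Type*} [NormedAddCommGroup H] [InnerProductSpace ℂ H] [CompleteSpace H]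
  {K : Type*} [NormedAddCommGroup K] [InnerProductSpace ℂ K] [CompleteSpace K]

/-- The hermitian projections of a von Neumann algebra: `P = P* = P²`. -/
abbrev Proj (W : VonNeumannAlgebra H) : Type _ := {P : W // IsStarProjection P}

/-- A positive operator-valued measure with values in `W`: positive values, and countable
additivity in the strong operator topology. -/
structure IsPositiveOperatorMeasure (W : VonNeumannAlgebra K) (E : MSet X → W) : Prop where
  isPositive : ∀ Δ, (E Δ : K →L[ℂ] K).IsPositive
  hasSum : ∀ (D : ℕ → MSet X) (Δ : MSet X),
    Pairwise (fun i j => Disjoint (D i : Set X) (D j : Set X)) →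
    (Δ : Set X) = ⋃ j, (D j : Set X) →
    ∀ k : K, HasSum (fun j => (E (D j) : K →L[ℂ] K) k) ((E Δ : K →L[ℂ] K) k)

/-- A spectral measure with values in `W`: a positive operator-valued measure whose values are
hermitian projections. -/
structure IsSpectralMeasure (W : VonNeumannAlgebra K) (E : MSet X → W) : Prop
    extends IsPositiveOperatorMeasure W E where
  isStarProjection : ∀ Δ, IsStarProjection (E Δ)

/-- A non-negative measure: for each positive `A ∈ W₁`, the set function `Δ ↦ M(Δ)(A)` is a
positive operator-valued measure. -/
def IsNonnegMeasure (W₁ : VonNeumannAlgebra H) (W₂ : VonNeumannAlgebra K)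
    (M : MSet X → (W₁ →L[ℂ] W₂)) : Prop :=
  ∀ A : W₁, (A : H →L[ℂ] H).IsPositive → IsPositiveOperatorMeasure W₂ (fun Δ => M Δ A)

/-- A non-negative spectral measure: a non-negative measure such that `M_P` is a spectral measure
for every hermitian projection `P`, and `M_P(Δ₁) M_Q(Δ₂) = M_{PQ}(Δ₁ ∩ Δ₂)`. -/
structure IsNonnegSpectralMeasure (W₁ : VonNeumannAlgebra H) (W₂ : VonNeumannAlgebra K)
    (M : MSet X → (W₁ →L[ℂ] W₂)) : Prop where
  isNonnegMeasure : IsNonnegMeasure W₁ W₂ M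
  isSpectralMeasure : ∀ P : Proj W₁, IsSpectralMeasure W₂ (fun Δ => M Δ P)
  mul_eq : ∀ (P Q : Proj W₁) (Δ₁ Δ₂ : MSet X),
    M Δ₁ (P : W₁) * M Δ₂ (Q : W₁) = M (Δ₁ ∩ Δ₂) ((P : W₁) * (Q : W₁))

end Basic

section SpectralResolution

variable {H : Type*} [NormedAddCommGroup H] [InnerProductSpace ℂ H] [CompleteSpace H]

/-- An element commuting with the commutant of `W` belongs to `W`. -/
theorem mem_of_forall_commute (W : VonNeumannAlgebra H) {A : H →L[ℂ] H}
    (h : ∀ T ∈ W.commutant, Commute A T) : A ∈ W := by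
  rw [← W.commutant_commutant, VonNeumannAlgebra.mem_commutant_iff]
  exact fun T hT => (h T hT).symm.eq

theorem commute_of_mem_commutant (W : VonNeumannAlgebra H) {A T : H →L[ℂ] H}
    (hA : A ∈ W) (hT : T ∈ W.commutant) : Commute A T :=
  VonNeumannAlgebra.mem_commutant_iff.1 hT A hA

theorem posPart_mem (W : VonNeumannAlgebra H) {A : H →L[ℂ] H} (hA : A ∈ W) : A⁺ ∈ W :=
  mem_of_forall_commute W fun _ hT =>
    (Commute.cfcₙ_real (commute_of_mem_commutant W hA hT) (fun x : ℝ => x⁺))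

theorem negPart_mem (W : VonNeumannAlgebra H) {A : H →L[ℂ] H} (hA : A ∈ W) : A⁻ ∈ W :=
  mem_of_forall_commute W fun _ hT =>
    (Commute.cfcₙ_real (commute_of_mem_commutant W hA hT) (fun x : ℝ => x⁻))

theorem sub_algebraMap_mem (W : VonNeumannAlgebra H) {A : H →L[ℂ] H} (hA : A ∈ W) (c : ℂ) :
    A - algebraMap ℂ (H →L[ℂ] H) c ∈ W :=
  sub_mem hA (W.toStarSubalgebra.algebraMap_mem c)

/-- For hermitian `A` with resolution of identity `E(t)` (`t` real), where `E(t)` is the orthogonal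
projection onto the kernel of `(A - t)₊`, this is `ran E(b) ∩ (ran E(a))ᗮ`. -/
noncomputable def spectralSubspace (A : H →L[ℂ] H) (a b : ℝ) : Submodule ℂ H :=
  ((A - algebraMap ℂ (H →L[ℂ] H) b)⁺).ker ⊓ (((A - algebraMap ℂ (H →L[ℂ] H) a)⁺).ker)ᗮ

instance (A : H →L[ℂ] H) (a b : ℝ) : (spectralSubspace A a b).HasOrthogonalProjection := by
  have hc : IsClosed (spectralSubspace A a b : Set H) :=
    (ContinuousLinearMap.isClosed_ker _).inter (Submodule.isClosed_orthogonal _)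
  have : CompleteSpace (spectralSubspace A a b) := hc.completeSpace_coe
  infer_instance

/-- For hermitian `A` and `a ≤ b`: the orthogonal projection `E(b) - E(a)`, that is, the spectral
projection of `A` for the interval `(a, b]`. -/
noncomputable def spectralProj (A : H →L[ℂ] H) (a b : ℝ) : H →L[ℂ] H :=
  (spectralSubspace A a b).starProjection

theorem spectralProj_isStarProjection (A : H →L[ℂ] H) (a b : ℝ) :
    IsStarProjection (spectralProj A a b) :=
  isStarProjection_starProjection

theorem spectralProj_mem (W : VonNeumannAlgebra H) {A : H →L[ℂ] H} (hA : A ∈ W) (a b : ℝ) :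
    spectralProj A a b ∈ W := by
  rw [VonNeumannAlgebra.IsStarProjection.mem_iff (spectralProj_isStarProjection A a b)]
  intro T hT
  have hb := posPart_mem W (sub_algebraMap_mem W hA b)
  have ha := posPart_mem W (sub_algebraMap_mem W hA a)
  have h1 : ∀ x, x ∈ ((A - algebraMap ℂ (H →L[ℂ] H) b)⁺).ker →
      T x ∈ ((A - algebraMap ℂ (H →L[ℂ] H) b)⁺).ker := by
    intro x hx
    have := congrArg (fun S : H →L[ℂ] H => S x) (commute_of_mem_commutant W hb hT).eq
    simp only [mul_apply_eq_comp] at this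
    rw [LinearMap.mem_ker] at hx ⊢
    simpa [hx] using this.trans (by simpa using congrArg T hx)
  have h2 : ∀ x, x ∈ ((A - algebraMap ℂ (H →L[ℂ] H) a)⁺).ker →
      (star T) x ∈ ((A - algebraMap ℂ (H →L[ℂ] H) a)⁺).ker := by
    intro x hx
    have := congrArg (fun S : H →L[ℂ] H => S x)
      (commute_of_mem_commutant W ha (star_mem hT)).eq
    simp only [mul_apply_eq_comp] at this
    rw [LinearMap.mem_ker] at hx ⊢
    exact this.trans (by simpa using congrArg (fun y => (star T) y) hx)
  rw [Module.End.mem_invtSubmodule]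
  intro x hx
  simp only [spectralProj, spectralSubspace, Submodule.range_starProjection, Submodule.mem_comap,
    Submodule.mem_inf, Submodule.mem_orthogonal] at hx ⊢
  refine ⟨h1 x hx.1, fun u hu => ?_⟩
  have := hx.2 _ (h2 u hu)
  rwa [ContinuousLinearMap.star_eq_adjoint, ContinuousLinearMap.adjoint_inner_left] at this

/-- The spectral projection of `A ∈ W` for `(a, b]` as a hermitian projection of `W`. -/
noncomputable def spectralProjIn (W : VonNeumannAlgebra H) (A : W) (a b : ℝ) : Proj W :=
  ⟨⟨spectralProj (A : H →L[ℂ] H) a b, spectralProj_mem W A.2 a b⟩,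
    ⟨Subtype.ext (spectralProj_isStarProjection (A : H →L[ℂ] H) a b).isIdempotentElem,
      Subtype.ext (spectralProj_isStarProjection (A : H →L[ℂ] H) a b).isSelfAdjoint⟩⟩

/-- `A ↦ (re A)₊` on `W`, where `re A = (A + A*)/2`. -/
noncomputable def rePos (W : VonNeumannAlgebra H) (A : W) : W :=
  ⟨((((2 : ℂ)⁻¹ • (A + star A) : W) : H →L[ℂ] H))⁺, posPart_mem W (Subtype.property _)⟩

/-- `A ↦ (re A)₋` on `W`. -/
noncomputable def reNeg (W : VonNeumannAlgebra H) (A : W) : W :=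
  ⟨((((2 : ℂ)⁻¹ • (A + star A) : W) : H →L[ℂ] H))⁻, negPart_mem W (Subtype.property _)⟩

/-- `A ↦ (im A)₊` on `W`, where `im A = i (A* - A)/2`. -/
noncomputable def imPos (W : VonNeumannAlgebra H) (A : W) : W :=
  ⟨((((Complex.I / 2 : ℂ) • (star A - A) : W) : H →L[ℂ] H))⁺, posPart_mem W (Subtype.property _)⟩

/-- `A ↦ (im A)₋` on `W`. -/
noncomputable def imNeg (W : VonNeumannAlgebra H) (A : W) : W :=
  ⟨((((Complex.I / 2 : ℂ) • (star A - A) : W) : H →L[ℂ] H))⁻, negPart_mem W (Subtype.property _)⟩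

end SpectralResolution

section Extension

variable {X : Type*} [MeasurableSpace X]
  {H : Type*} [NormedAddCommGroup H] [InnerProductSpace ℂ H] [CompleteSpace H]
  {K : Type*} [NormedAddCommGroup K] [InnerProductSpace ℂ K] [CompleteSpace K]
  {W₁ : VonNeumannAlgebra H} {W₂ : VonNeumannAlgebra K}

/-- For positive `A`, the value of the family `F` on the `ℓ`-th dyadic Riemann sum
`S_ℓ(A) = ∑ₖ (k / 2^ℓ) E((k-1)/2^ℓ, k/2^ℓ]`, `0 ≤ k ≤ ⌈2^ℓ ‖A‖⌉`, of the spectral resolution of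
`A`, that is, `∑ₖ (k / 2^ℓ) F_{E((k-1)/2^ℓ, k/2^ℓ]}(Δ)`. -/
noncomputable def riemannValue (F : Proj W₁ → MSet X → W₂) (A : W₁) (Δ : MSet X) (l : ℕ) : W₂ :=
  ∑ k ∈ Finset.range (⌈(2 : ℝ) ^ l * ‖A‖⌉₊ + 1),
    (((k : ℝ) / 2 ^ l : ℝ) : ℂ) •
      F (spectralProjIn W₁ A (((k : ℝ) - 1) / 2 ^ l) ((k : ℝ) / 2 ^ l)) Δ

/-- For positive `A`: `M_A(Δ)`, the norm limit of `F` along the Riemann sums of `A`. -/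
noncomputable def posExtension (F : Proj W₁ → MSet X → W₂) (A : W₁) (Δ : MSet X) : W₂ :=
  limUnder atTop (riemannValue F A Δ)

/-- For arbitrary `A ∈ W₁`: `M_A(Δ)`, obtained from the positive case through
`A = (re A)₊ - (re A)₋ + i ((im A)₊ - (im A)₋)`. -/
noncomputable def extension (F : Proj W₁ → MSet X → W₂) (A : W₁) (Δ : MSet X) : W₂ :=
  (posExtension F (rePos W₁ A) Δ - posExtension F (reNeg W₁ A) Δ) +
    Complex.I • (posExtension F (imPos W₁ A) Δ - posExtension F (imNeg W₁ A) Δ)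

/-- Real linear relations among hermitian projections are respected by the family. -/
def RespectsLinearRelations (F : Proj W₁ → MSet X → W₂) : Prop :=
  ∀ (n m : ℕ) (a : Fin n → ℝ) (b : Fin m → ℝ) (P : Fin n → Proj W₁) (Q : Fin m → Proj W₁)
    (Δ : MSet X),
    ∑ i, (a i : ℂ) • (P i : W₁) = ∑ j, (b j : ℂ) • (Q j : W₁) →
    ∑ i, (a i : ℂ) • F (P i) Δ = ∑ j, (b j : ℂ) • F (Q j) Δ

/-- For each `Δ`, the operators `F_P(Δ)` are bounded uniformly in `P`. -/
def IsSetwiseBounded (F : Proj W₁ → MSet X → W₂) : Prop :=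
  ∀ Δ : MSet X, ∃ k : ℝ, 0 < k ∧ ∀ P : Proj W₁, ‖F P Δ‖ ≤ k

/-- `M_P(Δ₁) M_Q(Δ₂) = M_{PQ}(Δ₁ ∩ Δ₂)`, where `M_P = F_P` on hermitian projections and
`M_{PQ}` is the extension of the family to the (in general not hermitian) operator `PQ`. -/
def IsMultiplicative (F : Proj W₁ → MSet X → W₂) : Prop :=
  ∀ (P Q : Proj W₁) (Δ₁ Δ₂ : MSet X),
    F P Δ₁ * F Q Δ₂ = extension F ((P : W₁) * (Q : W₁)) (Δ₁ ∩ Δ₂)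

end Extension

end SpectralFamily

set_option linter.unusedSectionVars false

/-! Necessity is a matter of evaluating `M Δ`. It is linear, projections have norm at most one, and
by continuity the Riemann sum construction applied to the family returns `M Δ` itself, so condition
3 is the multiplicativity of `M`.

For sufficiency fix `Δ`. Condition 1 gives a linear map `φ` on the span of the projections of `W₁`,
sending projections to projections. The crux is its boundedness: a bound on projections alone does
not bound a linear map on their span. On a commuting family `φ` is multiplicative and contractive,
so it extends to each single hermitian `A` through simple operators in the bicommutant of `A`. Call
the extension `ψ` (`quasiExt`). A priori `ψ` is additive and multiplicative only on commuting pairs,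
and the `M_A` of condition 3 is built from this `ψ`. The problem is to show that `ψ` agrees with `φ`
on real combinations of arbitrary projections; then `‖φ x‖ ≤ ‖x‖` there, with a factor 2 on complex
combinations.

Condition 3 with `Δ₁ = Δ₂ = Δ` gives the Jordan identity `φ P φ Q + φ Q φ P = ψ (PQ + QP)`
(`map_mul_map_add`). Since `(P - Q)²` commutes with both `P` and `Q`, this controls the algebra of
two projections: `ψ (P - Q) = φ P - φ Q`, `ψ (PQP) = φ P φ Q φ P`, hence `‖φ P φ Q‖² ≤ ‖PQP‖`. A
polar decomposition argument then gives `ψ ((P - c) R (P - c)) = (φ P - c) φ R (φ P - c)`.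

These identities transfer smallness: if `‖EBE‖` is of order `s³` with `B ≥ 0`, then `‖φ E ψ(B) φ E‖`
is of order `s²` (`norm_conj_quasiExt_le`). A spectral partition of mesh `m⁻³` has about `m³`
blocks; each has squared defect of order `m⁻⁶ = s³` with `s = m⁻²`, so its image has squared defect
of order `m⁻⁴`, and the total is of order `1/m`. Run once, this makes `ψ` norm continuous. Run on a
partition of `A + lP` with `A` simple, it gives `ψ (A + lP) = ψ A + l φ P`; continuity removes the
simplicity of `A`, and induction gives `ψ = φ` on real combinations.

Thus `φ` extends by density to `M Δ` with norm at most 2, uniformly in `Δ`. Positivity, countable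
additivity and uniqueness pass from projections to `W₁`, because the projections have dense span. -/

namespace SpectralFamily

/-! ### Spectral projections and spectral partitions of a hermitian operator -/

section SpectralProjections

variable {H : Type*} [NormedAddCommGroup H] [InnerProductSpace ℂ H]

theorem algebraMap_real (r : ℝ) :
    algebraMap ℂ (H →L[ℂ] H) (r : ℂ) = algebraMap ℝ (H →L[ℂ] H) r := by
  ext x; simp [Algebra.algebraMap_eq_smul_one]

variable [CompleteSpace H]

theorem isSelfAdjoint_sub_algebraMap {A : H →L[ℂ] H} (hA : IsSelfAdjoint A) (t : ℝ) :
    IsSelfAdjoint (A - algebraMap ℂ (H →L[ℂ] H) t) :=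
  hA.sub <| (IsSelfAdjoint.algebraMap (H →L[ℂ] H) (r := (t : ℂ)) (by
    simp [isSelfAdjoint_iff]))

theorem posPart_sub_eq_mul {X : H →L[ℂ] H} (hX : IsSelfAdjoint X) {d : ℝ} (hd : 0 < d) :
    ∃ Y : H →L[ℂ] H, (X - algebraMap ℂ (H →L[ℂ] H) d)⁺ = Y * X⁺ := by
  -- The quotient of `(s - d)⁺` by `s⁺`, which matters only for `s > d`; replacing `s⁺` by `max s d
  -- ≥ d > 0` keeps it continuous.
  refine ⟨cfc (fun s : ℝ => (s - d)⁺ / max s d) X, ?_⟩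
  have hg : Continuous fun s : ℝ => (s - d)⁺ / max s d := by
    refine Continuous.div ?_ (by fun_prop) fun s => (lt_max_of_lt_right hd).ne'
    simp only [posPart_def]
    fun_prop
  have hp : Continuous fun s : ℝ => s⁺ := by
    simp only [posPart_def]
    fun_prop
  have h1 : X - algebraMap ℂ (H →L[ℂ] H) d = cfc (fun s : ℝ => s - d) X := by
    rw [cfc_sub (fun s : ℝ => s) (fun _ => d) X, cfc_id' ℝ X, cfc_const d X]
    rw [algebraMap_real]
  rw [h1, CFC.posPart_def, CFC.posPart_def, cfcₙ_eq_cfc (by fun_prop) (by simp),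
    cfcₙ_eq_cfc (by fun_prop) (by simp), ← cfc_comp' (fun s : ℝ => s⁺) (fun s : ℝ => s - d) X
      (by fun_prop) (by fun_prop), ← cfc_mul _ _ X hg.continuousOn hp.continuousOn]
  congr 1
  funext s
  rcases le_total s d with h | h
  · simp [posPart_eq_zero.2 (sub_nonpos.2 h)]
  · have hs : 0 < s := hd.trans_le h
    rw [posPart_of_nonneg (sub_nonneg.2 h), posPart_of_nonneg hs.le, max_eq_left h,
      div_mul_cancel₀ _ hs.ne']

theorem ker_posPart_mono {A : H →L[ℂ] H} (hA : IsSelfAdjoint A) {a b : ℝ} (h : a ≤ b) :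
    ((A - algebraMap ℂ (H →L[ℂ] H) a)⁺).ker ≤ ((A - algebraMap ℂ (H →L[ℂ] H) b)⁺).ker := by
  rcases h.eq_or_lt with rfl | h
  · exact le_rfl
  obtain ⟨Y, hY⟩ := posPart_sub_eq_mul (isSelfAdjoint_sub_algebraMap hA a) (sub_pos.2 h)
  have h2 : A - algebraMap ℂ (H →L[ℂ] H) b =
      A - algebraMap ℂ (H →L[ℂ] H) a - algebraMap ℂ (H →L[ℂ] H) ((b - a : ℝ) : ℂ) := by
    rw [Complex.ofReal_sub, map_sub]; abel
  intro x hx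
  rw [LinearMap.mem_ker] at hx ⊢
  rw [h2, hY]
  change Y _ = 0
  exact (congrArg Y hx).trans (map_zero Y)

instance hasOrthogonalProjection_ker (T : H →L[ℂ] H) : (T.ker).HasOrthogonalProjection := by
  have : CompleteSpace (T.ker) := (ContinuousLinearMap.isClosed_ker T).completeSpace_coe
  infer_instance

/-- The resolution of identity of a hermitian operator. -/
noncomputable def resolution (A : H →L[ℂ] H) (t : ℝ) : H →L[ℂ] H :=
  (((A - algebraMap ℂ (H →L[ℂ] H) t)⁺).ker).starProjection

/-- The kernels increase with the parameter, so `(E(b) - E(a)) x` lies in the spectral subspace and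
its difference from `x` is orthogonal to that subspace. -/
theorem spectralProj_eq_sub {A : H →L[ℂ] H} (hA : IsSelfAdjoint A) {a b : ℝ} (h : a ≤ b) :
    spectralProj A a b = resolution A b - resolution A a := by
  have hm := ker_posPart_mono hA h
  ext x
  refine (Submodule.eq_starProjection_of_mem_of_inner_eq_zero (K := spectralSubspace A a b)
    (u := x) (v := (resolution A b - resolution A a) x) ?_ ?_)
  · refine ⟨sub_mem (Submodule.starProjection_apply_mem _ _)
      (hm (Submodule.starProjection_apply_mem _ _)), ?_⟩
    rw [SetLike.mem_coe, Submodule.mem_orthogonal]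
    intro u hu
    have h1 := Submodule.starProjection_inner_eq_zero
      (K := ((A - algebraMap ℂ (H →L[ℂ] H) a)⁺).ker) x u hu
    have h2 := Submodule.starProjection_inner_eq_zero
      (K := ((A - algebraMap ℂ (H →L[ℂ] H) b)⁺).ker) x u (hm hu)
    rw [← inner_conj_symm, map_eq_zero]
    simp only [resolution, sub_apply]
    rw [inner_sub_left] at h1 h2 ⊢
    rw [← sub_eq_zero.1 h1, ← sub_eq_zero.1 h2, sub_self]
  · intro w hw
    have h2 := Submodule.starProjection_inner_eq_zero
      (K := ((A - algebraMap ℂ (H →L[ℂ] H) b)⁺).ker) x w hw.1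
    have h3 := (Submodule.mem_orthogonal _ _).1 hw.2 _
      (Submodule.starProjection_apply_mem ((A - algebraMap ℂ (H →L[ℂ] H) a)⁺).ker x)
    simp only [resolution, sub_apply]
    rw [sub_sub_eq_add_sub, add_sub_right_comm, inner_add_left, h2, h3, add_zero]

theorem spectralProj_add {A : H →L[ℂ] H} (hA : IsSelfAdjoint A) {a b c : ℝ} (h : a ≤ b)
    (h' : b ≤ c) : spectralProj A a b + spectralProj A b c = spectralProj A a c := by
  rw [spectralProj_eq_sub hA h, spectralProj_eq_sub hA h', spectralProj_eq_sub hA (h.trans h')]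
  abel

theorem resolution_eq_one {A : H →L[ℂ] H} (hA : IsSelfAdjoint A) {b : ℝ} (h : ‖A‖ ≤ b) :
    resolution A b = 1 := by
  have h1 : (A - algebraMap ℂ (H →L[ℂ] H) b)⁺ = 0 := by
    rw [CFC.posPart_eq_zero_iff _ (isSelfAdjoint_sub_algebraMap hA b), sub_nonpos,
      algebraMap_real]
    exact hA.le_algebraMap_norm_self.trans (algebraMap_mono _ h)
  have h2 : ((A - algebraMap ℂ (H →L[ℂ] H) b)⁺).ker = ⊤ := by
    rw [h1]; exact LinearMap.ker_zero
  rw [resolution, ← Submodule.starProjection_top']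
  congr 1

/-- Here `(A - a)⁺ = A - a ≥ c - a > 0` is injective. Strictness matters: `c` itself may be an
eigenvalue. -/
theorem resolution_eq_zero {A : H →L[ℂ] H} {c : ℝ} (hc : algebraMap ℝ (H →L[ℂ] H) c ≤ A) {a : ℝ}
    (h : a < c) : resolution A a = 0 := by
  have h1 : algebraMap ℝ (H →L[ℂ] H) (c - a) ≤ A - algebraMap ℂ (H →L[ℂ] H) a := by
    rw [algebraMap_real, map_sub]
    exact sub_le_sub_right hc _
  have h0 : (0 : H →L[ℂ] H) ≤ algebraMap ℝ (H →L[ℂ] H) (c - a) :=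
    algebraMap_nonneg _ (by linarith)
  have h2 : (A - algebraMap ℂ (H →L[ℂ] H) a)⁺ = A - algebraMap ℂ (H →L[ℂ] H) a :=
    (CFC.posPart_eq_self _).2 (h0.trans h1)
  have h3 : ((A - algebraMap ℂ (H →L[ℂ] H) a)⁺).ker = ⊥ := by
    rw [h2, eq_bot_iff]
    intro x hx
    rw [LinearMap.mem_ker] at hx
    have h4 := (ContinuousLinearMap.le_def _ _).1 h1 |>.re_inner_nonneg_left x
    have h5 : (A - algebraMap ℂ (H →L[ℂ] H) a) x = 0 := hx
    rw [sub_apply, h5, zero_sub, inner_neg_left,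
      ← algebraMap_real, Algebra.algebraMap_eq_smul_one] at h4
    simp only [smul_apply, one_apply_eq_self, inner_smul_left,
      Complex.conj_ofReal, map_neg] at h4
    rw [RCLike.re_to_complex, Complex.re_ofReal_mul, ← RCLike.re_to_complex,
      inner_self_eq_norm_sq] at h4
    rw [Submodule.mem_bot, ← norm_eq_zero]
    have : 0 < c - a := by linarith
    by_contra hne
    have : 0 < ‖x‖ ^ 2 := by positivity
    nlinarith
  rw [resolution, ← Submodule.starProjection_bot]
  congr 1

theorem spectralProj_eq_one {A : H →L[ℂ] H} (hA : IsSelfAdjoint A) {a b c : ℝ}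
    (hc : algebraMap ℝ (H →L[ℂ] H) c ≤ A) (ha : a < c) (hab : a ≤ b) (hb : ‖A‖ ≤ b) :
    spectralProj A a b = 1 := by
  rw [spectralProj_eq_sub hA hab, resolution_eq_one hA hb, resolution_eq_zero hc ha, sub_zero]

theorem commute_starProjection_of_invariant (U : Submodule ℂ H) [U.HasOrthogonalProjection]
    {T : H →L[ℂ] H} (h1 : ∀ x ∈ U, T x ∈ U) (h2 : ∀ x ∈ U, star T x ∈ U) :
    Commute T U.starProjection := by
  have key : ∀ S : H →L[ℂ] H, (∀ x ∈ U, S x ∈ U) →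
      U.starProjection * S * U.starProjection = S * U.starProjection := by
    intro S hS
    ext x
    exact Submodule.starProjection_eq_self_iff.2 (hS _ (Submodule.starProjection_apply_mem _ _))
  have hp : star U.starProjection = U.starProjection := (isSelfAdjoint_starProjection U).star_eq
  have k2 := congrArg star (key _ h2)
  rw [star_mul, star_mul, star_mul, star_star, hp, ← mul_assoc] at k2
  exact (key _ h1).symm.trans k2

theorem commute_resolution {A T : H →L[ℂ] H} (hA : IsSelfAdjoint A) (h : Commute A T) (t : ℝ) :
    Commute T (resolution A t) := by
  have key : ∀ S : H →L[ℂ] H, Commute A S →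
      ∀ x ∈ ((A - algebraMap ℂ (H →L[ℂ] H) t)⁺).ker,
        S x ∈ ((A - algebraMap ℂ (H →L[ℂ] H) t)⁺).ker := by
    intro S hS x hx
    rw [LinearMap.mem_ker] at hx ⊢
    have h1 : Commute (A - algebraMap ℂ (H →L[ℂ] H) t)⁺ S :=
      Commute.cfcₙ_real (hS.sub_left (Algebra.commutes (t : ℂ) S)) (fun x : ℝ => x⁺)
    exact (congrArg (fun Q : H →L[ℂ] H => Q x) h1.eq).trans
      ((congrArg S hx).trans (map_zero S))
  refine commute_starProjection_of_invariant _ (key T h) (key _ ?_)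
  have := h.star_star
  rwa [hA.star_eq] at this

theorem commute_spectralProj {A T : H →L[ℂ] H} (hA : IsSelfAdjoint A) (h : Commute A T)
    {a b : ℝ} (hab : a ≤ b) : Commute T (spectralProj A a b) := by
  rw [spectralProj_eq_sub hA hab]
  exact (commute_resolution hA h b).sub_right (commute_resolution hA h a)

/-- The range of `p` lies in the kernel of `(A - b)⁺`, so `(b - A) p = p (A - b)⁻ p ≥ 0`. -/
theorem mul_spectralProj_le {A : H →L[ℂ] H} (hA : IsSelfAdjoint A) {a b : ℝ} (hab : a ≤ b) :
    A * spectralProj A a b ≤ b • spectralProj A a b := by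
  set p := spectralProj A a b with hp
  have hps : IsStarProjection p := spectralProj_isStarProjection A a b
  have hc : Commute A p := commute_spectralProj hA (Commute.refl A) hab
  have h0 : (A - algebraMap ℂ (H →L[ℂ] H) b)⁺ * p = 0 := by
    ext x
    have : p x ∈ spectralSubspace A a b := Submodule.starProjection_apply_mem _ _
    exact this.1
  have h1 : b • p - A * p = star p * (A - algebraMap ℂ (H →L[ℂ] H) b)⁻ * p := by
    have h2 : (A - algebraMap ℂ (H →L[ℂ] H) b)⁻ * p = b • p - A * p := by
      have := CFC.posPart_sub_negPart _ (isSelfAdjoint_sub_algebraMap hA b)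
      have h3 : (A - algebraMap ℂ (H →L[ℂ] H) b)⁻ =
        (A - algebraMap ℂ (H →L[ℂ] H) b)⁺ - (A - algebraMap ℂ (H →L[ℂ] H) b) := by
          rw [eq_sub_iff_add_eq', ← eq_sub_iff_add_eq]; exact this.symm
      rw [h3, sub_mul, h0, sub_mul, algebraMap_real, Algebra.algebraMap_eq_smul_one,
        smul_mul_assoc, one_mul]
      abel
    rw [mul_assoc, h2, hps.isSelfAdjoint.star_eq, mul_sub, mul_smul_comm, ← mul_assoc,
      ← hc.eq, mul_assoc, hps.isIdempotentElem.eq]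
  rw [← sub_nonneg, h1]
  exact star_left_conjugate_nonneg (CFC.negPart_nonneg _) p

/-- The range of `(A - a)⁻` lies in the kernel of `(A - a)⁺`, to which the range of `p` is
orthogonal; hence `(A - a)⁻ p = 0` and `(A - a) p = p (A - a)⁺ p`. -/
theorem smul_spectralProj_le {A : H →L[ℂ] H} (hA : IsSelfAdjoint A) {a b : ℝ} (hab : a ≤ b) :
    a • spectralProj A a b ≤ A * spectralProj A a b := by
  set p := spectralProj A a b with hp
  have hps : IsStarProjection p := spectralProj_isStarProjection A a b
  have hc : Commute A p := commute_spectralProj hA (Commute.refl A) hab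
  have h0 : (A - algebraMap ℂ (H →L[ℂ] H) a)⁻ * p = 0 := by
    ext x
    have hx : p x ∈ spectralSubspace A a b := Submodule.starProjection_apply_mem _ _
    have hx := (Submodule.mem_orthogonal' _ _).1 hx.2
    refine ext_inner_right ℂ fun y => ?_
    have hs : IsSelfAdjoint ((A - algebraMap ℂ (H →L[ℂ] H) a)⁻) :=
      (CFC.negPart_nonneg _).isSelfAdjoint
    rw [ContinuousLinearMap.isSelfAdjoint_iff'] at hs
    change inner ℂ ((A - algebraMap ℂ (H →L[ℂ] H) a)⁻ (p x)) y = inner ℂ (0 : H) y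
    rw [← ContinuousLinearMap.adjoint_inner_right, hs, inner_zero_left]
    refine hx _ ?_
    rw [LinearMap.mem_ker]
    exact congrArg (fun Q : H →L[ℂ] H => Q y)
      (CFC.posPart_mul_negPart (A - algebraMap ℂ (H →L[ℂ] H) a))
  have h1 : A * p - a • p = star p * (A - algebraMap ℂ (H →L[ℂ] H) a)⁺ * p := by
    have h2 : (A - algebraMap ℂ (H →L[ℂ] H) a)⁺ * p = A * p - a • p := by
      have := CFC.posPart_sub_negPart _ (isSelfAdjoint_sub_algebraMap hA a)
      rw [sub_eq_iff_eq_add.1 this, add_mul, h0, sub_mul, algebraMap_real,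
        Algebra.algebraMap_eq_smul_one, smul_mul_assoc, one_mul, add_zero]
    rw [mul_assoc, h2, hps.isSelfAdjoint.star_eq, mul_sub, mul_smul_comm, ← mul_assoc,
      ← hc.eq, mul_assoc, hps.isIdempotentElem.eq]
  rw [← sub_nonneg, h1]
  exact star_left_conjugate_nonneg (CFC.posPart_nonneg _) p

theorem sum_spectralProj {A : H →L[ℂ] H} (hA : IsSelfAdjoint A) {t : ℕ → ℝ} (ht : Monotone t)
    (N : ℕ) : ∑ k ∈ Finset.range N, spectralProj A (t k) (t (k + 1)) =
      spectralProj A (t 0) (t N) := by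
  induction N with
  | zero => simp [spectralProj_eq_sub hA le_rfl]
  | succ n ih =>
    rw [Finset.sum_range_succ, ih, spectralProj_add hA (ht (Nat.zero_le n)) (ht n.le_succ)]

theorem norm_le_of_neg_le_of_le {X : H →L[ℂ] H} {r : ℝ} (hr : 0 ≤ r)
    (h1 : -algebraMap ℝ (H →L[ℂ] H) r ≤ X) (h2 : X ≤ algebraMap ℝ (H →L[ℂ] H) r) : ‖X‖ ≤ r := by
  have hX : IsSelfAdjoint X := by
    have h3 : IsSelfAdjoint (algebraMap ℝ (H →L[ℂ] H) r - X) := (sub_nonneg.2 h2).isSelfAdjoint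
    have h4 : IsSelfAdjoint (algebraMap ℝ (H →L[ℂ] H) r) := (algebraMap_nonneg _ hr).isSelfAdjoint
    simpa using h4.sub h3
  rw [← cfc_id ℝ X]
  refine norm_cfc_le hr fun x hx => abs_le.2 ⟨?_, ?_⟩
  · rw [← map_neg] at h1
    exact (algebraMap_le_iff_le_spectrum hX).1 h1 x hx
  · exact (le_algebraMap_iff_spectrum_le hX).1 h2 x hx

/-- Each block of the difference lies between `-δ E_k` and `0`. The blocks add up to the identity,
so summing the order bounds costs nothing. -/
theorem norm_sub_riemannSum_le {A : H →L[ℂ] H} (hA : IsSelfAdjoint A) {t : ℕ → ℝ}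
    (ht : Monotone t) {δ : ℝ} (hδ : ∀ k, t (k + 1) - t k ≤ δ) {N : ℕ}
    (h1 : spectralProj A (t 0) (t N) = 1) :
    ‖A - ∑ k ∈ Finset.range N, t (k + 1) • spectralProj A (t k) (t (k + 1))‖ ≤ δ := by
  have hδ0 : 0 ≤ δ := (sub_nonneg.2 (ht (Nat.zero_le 1))).trans (hδ 0)
  have hs := sum_spectralProj hA ht N
  rw [h1] at hs
  have h2 : A - ∑ k ∈ Finset.range N, t (k + 1) • spectralProj A (t k) (t (k + 1)) =
      ∑ k ∈ Finset.range N, (A * spectralProj A (t k) (t (k + 1)) -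
        t (k + 1) • spectralProj A (t k) (t (k + 1))) := by
    rw [Finset.sum_sub_distrib, ← Finset.mul_sum, hs, mul_one]
  rw [h2]
  refine norm_le_of_neg_le_of_le hδ0 ?_ ?_
  · rw [Algebra.algebraMap_eq_smul_one, ← hs, Finset.smul_sum, ← Finset.sum_neg_distrib]
    refine Finset.sum_le_sum fun k _ => ?_
    rw [neg_le_sub_iff_le_add, ← sub_le_iff_le_add, ← sub_smul]
    have := smul_spectralProj_le hA (ht k.le_succ)
    refine le_trans ?_ this
    exact smul_le_smul_of_nonneg_right (by linarith [hδ k])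
      (spectralProj_isStarProjection A _ _).nonneg
  · refine (Finset.sum_nonpos fun k _ => ?_).trans (algebraMap_nonneg _ hδ0)
    exact sub_nonpos.2 (mul_spectralProj_le hA (ht k.le_succ))

theorem norm_mul_spectralProj_sub_le {A : H →L[ℂ] H} (hA : IsSelfAdjoint A) {a b : ℝ}
    (hab : a ≤ b) : ‖A * spectralProj A a b - b • spectralProj A a b‖ ≤ b - a := by
  refine norm_le_of_neg_le_of_le (sub_nonneg.2 hab) ?_ ?_
  · rw [neg_le_sub_iff_le_add, ← sub_le_iff_le_add]
    have h1 := smul_spectralProj_le hA hab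
    have h2 : (b - a) • spectralProj A a b ≤ algebraMap ℝ _ (b - a) := by
      rw [Algebra.algebraMap_eq_smul_one]
      exact smul_le_smul_of_nonneg_left (spectralProj_isStarProjection A _ _).le_one
        (sub_nonneg.2 hab)
    rw [sub_smul] at h2
    calc _ ≤ b • spectralProj A a b - (b • spectralProj A a b - a • spectralProj A a b) :=
          sub_le_sub_left h2 _
      _ = a • spectralProj A a b := by abel
      _ ≤ _ := h1
  · exact (sub_nonpos.2 (mul_spectralProj_le hA hab)).trans
      (algebraMap_nonneg _ (sub_nonneg.2 hab))

/-- Compressing `∑ E_i = 1` by `E_k` leaves a vanishing sum of positive operators `E_k E_i E_k`, `i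
≠ k`. Each is zero, and `E_k E_j E_k = (E_j E_k)* (E_j E_k)`. -/
theorem mul_eq_zero_of_sum_eq_one {N : ℕ} {E : ℕ → H →L[ℂ] H}
    (hE : ∀ k, IsStarProjection (E k)) (hs : ∑ k ∈ Finset.range N, E k = 1) {j k : ℕ}
    (hj : j < N) (hk : k < N) (hjk : j ≠ k) : E j * E k = 0 := by
  have h1 : ∑ i ∈ (Finset.range N).erase k, star (E k) * E i * E k = 0 := by
    have h2 : ∑ i ∈ Finset.range N, star (E k) * E i * E k = E k := by
      rw [← Finset.sum_mul, ← Finset.mul_sum, hs, mul_one, (hE k).isSelfAdjoint.star_eq,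
        (hE k).isIdempotentElem.eq]
    rw [← Finset.add_sum_erase _ _ (Finset.mem_range.2 hk), (hE k).isSelfAdjoint.star_eq,
      (hE k).isIdempotentElem.eq, (hE k).isIdempotentElem.eq] at h2
    rw [(hE k).isSelfAdjoint.star_eq]
    simpa using h2
  have h3 := (Finset.sum_eq_zero_iff_of_nonneg fun i _ =>
    star_left_conjugate_nonneg (hE i).nonneg (E k)).1 h1 j
    (Finset.mem_erase.2 ⟨hjk, Finset.mem_range.2 hj⟩)
  have h4 : star (E j * E k) * (E j * E k) = 0 := by
    rw [star_mul, (hE j).isSelfAdjoint.star_eq, mul_assoc, ← mul_assoc (E j),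
      (hE j).isIdempotentElem.eq, ← mul_assoc, h3]
  exact CStarRing.star_mul_self_eq_zero_iff _ |>.1 h4

/-- A spectral partition of a hermitian operator with mesh `1 / n`. -/
theorem exists_spectral_partition {A : H →L[ℂ] H} (hA : IsSelfAdjoint A) {M n : ℕ}
    (hM : ‖A‖ < M) (hn : 0 < n) :
    ∃ (t : ℕ → ℝ) (E : ℕ → H →L[ℂ] H), (∀ k, IsStarProjection (E k)) ∧
      (∀ k (W : VonNeumannAlgebra H), A ∈ W → E k ∈ W) ∧
      (∀ k T, Commute A T → Commute T (E k)) ∧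
      (∑ k ∈ Finset.range (2 * M * n), E k = 1) ∧
      (∀ k ∈ Finset.range (2 * M * n), |t k| ≤ M) ∧
      (∀ k, ‖A * E k - t k • E k‖ ≤ 1 / n) ∧
      ‖A - ∑ k ∈ Finset.range (2 * M * n), t k • E k‖ ≤ 1 / n := by
  have hn' : (0 : ℝ) < n := by exact_mod_cast hn
  set t : ℕ → ℝ := fun k => -M + k / n with ht
  have hmono : Monotone t := fun i j hij => by
    simp only [ht]; gcongr
  have hstep : ∀ k, t (k + 1) - t k = 1 / n := fun k => by
    simp only [ht]; push_cast; field_simp; ring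
  have hN : t (2 * M * n) = M := by
    simp only [ht]; push_cast; field_simp; ring
  have h0 : t 0 = -M := by simp [ht]
  -- The intervals are open on the left, so `-M` has to be strictly below the spectrum; this is
  -- where `‖A‖ < M` is strict.
  have h1 : spectralProj A (t 0) (t (2 * M * n)) = 1 := by
    refine spectralProj_eq_one hA (c := -‖A‖) ?_ ?_ (hmono (Nat.zero_le _)) ?_
    · rw [map_neg]; exact hA.neg_algebraMap_norm_le_self
    · rw [h0]; linarith
    · rw [hN]; exact hM.le
  refine ⟨fun k => t (k + 1), fun k => spectralProj A (t k) (t (k + 1)),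
    fun k => spectralProj_isStarProjection _ _ _, fun k W hW => spectralProj_mem W hW _ _,
    fun k T hT => commute_spectralProj hA hT (hmono k.le_succ), ?_, ?_, ?_, ?_⟩
  · rw [sum_spectralProj hA hmono, h1]
  · intro k hk
    have h2 := hmono (Nat.zero_le (k + 1))
    have h3 := hmono (Nat.succ_le_of_lt (Finset.mem_range.1 hk))
    rw [h0] at h2
    rw [hN] at h3
    exact abs_le.2 ⟨h2, h3⟩
  · intro k
    rw [← hstep k]
    exact norm_mul_spectralProj_sub_le hA (hmono k.le_succ)
  · exact norm_sub_riemannSum_le hA hmono (fun k => (hstep k).le) h1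

end SpectralProjections

/-! ### Linear maps preserving projections, on commuting families -/

section CommutingProjections

variable {H : Type*} [NormedAddCommGroup H] [InnerProductSpace ℂ H] [CompleteSpace H]
  {K : Type*} [NormedAddCommGroup K] [InnerProductSpace ℂ K] [CompleteSpace K]

/-- Idempotence of the sum says `pq + qp = 0`. Multiplying by `p` on either side gives `pq = -pqp =
qp`, so `2pq = 0`. -/
theorem mul_eq_zero_of_isIdempotentElem_add {R : Type*} [Ring R] [Module ℂ R] {p q : R}
    (hp : IsIdempotentElem p) (hq : IsIdempotentElem q) (h : IsIdempotentElem (p + q)) :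
    p * q = 0 := by
  have h1 : p * q + q * p = 0 := by
    have := h.eq
    rw [add_mul, mul_add, mul_add, hp.eq, hq.eq] at this
    have h2 : p * q + q * p = (p + p * q + (q * p + q)) - (p + q) := by abel
    rw [h2, this, sub_self]
  have h2 : p * q + p * q * p = 0 := by
    have := congrArg (p * ·) h1
    simp only [mul_add, mul_zero, ← mul_assoc, hp.eq] at this
    exact this
  have h3 : p * q * p + q * p = 0 := by
    have := congrArg (· * p) h1
    simp only [add_mul, zero_mul, mul_assoc, hp.eq] at this
    rw [mul_assoc]
    exact this
  have h4 : p * q = q * p := by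
    rw [eq_neg_of_add_eq_zero_left h2, eq_neg_of_add_eq_zero_right h3]
  rw [← h4] at h1
  have h5 : (2 : ℂ) • (p * q) = 0 := by rw [two_smul, h1]
  have := congrArg ((2⁻¹ : ℂ) • ·) h5
  simpa [smul_smul] using this

variable {W : VonNeumannAlgebra H} {φ : (H →L[ℂ] H) →ₗ[ℂ] (K →L[ℂ] K)}

theorem isStarProjection_mul {P Q : H →L[ℂ] H} (hP : IsStarProjection P) (hQ : IsStarProjection Q)
    (h : Commute P Q) : IsStarProjection (P * Q) :=
  ⟨hP.isIdempotentElem.mul_of_commute h hQ.isIdempotentElem,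
    (hP.isSelfAdjoint.commute_iff hQ.isSelfAdjoint).1 h⟩

/-- Orthogonal projections have a projection as sum, so their images are orthogonal too. Splitting
`P = PQ + P(1 - Q)` and `Q = PQ + Q(1 - P)` into mutually orthogonal pieces leaves only `φ (PQ)² = φ
(PQ)`. -/
theorem map_mul_of_commute_projections
    (hφ : ∀ P ∈ W, IsStarProjection P → IsStarProjection (φ P)) {P Q : H →L[ℂ] H}
    (hPW : P ∈ W) (hQW : Q ∈ W) (hP : IsStarProjection P) (hQ : IsStarProjection Q)
    (h : Commute P Q) : φ (P * Q) = φ P * φ Q := by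
  have orth : ∀ p ∈ W, ∀ q ∈ W, IsStarProjection p → IsStarProjection q → p * q = 0 →
      q * p = 0 → φ p * φ q = 0 := by
    intro p hp q hq hp' hq' h1 h2
    refine mul_eq_zero_of_isIdempotentElem_add (hφ p hp hp').isIdempotentElem
      (hφ q hq hq').isIdempotentElem ?_
    rw [← map_add]
    refine (hφ _ (add_mem hp hq) ⟨?_, hp'.isSelfAdjoint.add hq'.isSelfAdjoint⟩).isIdempotentElem
    rw [IsIdempotentElem, add_mul, mul_add, mul_add, h1, h2, hp'.isIdempotentElem.eq,
      hq'.isIdempotentElem.eq, add_zero, zero_add]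
  have hPQ := isStarProjection_mul hP hQ h
  have hPQW := mul_mem hPW hQW
  have sub : ∀ p ∈ W, ∀ q ∈ W, IsStarProjection p → IsStarProjection q → Commute p q →
      IsStarProjection (p * (1 - q)) := fun p _ q _ hp hq h =>
    isStarProjection_mul hp hq.one_sub ((Commute.one_right _).sub_right h)
  have e1 : P = P * Q + P * (1 - Q) := by rw [← mul_add, add_sub_cancel, mul_one]
  have e2 : Q = P * Q + Q * (1 - P) := by rw [h.eq, ← mul_add, add_sub_cancel, mul_one]
  have hA := sub P hPW Q hQW hP hQ h
  have hB := sub Q hQW P hPW hQ hP h.symm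
  have hAW : P * (1 - Q) ∈ W := mul_mem hPW (sub_mem (one_mem _) hQW)
  have hBW : Q * (1 - P) ∈ W := mul_mem hQW (sub_mem (one_mem _) hPW)
  have cQ := hQ.mul_one_sub_self
  have cQ' := hQ.one_sub_mul_self
  have cP := hP.mul_one_sub_self
  have cP' := hP.one_sub_mul_self
  have hc1 : Commute (1 - Q) P := (Commute.one_left _).sub_left h.symm
  have hc2 : Commute (1 - P) Q := (Commute.one_left _).sub_left h
  have z1 : φ (P * Q) * φ (Q * (1 - P)) = 0 := by
    refine orth _ hPQW _ hBW hPQ hB ?_ ?_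
    · rw [← hc2.eq, h.eq, mul_assoc, ← mul_assoc P, cP, zero_mul, mul_zero]
    · rw [mul_assoc, ← mul_assoc (1 - P), cP', zero_mul, mul_zero]
  have z2 : φ (P * (1 - Q)) * φ (P * Q) = 0 := by
    refine orth _ hAW _ hPQW hA hPQ ?_ ?_
    · rw [h.eq, mul_assoc, ← mul_assoc (1 - Q), cQ', zero_mul, mul_zero]
    · rw [← hc1.eq, mul_assoc, ← mul_assoc Q, cQ, zero_mul, mul_zero]
  have z3 : φ (P * (1 - Q)) * φ (Q * (1 - P)) = 0 := by
    refine orth _ hAW _ hBW hA hB ?_ ?_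
    · rw [mul_assoc, ← mul_assoc (1 - Q), cQ', zero_mul, mul_zero]
    · rw [mul_assoc, ← mul_assoc (1 - P), cP', zero_mul, mul_zero]
  have f1 := congrArg φ e1
  have f2 := congrArg φ e2
  rw [map_add] at f1 f2
  rw [f1, f2, add_mul, mul_add, mul_add, z1, z2, z3, (hφ _ hPQW hPQ).isIdempotentElem.eq]
  simp

theorem span_mul_mem {R : Type*} [Ring R] [Algebra ℂ R] {D : Set R}
    (hm : ∀ P ∈ D, ∀ Q ∈ D, P * Q ∈ D) {x y : R} (hx : x ∈ Submodule.span ℂ D)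
    (hy : y ∈ Submodule.span ℂ D) : x * y ∈ Submodule.span ℂ D := by
  have h := Submodule.mul_mem_mul hx hy
  rw [Submodule.span_mul_span] at h
  refine Submodule.span_mono ?_ h
  rintro _ ⟨a, ha, b, hb, rfl⟩
  exact hm a ha b hb

theorem map_mul_of_mem_span {D : Set (H →L[ℂ] H)}
    (h : ∀ P ∈ D, ∀ Q ∈ D, φ (P * Q) = φ P * φ Q) {x y : H →L[ℂ] H}
    (hx : x ∈ Submodule.span ℂ D) (hy : y ∈ Submodule.span ℂ D) : φ (x * y) = φ x * φ y := by
  induction hx, hy using Submodule.span_induction₂ with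
  | mem_mem x y hx hy => exact h x hx y hy
  | zero_left y hy => simp
  | zero_right x hx => simp
  | add_left x y z _ _ _ h1 h2 => rw [add_mul, map_add, map_add, h1, h2, add_mul]
  | add_right x y z _ _ _ h1 h2 => rw [mul_add, map_add, map_add, h1, h2, mul_add]
  | smul_left r x y _ _ h1 => rw [smul_mul_assoc, map_smul, h1, map_smul, smul_mul_assoc]
  | smul_right r x y _ _ h1 => rw [mul_smul_comm, map_smul, h1, map_smul, mul_smul_comm]

theorem star_mem_span_projections {D : Set (H →L[ℂ] H)} (hD : ∀ P ∈ D, IsStarProjection P)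
    {x : H →L[ℂ] H} (hx : x ∈ Submodule.span ℂ D) : star x ∈ Submodule.span ℂ D := by
  induction hx using Submodule.span_induction with
  | mem x hx => rw [(hD x hx).isSelfAdjoint.star_eq]; exact Submodule.subset_span hx
  | zero => simp
  | add x y _ _ h1 h2 => rw [star_add]; exact add_mem h1 h2
  | smul r x _ h1 => rw [star_smul]; exact Submodule.smul_mem _ _ h1

theorem map_star_of_mem_span {D : Set (H →L[ℂ] H)} (hD : ∀ P ∈ D, IsStarProjection P)
    (hφ : ∀ P ∈ D, IsStarProjection (φ P)) {x : H →L[ℂ] H} (hx : x ∈ Submodule.span ℂ D) :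
    φ (star x) = star (φ x) := by
  induction hx using Submodule.span_induction with
  | mem x hx => rw [(hD x hx).isSelfAdjoint.star_eq, (hφ x hx).isSelfAdjoint.star_eq]
  | zero => simp
  | add x y _ _ h1 h2 => rw [star_add, map_add, map_add, h1, h2, star_add]
  | smul r x _ h1 => rw [star_smul, map_smul, map_smul, h1, star_smul]

/-- Adjoining one idempotent `p` to a closed set `T'` only adds `p` and `p T'`. This provides a
finite-dimensional algebra, on which any linear map is bounded. -/
theorem exists_finite_mul_closed {R : Type*} [Monoid R] {D : Set R}
    (hi : ∀ P ∈ D, IsIdempotentElem P) (hc : ∀ P ∈ D, ∀ Q ∈ D, Commute P Q)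
    (hm : ∀ P ∈ D, ∀ Q ∈ D, P * Q ∈ D) (T : Set R) (hT : T.Finite) (hTD : T ⊆ D) :
    ∃ T' : Set R, T'.Finite ∧ T ⊆ T' ∧ T' ⊆ D ∧ ∀ P ∈ T', ∀ Q ∈ T', P * Q ∈ T' := by
  induction T, hT using Set.Finite.induction_on with
  | empty => exact ⟨∅, Set.finite_empty, le_rfl, Set.empty_subset _, by simp⟩
  | @insert p T _ _ ih =>
    obtain ⟨T', hf, hTT, hTD', hmul⟩ := ih fun x hx => hTD (Set.mem_insert_of_mem _ hx)
    have hp : p ∈ D := hTD (Set.mem_insert _ _)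
    refine ⟨insert p (T' ∪ (p * ·) '' T'), (hf.union (hf.image _)).insert p, ?_, ?_, ?_⟩
    · exact Set.insert_subset_insert (hTT.trans Set.subset_union_left)
    · rintro x (rfl | hx | ⟨y, hy, rfl⟩)
      · exact hp
      · exact hTD' hx
      · exact hm _ hp _ (hTD' hy)
    · have hpp : ∀ x, p * (p * x) = p * x := fun x => by rw [← mul_assoc, (hi p hp).eq]
      have hcc : ∀ x ∈ T', x * p = p * x := fun x hx => (hc _ (hTD' hx) _ hp).eq
      rintro x (rfl | hx | ⟨x, hx, rfl⟩) y (rfl | hy | ⟨y, hy, rfl⟩)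
      · left; exact (hi _ hp).eq
      · right; right; exact ⟨y, hy, rfl⟩
      · right; right; exact ⟨y, hy, (hpp y).symm⟩
      · right; right; exact ⟨x, hx, (hcc x hx).symm⟩
      · right; left; exact hmul _ hx _ hy
      · right; right; refine ⟨x * y, hmul _ hx _ hy, ?_⟩
        simp only [← mul_assoc, hcc x hx]
      · right; right; exact ⟨x, hx, by simp only; rw [mul_assoc, hcc x hx, hpp]⟩
      · right; right; exact ⟨x * y, hmul _ hx _ hy, by simp only [mul_assoc]⟩
      · right; right; refine ⟨x * y, hmul _ hx _ hy, ?_⟩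
        simp only
        rw [mul_assoc, ← mul_assoc x, hcc x hx, mul_assoc, hpp]

theorem le_of_forall_pow_two_pow_le {a b C : ℝ} (hb : 0 ≤ b)
    (h : ∀ n : ℕ, a ^ 2 ^ n ≤ C * b ^ 2 ^ n) : a ≤ b := by
  by_contra! hlt
  rcases hb.eq_or_lt with rfl | hb
  · have := h 0
    simp at this
    linarith
  · have hr : 1 < a / b := (one_lt_div hb).2 hlt
    obtain ⟨n, hn⟩ := pow_unbounded_of_one_lt C hr
    have h1 : (a / b) ^ n ≤ (a / b) ^ 2 ^ n :=
      pow_le_pow_right₀ hr.le n.lt_two_pow_self.le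
    have h2 : (a / b) ^ 2 ^ n ≤ C := by
      rw [div_pow, div_le_iff₀ (by positivity)]
      exact h n
    linarith

/-- A hermitian `x` lies in a finite-dimensional span closed under products, where `φ` has some
bound `C`. Multiplicativity and the C*-identity give `‖φ x‖ ^ 2 ^ n ≤ C ‖x‖ ^ 2 ^ n` for all `n`,
which forces the constant down to 1. General `x` reduces to `x* x`. -/
theorem norm_map_le_of_commuting_projections {D : Set (H →L[ℂ] H)}
    (hD : ∀ P ∈ D, IsStarProjection P) (hφ : ∀ P ∈ D, IsStarProjection (φ P))
    (hc : ∀ P ∈ D, ∀ Q ∈ D, Commute P Q) (hm : ∀ P ∈ D, ∀ Q ∈ D, P * Q ∈ D)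
    (hmul : ∀ P ∈ D, ∀ Q ∈ D, φ (P * Q) = φ P * φ Q) {x : H →L[ℂ] H}
    (hx : x ∈ Submodule.span ℂ D) : ‖φ x‖ ≤ ‖x‖ := by
  have main : ∀ x ∈ Submodule.span ℂ D, IsSelfAdjoint x → ‖φ x‖ ≤ ‖x‖ := by
    intro x hx hsa
    obtain ⟨T, hTD, hxT⟩ := Submodule.mem_span_finite_of_mem_span hx
    obtain ⟨T', hf, hTT, hTD', hTm⟩ := exists_finite_mul_closed
      (fun P hP => (hD P hP).isIdempotentElem) hc hm T T.finite_toSet hTD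
    have hxT' : x ∈ Submodule.span ℂ T' := Submodule.span_mono hTT hxT
    have : FiniteDimensional ℂ (Submodule.span ℂ T') := FiniteDimensional.span_of_finite ℂ hf
    set f := LinearMap.toContinuousLinearMap (φ.comp (Submodule.span ℂ T').subtype) with hfdef
    have hbound : ∀ y ∈ Submodule.span ℂ T', ‖φ y‖ ≤ ‖f‖ * ‖y‖ := fun y hy =>
      f.le_opNorm ⟨y, hy⟩
    have hsa' : IsSelfAdjoint (φ x) := by
      have := map_star_of_mem_span hD hφ hx
      rw [hsa.star_eq] at this
      exact this.symm
    have hpow : ∀ n : ℕ, x ^ 2 ^ n ∈ Submodule.span ℂ T' ∧ φ (x ^ 2 ^ n) = φ x ^ 2 ^ n := by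
      intro n
      induction n with
      | zero => simpa using hxT'
      | succ n ih =>
        have h1 := span_mul_mem hTm ih.1 ih.1
        have h2 := map_mul_of_mem_span (φ := φ)
          (fun P hP Q hQ => hmul P (hTD' hP) Q (hTD' hQ)) ih.1 ih.1
        rw [pow_succ, mul_two, pow_add, pow_add]
        exact ⟨h1, by rw [h2, ih.2]⟩
    refine le_of_forall_pow_two_pow_le (C := ‖f‖) (norm_nonneg _) fun n => ?_
    have h1 : ‖φ x ^ 2 ^ n‖ = ‖φ x‖ ^ 2 ^ n := by
      simpa using congrArg NNReal.toReal (hsa'.nnnorm_pow_two_pow n)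
    have h2 : ‖x ^ 2 ^ n‖ = ‖x‖ ^ 2 ^ n := by
      simpa using congrArg NNReal.toReal (hsa.nnnorm_pow_two_pow n)
    rw [← h1, ← h2, ← (hpow n).2]
    exact hbound _ (hpow n).1
  have hs := star_mem_span_projections hD hx
  have h1 := main _ (span_mul_mem hm hs hx) (IsSelfAdjoint.star_mul_self x)
  rw [map_mul_of_mem_span hmul hs hx, map_star_of_mem_span hD hφ hx,
    CStarRing.norm_star_mul_self, CStarRing.norm_star_mul_self] at h1
  exact le_of_sq_le_sq (by simpa [sq] using h1) (norm_nonneg _)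

end CommutingProjections

/-! ### Extension to single hermitian operators -/

section QuasiExtension

variable {H : Type*} [NormedAddCommGroup H] [InnerProductSpace ℂ H] [CompleteSpace H]
  {K : Type*} [NormedAddCommGroup K] [InnerProductSpace ℂ K] [CompleteSpace K]

/-- The projections of `W` in the bicommutant of `S`. -/
def bicommutantProj (W : VonNeumannAlgebra H) (S : Set (H →L[ℂ] H)) : Set (H →L[ℂ] H) :=
  {P | P ∈ W ∧ IsStarProjection P ∧ P ∈ S.centralizer.centralizer}

/-- The combinations of the projections of `W` in the bicommutant of `S`. -/
def simpleSpan (W : VonNeumannAlgebra H) (S : Set (H →L[ℂ] H)) : Submodule ℂ (H →L[ℂ] H) :=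
  Submodule.span ℂ (bicommutantProj W S)

/-- The extension of `φ` from the simple operators in the bicommutant of `A` to `A`. -/
noncomputable def quasiExt (W : VonNeumannAlgebra H) (φ : (H →L[ℂ] H) →ₗ[ℂ] (K →L[ℂ] K))
    (A : H →L[ℂ] H) : K →L[ℂ] K :=
  extendFrom (simpleSpan W {A} : Set (H →L[ℂ] H)) φ A

/-- `S` consists of pairwise commuting operators. -/
def PairwiseCommute (S : Set (H →L[ℂ] H)) : Prop := ∀ x ∈ S, ∀ y ∈ S, x * y = y * x

theorem pairwiseCommute_singleton (A : H →L[ℂ] H) : PairwiseCommute {A} := by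
  rintro x rfl y rfl; rfl

theorem pairwiseCommute_pair {A B : H →L[ℂ] H} (h : Commute A B) : PairwiseCommute {A, B} := by
  rintro x (rfl | rfl) y (rfl | rfl)
  · rfl
  · exact h.eq
  · exact h.eq.symm
  · rfl

variable {W : VonNeumannAlgebra H} {φ : (H →L[ℂ] H) →ₗ[ℂ] (K →L[ℂ] K)} {S : Set (H →L[ℂ] H)}

theorem bicommutantProj_commute (hS : PairwiseCommute S) :
    ∀ P ∈ bicommutantProj W S, ∀ Q ∈ bicommutantProj W S, Commute P Q := fun P hP Q hQ =>
  Set.centralizer_centralizer_comm_of_comm hS P hP.2.2 Q hQ.2.2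

theorem bicommutantProj_mul (hS : PairwiseCommute S) :
    ∀ P ∈ bicommutantProj W S, ∀ Q ∈ bicommutantProj W S, P * Q ∈ bicommutantProj W S :=
  fun P hP Q hQ => ⟨mul_mem hP.1 hQ.1,
    isStarProjection_mul hP.2.1 hQ.2.1 (bicommutantProj_commute hS P hP Q hQ),
    Set.mul_mem_centralizer hP.2.2 hQ.2.2⟩

theorem simpleSpan_mono {A : H →L[ℂ] H} (hA : A ∈ S.centralizer.centralizer) :
    simpleSpan W {A} ≤ simpleSpan W S := by
  refine Submodule.span_mono fun P hP => ⟨hP.1, hP.2.1, ?_⟩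
  have h1 : S.centralizer ⊆ Set.centralizer {A} := by
    rintro T hT x rfl
    exact (hA T hT).symm
  exact Set.centralizer_subset h1 hP.2.2

theorem simpleSpan_mul_mem (hS : PairwiseCommute S) {x y : H →L[ℂ] H} (hx : x ∈ simpleSpan W S)
    (hy : y ∈ simpleSpan W S) : x * y ∈ simpleSpan W S :=
  span_mul_mem (bicommutantProj_mul hS) hx hy

theorem map_mul_simpleSpan (hφ : ∀ P ∈ W, IsStarProjection P → IsStarProjection (φ P))
    (hS : PairwiseCommute S) {x y : H →L[ℂ] H} (hx : x ∈ simpleSpan W S)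
    (hy : y ∈ simpleSpan W S) : φ (x * y) = φ x * φ y :=
  map_mul_of_mem_span (fun P hP Q hQ => map_mul_of_commute_projections hφ hP.1 hQ.1 hP.2.1 hQ.2.1
    (bicommutantProj_commute hS P hP Q hQ)) hx hy

theorem norm_map_simpleSpan_le (hφ : ∀ P ∈ W, IsStarProjection P → IsStarProjection (φ P))
    (hS : PairwiseCommute S) {x : H →L[ℂ] H} (hx : x ∈ simpleSpan W S) : ‖φ x‖ ≤ ‖x‖ :=
  norm_map_le_of_commuting_projections (fun _ hP => hP.2.1) (fun P hP => hφ P hP.1 hP.2.1)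
    (bicommutantProj_commute hS) (bicommutantProj_mul hS)
    (fun P hP Q hQ => map_mul_of_commute_projections hφ hP.1 hQ.1 hP.2.1 hQ.2.1
      (bicommutantProj_commute hS P hP Q hQ)) hx

theorem real_smul_eq_complex_smul (r : ℝ) (A : H →L[ℂ] H) : r • A = (r : ℂ) • A := by
  ext x; simp

theorem mem_bicommutant {A : H →L[ℂ] H} (hA : A ∈ S) : A ∈ S.centralizer.centralizer :=
  Set.subset_centralizer_centralizer hA

theorem mem_closure_simpleSpan {A : H →L[ℂ] H} (hA : IsSelfAdjoint A) (hW : A ∈ W) :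
    A ∈ closure (simpleSpan W {A} : Set (H →L[ℂ] H)) := by
  rw [Metric.mem_closure_iff]
  intro ε hε
  obtain ⟨M, hM⟩ := exists_nat_gt ‖A‖
  obtain ⟨n, hn⟩ := exists_nat_one_div_lt hε
  obtain ⟨t, E, hE, hEW, hEc, -, -, -, hn'⟩ :=
    exists_spectral_partition hA hM (Nat.succ_pos n)
  refine ⟨_, sum_mem fun k _ => ?_, ((dist_eq_norm _ _).trans_le hn').trans_lt ?_⟩
  · rw [real_smul_eq_complex_smul]
    refine Submodule.smul_mem _ _ (Submodule.subset_span ⟨hEW k W hW, hE k, fun T hT => ?_⟩)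
    exact hEc k T (hT A rfl)
  · simpa using hn

/-- Contractivity of `φ` on the larger span makes its values near `A` Cauchy, and restricting the
limit to the span belonging to `A` identifies it. The freedom in `S` lets commuting operators be
approximated inside one commutative algebra. -/
theorem tendsto_quasiExt (hφ : ∀ P ∈ W, IsStarProjection P → IsStarProjection (φ P))
    (hS : PairwiseCommute S) {A : H →L[ℂ] H} (hA : IsSelfAdjoint A) (hW : A ∈ W)
    (hAS : A ∈ S.centralizer.centralizer) :
    Tendsto φ (𝓝[(simpleSpan W S : Set (H →L[ℂ] H))] A) (𝓝 (quasiExt W φ A)) := by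
  have hcl := mem_closure_simpleSpan hA hW
  have hsub : (simpleSpan W {A} : Set (H →L[ℂ] H)) ⊆ simpleSpan W S := simpleSpan_mono hAS
  have hcl' := closure_mono hsub hcl
  have : (𝓝[(simpleSpan W S : Set (H →L[ℂ] H))] A).NeBot := mem_closure_iff_nhdsWithin_neBot.1 hcl'
  have hlip : LipschitzOnWith 1 φ (simpleSpan W S : Set (H →L[ℂ] H)) := by
    refine LipschitzOnWith.of_dist_le_mul fun x hx y hy => ?_
    rw [dist_eq_norm, dist_eq_norm, ← map_sub, NNReal.coe_one, one_mul]
    exact norm_map_simpleSpan_le hφ hS (sub_mem hx hy)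
  have hc : Cauchy (map φ (𝓝[(simpleSpan W S : Set (H →L[ℂ] H))] A)) :=
    Cauchy.map_of_le (cauchy_nhds.mono nhdsWithin_le_nhds) hlip.uniformContinuousOn
      inf_le_right
  obtain ⟨y, hy⟩ := CompleteSpace.complete hc
  have hy : Tendsto φ (𝓝[(simpleSpan W S : Set (H →L[ℂ] H))] A) (𝓝 y) := hy
  have := extendFrom_eq hcl (hy.mono_left (nhdsWithin_mono _ hsub))
  rw [quasiExt, this]
  exact hy

theorem tendsto_quasiExt_of_seq (hφ : ∀ P ∈ W, IsStarProjection P → IsStarProjection (φ P))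
    (hS : PairwiseCommute S) {A : H →L[ℂ] H} (hA : IsSelfAdjoint A) (hW : A ∈ W)
    (hAS : A ∈ S.centralizer.centralizer) {s : ℕ → H →L[ℂ] H}
    (hs : ∀ n, s n ∈ simpleSpan W S) (hsA : Tendsto s atTop (𝓝 A)) :
    Tendsto (fun n => φ (s n)) atTop (𝓝 (quasiExt W φ A)) :=
  (tendsto_quasiExt hφ hS hA hW hAS).comp
    (tendsto_nhdsWithin_iff.2 ⟨hsA, Eventually.of_forall hs⟩)

theorem exists_seq_simpleSpan {A : H →L[ℂ] H} (hA : IsSelfAdjoint A) (hW : A ∈ W)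
    (hAS : A ∈ S.centralizer.centralizer) :
    ∃ s : ℕ → H →L[ℂ] H, (∀ n, s n ∈ simpleSpan W S) ∧ Tendsto s atTop (𝓝 A) := by
  obtain ⟨s, hs, h⟩ := mem_closure_iff_seq_limit.1 (mem_closure_simpleSpan hA hW)
  exact ⟨s, fun n => simpleSpan_mono hAS (hs n), h⟩

theorem quasiExt_proj (hφ : ∀ P ∈ W, IsStarProjection P → IsStarProjection (φ P))
    {P : H →L[ℂ] H} (hW : P ∈ W) (hP : IsStarProjection P) : quasiExt W φ P = φ P := by
  have h1 : P ∈ simpleSpan W {P} := Submodule.subset_span ⟨hW, hP, mem_bicommutant rfl⟩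
  exact tendsto_nhds_unique (tendsto_quasiExt_of_seq hφ (pairwiseCommute_singleton P)
    hP.isSelfAdjoint hW (mem_bicommutant rfl) (fun _ => h1) tendsto_const_nhds) tendsto_const_nhds

/-- Commutation supplies simple approximants of `A`, `B` and `A + B` in the common bicommutant of
`{A, B}`. Additivity of `ψ` without commutation is the hard point, settled only later and with the
Jordan identity. -/
theorem quasiExt_add (hφ : ∀ P ∈ W, IsStarProjection P → IsStarProjection (φ P))
    {A B : H →L[ℂ] H} (hA : IsSelfAdjoint A) (hAW : A ∈ W) (hB : IsSelfAdjoint B) (hBW : B ∈ W)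
    (h : Commute A B) : quasiExt W φ (A + B) = quasiExt W φ A + quasiExt W φ B := by
  have hS := pairwiseCommute_pair h
  have hA' : A ∈ ({A, B} : Set (H →L[ℂ] H)).centralizer.centralizer :=
    mem_bicommutant (Set.mem_insert _ _)
  have hB' : B ∈ ({A, B} : Set (H →L[ℂ] H)).centralizer.centralizer :=
    mem_bicommutant (Set.mem_insert_of_mem _ rfl)
  obtain ⟨s, hs, hsA⟩ := exists_seq_simpleSpan hA hAW hA'
  obtain ⟨u, hu, huB⟩ := exists_seq_simpleSpan hB hBW hB'
  have h1 := tendsto_quasiExt_of_seq hφ hS (hA.add hB) (add_mem hAW hBW)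
    (Set.add_mem_centralizer hA' hB') (fun n => add_mem (hs n) (hu n)) (hsA.add huB)
  simp only [map_add] at h1
  exact tendsto_nhds_unique h1 ((tendsto_quasiExt_of_seq hφ hS hA hAW hA' hs hsA).add
    (tendsto_quasiExt_of_seq hφ hS hB hBW hB' hu huB))

theorem quasiExt_mul (hφ : ∀ P ∈ W, IsStarProjection P → IsStarProjection (φ P))
    {A B : H →L[ℂ] H} (hA : IsSelfAdjoint A) (hAW : A ∈ W) (hB : IsSelfAdjoint B) (hBW : B ∈ W)
    (h : Commute A B) : quasiExt W φ (A * B) = quasiExt W φ A * quasiExt W φ B := by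
  have hS := pairwiseCommute_pair h
  have hA' : A ∈ ({A, B} : Set (H →L[ℂ] H)).centralizer.centralizer :=
    mem_bicommutant (Set.mem_insert _ _)
  have hB' : B ∈ ({A, B} : Set (H →L[ℂ] H)).centralizer.centralizer :=
    mem_bicommutant (Set.mem_insert_of_mem _ rfl)
  obtain ⟨s, hs, hsA⟩ := exists_seq_simpleSpan hA hAW hA'
  obtain ⟨u, hu, huB⟩ := exists_seq_simpleSpan hB hBW hB'
  have h1 := tendsto_quasiExt_of_seq hφ hS ((hA.commute_iff hB).1 h) (mul_mem hAW hBW)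
    (Set.mul_mem_centralizer hA' hB') (fun n => simpleSpan_mul_mem hS (hs n) (hu n))
    (hsA.mul huB)
  simp only [map_mul_simpleSpan hφ hS (hs _) (hu _)] at h1
  exact tendsto_nhds_unique h1 ((tendsto_quasiExt_of_seq hφ hS hA hAW hA' hs hsA).mul
    (tendsto_quasiExt_of_seq hφ hS hB hBW hB' hu huB))

theorem quasiExt_smul (hφ : ∀ P ∈ W, IsStarProjection P → IsStarProjection (φ P))
    {A : H →L[ℂ] H} (hA : IsSelfAdjoint A) (hAW : A ∈ W) (r : ℝ) :
    quasiExt W φ (r • A) = r • quasiExt W φ A := by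
  have hS := pairwiseCommute_singleton A
  have hA' : A ∈ ({A} : Set (H →L[ℂ] H)).centralizer.centralizer := mem_bicommutant rfl
  obtain ⟨s, hs, hsA⟩ := exists_seq_simpleSpan hA hAW hA'
  have hrW : r • A ∈ W := by rw [real_smul_eq_complex_smul]; exact SMulMemClass.smul_mem _ hAW
  have hr : r • A ∈ ({A} : Set (H →L[ℂ] H)).centralizer.centralizer := fun T hT => by
    rw [mul_smul_comm, smul_mul_assoc, hA' T hT]
  have h1 := tendsto_quasiExt_of_seq hφ hS ((IsSelfAdjoint.all r).smul hA) hrW hr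
    (s := fun n => r • s n)
    (fun n => by
      simp only [real_smul_eq_complex_smul]
      exact Submodule.smul_mem _ _ (hs n)) (hsA.const_smul r)
  simp only [real_smul_eq_complex_smul, map_smul] at h1 ⊢
  exact tendsto_nhds_unique h1
    ((tendsto_quasiExt_of_seq hφ hS hA hAW hA' hs hsA).const_smul (r : ℂ))

theorem norm_quasiExt_le (hφ : ∀ P ∈ W, IsStarProjection P → IsStarProjection (φ P))
    {A : H →L[ℂ] H} (hA : IsSelfAdjoint A) (hAW : A ∈ W) : ‖quasiExt W φ A‖ ≤ ‖A‖ := by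
  have hS := pairwiseCommute_singleton A
  have hA' : A ∈ ({A} : Set (H →L[ℂ] H)).centralizer.centralizer := mem_bicommutant rfl
  obtain ⟨s, hs, hsA⟩ := exists_seq_simpleSpan hA hAW hA'
  exact le_of_tendsto_of_tendsto' (tendsto_quasiExt_of_seq hφ hS hA hAW hA' hs hsA).norm
    hsA.norm fun n => norm_map_simpleSpan_le hφ hS (hs n)

theorem isSelfAdjoint_quasiExt (hφ : ∀ P ∈ W, IsStarProjection P → IsStarProjection (φ P))
    {A : H →L[ℂ] H} (hA : IsSelfAdjoint A) (hAW : A ∈ W) : IsSelfAdjoint (quasiExt W φ A) := by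
  have hS := pairwiseCommute_singleton A
  have hA' : A ∈ ({A} : Set (H →L[ℂ] H)).centralizer.centralizer := mem_bicommutant rfl
  obtain ⟨s, hs, hsA⟩ := exists_seq_simpleSpan hA hAW hA'
  have h1 := hsA.star
  rw [hA.star_eq] at h1
  have h2 := tendsto_quasiExt_of_seq hφ hS hA hAW hA'
    (fun n => star_mem_span_projections (fun _ hP => hP.2.1) (hs n)) h1
  have h3 := (tendsto_quasiExt_of_seq hφ hS hA hAW hA' hs hsA).star
  refine tendsto_nhds_unique h3 (h2.congr fun n => ?_)
  exact map_star_of_mem_span (fun _ hP => hP.2.1) (fun P hP => hφ P hP.1 hP.2.1) (hs n)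

end QuasiExtension

/-! ### The Jordan identity and two non-commuting projections -/

section TwoProjections

variable {H : Type*} [NormedAddCommGroup H] [InnerProductSpace ℂ H] [CompleteSpace H]
  {K : Type*} [NormedAddCommGroup K] [InnerProductSpace ℂ K] [CompleteSpace K]
  {W : VonNeumannAlgebra H} {φ : (H →L[ℂ] H) →ₗ[ℂ] (K →L[ℂ] K)}

theorem real_smul_mem {A : H →L[ℂ] H} (hA : A ∈ W) (r : ℝ) : r • A ∈ W := by
  rw [real_smul_eq_complex_smul]; exact SMulMemClass.smul_mem _ hA

theorem quasiExt_sub (hφ : ∀ P ∈ W, IsStarProjection P → IsStarProjection (φ P))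
    {A B : H →L[ℂ] H} (hA : IsSelfAdjoint A) (hAW : A ∈ W) (hB : IsSelfAdjoint B) (hBW : B ∈ W)
    (h : Commute A B) : quasiExt W φ (A - B) = quasiExt W φ A - quasiExt W φ B := by
  have h1 : A - B = A + (-1 : ℝ) • B := by rw [neg_one_smul, sub_eq_add_neg]
  rw [h1, quasiExt_add hφ hA hAW ((IsSelfAdjoint.all _).smul hB) (real_smul_mem hBW _)
    (h.smul_right _), quasiExt_smul hφ hB hBW, neg_one_smul, sub_eq_add_neg]

theorem map_mul_one_proj (hφ : ∀ P ∈ W, IsStarProjection P → IsStarProjection (φ P))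
    {P : H →L[ℂ] H} (hPW : P ∈ W) (hP : IsStarProjection P) : φ P * φ 1 = φ P := by
  rw [← map_mul_of_commute_projections hφ hPW (one_mem W) hP (.one _) (Commute.one_right P),
    mul_one]

theorem map_one_mul_proj (hφ : ∀ P ∈ W, IsStarProjection P → IsStarProjection (φ P))
    {P : H →L[ℂ] H} (hPW : P ∈ W) (hP : IsStarProjection P) : φ 1 * φ P = φ P := by
  rw [← map_mul_of_commute_projections hφ (one_mem W) hPW (.one _) hP (Commute.one_left P),
    one_mul]

theorem quasiExt_mul_one (hφ : ∀ P ∈ W, IsStarProjection P → IsStarProjection (φ P))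
    {A : H →L[ℂ] H} (hA : IsSelfAdjoint A) (hAW : A ∈ W) :
    quasiExt W φ A * φ 1 = quasiExt W φ A := by
  have := quasiExt_mul hφ hA hAW (.one _) (one_mem W) (Commute.one_right A)
  rw [mul_one, quasiExt_proj hφ (one_mem W) (.one _)] at this
  exact this.symm

theorem quasiExt_one_mul (hφ : ∀ P ∈ W, IsStarProjection P → IsStarProjection (φ P))
    {A : H →L[ℂ] H} (hA : IsSelfAdjoint A) (hAW : A ∈ W) :
    φ 1 * quasiExt W φ A = quasiExt W φ A := by
  have := quasiExt_mul hφ (.one _) (one_mem W) hA hAW (Commute.one_left A)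
  rw [one_mul, quasiExt_proj hφ (one_mem W) (.one _)] at this
  exact this.symm

theorem quasiExt_commute (hφ : ∀ P ∈ W, IsStarProjection P → IsStarProjection (φ P))
    {A B : H →L[ℂ] H} (hA : IsSelfAdjoint A) (hAW : A ∈ W) (hB : IsSelfAdjoint B) (hBW : B ∈ W)
    (h : Commute A B) : Commute (quasiExt W φ A) (quasiExt W φ B) := by
  rw [Commute, SemiconjBy, ← quasiExt_mul hφ hA hAW hB hBW h, ← quasiExt_mul hφ hB hBW hA hAW h.symm,
    h.eq]

/-- With `d = P - Q` one has `P(1 - Q) + (1 - Q)P = d + d²`, so the Jordan identity for `P` and `1 -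
Q` computes `ψ d + (ψ d)²`. Exchanging `P` and `Q` changes the sign of `d` only; subtracting the two
identities isolates `2 ψ d`. -/
theorem quasiExt_sub_proj (hφ : ∀ P ∈ W, IsStarProjection P → IsStarProjection (φ P))
    (hJ : ∀ P ∈ W, ∀ Q ∈ W, IsStarProjection P → IsStarProjection Q →
      φ P * φ Q + φ Q * φ P = quasiExt W φ (P * Q + Q * P))
    {P Q : H →L[ℂ] H} (hPW : P ∈ W) (hQW : Q ∈ W) (hP : IsStarProjection P)
    (hQ : IsStarProjection Q) : quasiExt W φ (P - Q) = φ P - φ Q := by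
  have key : ∀ P ∈ W, ∀ Q ∈ W, IsStarProjection P → IsStarProjection Q →
      quasiExt W φ (P - Q) + quasiExt W φ (P - Q) * quasiExt W φ (P - Q) =
        (φ P - φ Q) + (φ P - φ Q) * (φ P - φ Q) := by
    intro P hPW Q hQW hP hQ
    have hd := hP.isSelfAdjoint.sub hQ.isSelfAdjoint
    have hdW := sub_mem hPW hQW
    have h1 := hJ P hPW (1 - Q) (sub_mem (one_mem _) hQW) hP hQ.one_sub
    have h2 : P * (1 - Q) + (1 - Q) * P = (P - Q) + (P - Q) * (P - Q) := by
      have e1 := hP.isIdempotentElem.eq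
      have e2 := hQ.isIdempotentElem.eq
      simp only [mul_sub, sub_mul, mul_one, one_mul, e1, e2]
      abel
    rw [h2, quasiExt_add hφ hd hdW ((hd.commute_iff hd).1 (Commute.refl _)) (mul_mem hdW hdW)
      ((Commute.refl _).mul_right (Commute.refl _)),
      quasiExt_mul hφ hd hdW hd hdW (Commute.refl _)] at h1
    rw [← h1, map_sub]
    have e1 := (hφ P hPW hP).isIdempotentElem.eq
    have e2 := (hφ Q hQW hQ).isIdempotentElem.eq
    simp only [mul_sub, sub_mul, map_mul_one_proj hφ hPW hP, map_one_mul_proj hφ hPW hP, e1, e2]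
    abel
  have h1 := key P hPW Q hQW hP hQ
  have h2 := key Q hQW P hPW hQ hP
  have h3 : quasiExt W φ (Q - P) = -quasiExt W φ (P - Q) := by
    have := quasiExt_smul hφ (hP.isSelfAdjoint.sub hQ.isSelfAdjoint) (sub_mem hPW hQW) (-1)
    rwa [neg_one_smul, neg_one_smul, neg_sub] at this
  rw [h3, neg_mul_neg, ← neg_sub (φ P) (φ Q), neg_mul_neg] at h2
  have h4 : (2 : ℂ) • quasiExt W φ (P - Q) = (2 : ℂ) • (φ P - φ Q) := by
    have := congrArg₂ (· - ·) h1 h2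
    simp only [add_sub_add_right_eq_sub, sub_neg_eq_add, ← two_smul ℂ] at this
    exact this
  exact smul_right_injective _ two_ne_zero h4

theorem quasiExt_sq_sub_proj (hφ : ∀ P ∈ W, IsStarProjection P → IsStarProjection (φ P))
    (hJ : ∀ P ∈ W, ∀ Q ∈ W, IsStarProjection P → IsStarProjection Q →
      φ P * φ Q + φ Q * φ P = quasiExt W φ (P * Q + Q * P))
    {P Q : H →L[ℂ] H} (hPW : P ∈ W) (hQW : Q ∈ W) (hP : IsStarProjection P)
    (hQ : IsStarProjection Q) :
    quasiExt W φ ((P - Q) * (P - Q)) = (φ P - φ Q) * (φ P - φ Q) := by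
  have hd := hP.isSelfAdjoint.sub hQ.isSelfAdjoint
  have hdW := sub_mem hPW hQW
  rw [quasiExt_mul hφ hd hdW hd hdW (Commute.refl _), quasiExt_sub_proj hφ hJ hPW hQW hP hQ]

theorem isSelfAdjoint_mul_self {R : Type*} [Mul R] [StarMul R] {A : R} (hA : IsSelfAdjoint A) :
    IsSelfAdjoint (A * A) := (hA.commute_iff hA).1 (Commute.refl A)

/-- The element `(P - Q)² = P + Q - PQ - QP` is central in the algebra generated by two idempotents.
It is what reduces non-commuting products to commuting ones, where `ψ` can be computed. -/
theorem commute_sq_sub_left {R : Type*} [Ring R] {P Q : R} (hP : IsIdempotentElem P)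
    (hQ : IsIdempotentElem Q) : Commute P ((P - Q) * (P - Q)) := by
  rw [Commute, SemiconjBy]
  have e1 := hP.eq
  have e2 := hQ.eq
  have e3 : ∀ x, P * (P * x) = P * x := fun x => by rw [← mul_assoc, e1]
  simp only [mul_sub, sub_mul, mul_assoc, e1, e2, e3]
  abel

theorem commute_sq_sub_right {R : Type*} [Ring R] {P Q : R} (hP : IsIdempotentElem P)
    (hQ : IsIdempotentElem Q) : Commute Q ((P - Q) * (P - Q)) := by
  have := commute_sq_sub_left hQ hP
  rwa [← neg_sub P Q, neg_mul_neg] at this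

theorem mul_mul_self_eq_sub {R : Type*} [Ring R] {P Q : R} (hP : IsIdempotentElem P)
    (hQ : IsIdempotentElem Q) : P * Q * P = P - P * ((P - Q) * (P - Q)) := by
  have e1 := hP.eq
  have e2 := hQ.eq
  have e3 : ∀ x, P * (P * x) = P * x := fun x => by rw [← mul_assoc, e1]
  simp only [mul_sub, sub_mul, mul_assoc, e1, e2, e3]
  abel

/-- Since `PQP = P - P (P - Q)²` involves only commuting operators, `ψ` can be computed term by
term; the same identity read backwards for the images closes the argument. -/
theorem quasiExt_conj_proj (hφ : ∀ P ∈ W, IsStarProjection P → IsStarProjection (φ P))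
    (hJ : ∀ P ∈ W, ∀ Q ∈ W, IsStarProjection P → IsStarProjection Q →
      φ P * φ Q + φ Q * φ P = quasiExt W φ (P * Q + Q * P))
    {P Q : H →L[ℂ] H} (hPW : P ∈ W) (hQW : Q ∈ W) (hP : IsStarProjection P)
    (hQ : IsStarProjection Q) : quasiExt W φ (P * Q * P) = φ P * φ Q * φ P := by
  have hc := commute_sq_sub_left hP.isIdempotentElem hQ.isIdempotentElem
  have hd := isSelfAdjoint_mul_self (hP.isSelfAdjoint.sub hQ.isSelfAdjoint)
  have hdW := mul_mem (sub_mem hPW hQW) (sub_mem hPW hQW)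
  rw [mul_mul_self_eq_sub hP.isIdempotentElem hQ.isIdempotentElem,
    mul_mul_self_eq_sub (hφ P hPW hP).isIdempotentElem (hφ Q hQW hQ).isIdempotentElem,
    quasiExt_sub hφ hP.isSelfAdjoint hPW ((hP.isSelfAdjoint.commute_iff hd).1 hc)
      (mul_mem hPW hdW) ((Commute.refl P).mul_right hc),
    quasiExt_mul hφ hP.isSelfAdjoint hPW hd hdW hc, quasiExt_proj hφ hPW hP,
    quasiExt_sq_sub_proj hφ hJ hPW hQW hP hQ]

/-- The left side is `‖φ P φ Q φ P‖ = ‖ψ (PQP)‖`, and `ψ` is contractive on hermitian operators.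
This is the estimate that carries small angles over to the images. -/
theorem norm_map_mul_map_le (hφ : ∀ P ∈ W, IsStarProjection P → IsStarProjection (φ P))
    (hJ : ∀ P ∈ W, ∀ Q ∈ W, IsStarProjection P → IsStarProjection Q →
      φ P * φ Q + φ Q * φ P = quasiExt W φ (P * Q + Q * P))
    {P Q : H →L[ℂ] H} (hPW : P ∈ W) (hQW : Q ∈ W) (hP : IsStarProjection P)
    (hQ : IsStarProjection Q) : ‖φ P * φ Q‖ ^ 2 ≤ ‖P * Q * P‖ := by
  have h1 : ‖φ P * φ Q‖ ^ 2 = ‖φ P * φ Q * φ P‖ := by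
    rw [sq, ← CStarRing.norm_self_mul_star, star_mul, (hφ P hPW hP).isSelfAdjoint.star_eq,
      (hφ Q hQW hQ).isSelfAdjoint.star_eq, mul_assoc, ← mul_assoc (φ Q),
      (hφ Q hQW hQ).isIdempotentElem.eq, mul_assoc]
  rw [h1, ← quasiExt_conj_proj hφ hJ hPW hQW hP hQ]
  refine norm_quasiExt_le hφ ?_ (mul_mem (mul_mem hPW hQW) hPW)
  have := hQ.isSelfAdjoint.conjugate P
  rwa [hP.isSelfAdjoint.star_eq] at this

end TwoProjections

/-! ### Algebraic identities for symmetries `2P - e` -/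

section Symmetries

variable {R : Type*} [Ring R] [Algebra ℝ R]

theorem anticommutator_symmetries {L P e : R} (hL : IsIdempotentElem L) (hP : IsIdempotentElem P)
    (he : IsIdempotentElem e) (h1 : e * L = L) (h2 : L * e = L) (h3 : e * P = P) (h4 : P * e = P) :
    ((2 : ℝ) • L - e) * ((2 : ℝ) • P - e) + ((2 : ℝ) • P - e) * ((2 : ℝ) • L - e) =
      (2 : ℝ) • e - (4 : ℝ) • ((L - P) * (L - P)) := by
  simp only [mul_sub, sub_mul, smul_mul_assoc, mul_smul_comm, hL.eq, hP.eq, he.eq, h1, h2, h3, h4,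
    smul_sub]
  module

theorem symmetry_mul_self {P e : R} (hP : IsIdempotentElem P)
    (he : IsIdempotentElem e) (h3 : e * P = P) (h4 : P * e = P) :
    ((2 : ℝ) • P - e) * ((2 : ℝ) • P - e) = e := by
  simp only [mul_sub, sub_mul, smul_mul_assoc, mul_smul_comm, hP.eq, he.eq, h3, h4]
  module

theorem combination_mul_self {y z p r e k : R} (hy : y * e = y) (hz : z * e = z)
    (hyz : Commute y z) (hyp : Commute y p) (hyr : Commute y r) (hzp : Commute z p)
    (hzr : Commute z r) (hp : p * p = e) (hr : r * r = e) (hk : p * r + r * p = k) :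
    (y * p + z * r) * (y * p + z * r) = y * y + z * z + y * z * k := by
  rw [add_mul, mul_add, mul_add, hyp.symm.mul_mul_mul_comm, hzp.symm.mul_mul_mul_comm,
    hyr.symm.mul_mul_mul_comm, hzr.symm.mul_mul_mul_comm, hp, hr, ← hk, mul_assoc y y, hy,
    mul_assoc z z, hz, mul_add, hyz.symm.eq]
  abel

theorem combination_anticommutator {y z p r : R} (hyp : Commute y p) (hzp : Commute z p)
    (hp : p * p = 1) :
    (y * p + z * r) * p + p * (y * p + z * r) = (2 : ℝ) • y + z * (p * r + r * p) := by
  rw [mul_add, add_mul, mul_assoc, hp, ← mul_assoc p y, ← hyp.eq, mul_assoc y, hp, ← mul_assoc p z,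
    ← hzp.eq, mul_assoc, mul_assoc, mul_add, mul_one]
  module

/-- A Gram computation: with coefficients commuting with the symmetries, the square of `x l - y p -
z r` depends only on the coefficients and the anticommutators of `l, p, r`. It vanishes once `h1`,
`h2` prescribe the pairings with `p` and `r`, and `h3` the square of `x`. These relations involve
commuting operators only, hence survive `ψ`. -/
theorem gram_mul_self_eq_zero {x y z l p r e kp kr k : R} (hx : x * e = x) (hy : y * e = y)
    (hz : z * e = z) (hxy : Commute x y) (hxz : Commute x z) (hyz : Commute y z)
    (hxl : Commute x l) (hxp : Commute x p) (hxr : Commute x r)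
    (hyl : Commute y l) (hyp : Commute y p) (hyr : Commute y r)
    (hzl : Commute z l) (hzp : Commute z p) (hzr : Commute z r)
    (hl : l * l = e) (hp : p * p = e) (hr : r * r = e)
    (hkp : l * p + p * l = kp) (hkr : l * r + r * l = kr) (hk : p * r + r * p = k)
    (h1 : x * kp = (2 : ℝ) • y + z * k) (h2 : x * kr = (2 : ℝ) • z + y * k)
    (h3 : x * x = y * y + z * z + y * z * k) :
    (x * l - (y * p + z * r)) * (x * l - (y * p + z * r)) = 0 := by
  have e1 : x * l * (y * p + z * r) + (y * p + z * r) * (x * l) =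
      (2 : ℝ) • (y * y + z * z + y * z * k) := by
    rw [add_mul, mul_add, hyl.symm.mul_mul_mul_comm, hzl.symm.mul_mul_mul_comm,
      hxp.symm.mul_mul_mul_comm, hxr.symm.mul_mul_mul_comm, ← hxy.eq, ← hxz.eq]
    have : x * y * (l * p) + x * z * (l * r) + (x * y * (p * l) + x * z * (r * l)) =
        y * (x * kp) + z * (x * kr) := by
      have ey : ∀ A, y * (x * A) = x * y * A := fun A => by rw [← mul_assoc, hxy.eq]
      have ez : ∀ A, z * (x * A) = x * z * A := fun A => by rw [← mul_assoc, hxz.eq]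
      rw [← hkp, ← hkr, ey, ez, mul_add, mul_add]
      abel
    rw [this, h1, h2, mul_add, mul_add, mul_smul_comm, mul_smul_comm, ← mul_assoc, ← mul_assoc,
      hyz.symm.eq]
    module
  have e2 : x * l * (x * l) = y * y + z * z + y * z * k := by
    rw [hxl.symm.mul_mul_mul_comm, hl, mul_assoc, hx, h3]
  have e3 := combination_mul_self hy hz hyz hyp hyr hzp hzr hp hr hk
  rw [sub_mul, mul_sub, mul_sub, e2, e3]
  have : ∀ A B C D : R, B + C = (2 : ℝ) • D → D - B - (C - D) = 0 := by
    intro A B C D h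
    have : D - B - (C - D) = (2 : ℝ) • D - (B + C) := by module
    rw [this, h, sub_self]
  exact this 0 _ _ _ e1

/-- Writes the conjugate as `cC + (1 - c - C) p + (c² - c) r` with `C = (p - r)²`: a combination of
`p` and `r` with coefficients commuting with both. -/
theorem conj_sub_smul_eq {p r : R} (hp : IsIdempotentElem p) (hr : IsIdempotentElem r) (c : ℝ) :
    (p - c • (1 : R)) * r * (p - c • (1 : R)) = c • ((p - r) * (p - r)) +
      (((1 - c) • p - (p - r) * (p - r) * p) + (c ^ 2 - c) • r) := by
  simp only [mul_sub, sub_mul, smul_mul_assoc, mul_smul_comm, hp.eq, hr.eq, mul_assoc,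
    mul_one, one_mul, smul_sub]
  module

end Symmetries

/-! ### Additivity on two projections with commuting coefficients -/

section TwoProjectionsCalculus

variable {H : Type*} [NormedAddCommGroup H] [InnerProductSpace ℂ H] [CompleteSpace H]
  {K : Type*} [NormedAddCommGroup K] [InnerProductSpace ℂ K] [CompleteSpace K]
  {W : VonNeumannAlgebra H} {φ : (H →L[ℂ] H) →ₗ[ℂ] (K →L[ℂ] K)}

/-- Polar decomposition with `L` the spectral projection for `(0, ‖S‖]`, so the sign is `-1` on the
kernel, and `w = |S|`. As the positive root of `S²`, `w` commutes with everything `S²` commutes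
with, which may be more than what `S` commutes with. -/
theorem exists_sign_decomposition {S : H →L[ℂ] H} (hS : IsSelfAdjoint S) (hSW : S ∈ W) :
    ∃ L w : H →L[ℂ] H, L ∈ W ∧ IsStarProjection L ∧ w ∈ W ∧ IsSelfAdjoint w ∧ Commute w L ∧
      S = w * ((2 : ℝ) • L - 1) ∧ w * w = S * S ∧ (∀ T, Commute S T → Commute T L) ∧
      ∀ T, Commute (S * S) T → Commute w T := by
  have h0 : (0 : ℝ) ≤ ‖S‖ := norm_nonneg S
  set L := spectralProj S 0 ‖S‖ with hL
  have hLp : IsStarProjection L := spectralProj_isStarProjection S 0 ‖S‖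
  have hcL : ∀ T, Commute S T → Commute T L := fun T hT => commute_spectralProj hS hT h0
  have hSL : Commute S L := hcL S (Commute.refl S)
  have hLW : L ∈ W := spectralProj_mem W hSW _ _
  have h1 : 1 - L = spectralProj S (-‖S‖ - 1) 0 := by
    rw [sub_eq_iff_eq_add, hL, spectralProj_add hS (by linarith) h0,
      spectralProj_eq_one hS (c := -‖S‖) (by rw [map_neg]; exact hS.neg_algebraMap_norm_le_self)
        (by linarith) (by linarith) le_rfl]
  have hU : ((2 : ℝ) • L - 1) * ((2 : ℝ) • L - 1) = 1 :=
    symmetry_mul_self hLp.isIdempotentElem (IsIdempotentElem.one) (one_mul L) (mul_one L)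
  have hSU : Commute S ((2 : ℝ) • L - 1) := (hSL.smul_right _).sub_right (Commute.one_right S)
  have hUsa : IsSelfAdjoint ((2 : ℝ) • L - 1) :=
    ((IsSelfAdjoint.all (2 : ℝ)).smul hLp.isSelfAdjoint).sub (.one _)
  have hpos : 0 ≤ S * ((2 : ℝ) • L - 1) := by
    have h2 : S * ((2 : ℝ) • L - 1) = S * L - S * (1 - L) := by
      rw [← mul_sub]; congr 1; module
    have h3 := smul_spectralProj_le hS h0
    have h4 := mul_spectralProj_le hS (a := -‖S‖ - 1) (b := 0) (by linarith)
    rw [zero_smul] at h3 h4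
    rw [h2, h1]
    exact sub_nonneg.2 (h4.trans h3)
  have hsq : S * ((2 : ℝ) • L - 1) * (S * ((2 : ℝ) • L - 1)) = S * S := by
    rw [hSU.symm.mul_mul_mul_comm, hU, mul_one]
  refine ⟨L, S * ((2 : ℝ) • L - 1), hLW, hLp,
    mul_mem hSW (sub_mem (real_smul_mem hLW _) (one_mem _)), (hS.commute_iff hUsa).1 hSU, ?_, ?_,
    hsq, hcL, ?_⟩
  · exact hSL.mul_left (((Commute.refl L).smul_left _).sub_left (Commute.one_left L))
  · rw [mul_assoc, hU, mul_one]
  · intro T hT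
    rw [← CFC.sqrt_unique hsq hpos]
    exact Commute.cfcₙ_nnreal hT _

theorem quasiExt_symmetry (hφ : ∀ P ∈ W, IsStarProjection P → IsStarProjection (φ P))
    {P : H →L[ℂ] H} (hPW : P ∈ W) (hP : IsStarProjection P) :
    quasiExt W φ ((2 : ℝ) • P - 1) = (2 : ℝ) • φ P - φ 1 := by
  rw [quasiExt_sub hφ ((IsSelfAdjoint.all _).smul hP.isSelfAdjoint) (real_smul_mem hPW _) (.one _)
    (one_mem W) (Commute.one_right _), quasiExt_smul hφ hP.isSelfAdjoint hPW,
    quasiExt_proj hφ hPW hP, quasiExt_proj hφ (one_mem W) (.one _)]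

theorem quasiExt_anticommutator (hφ : ∀ P ∈ W, IsStarProjection P → IsStarProjection (φ P))
    (hJ : ∀ P ∈ W, ∀ Q ∈ W, IsStarProjection P → IsStarProjection Q →
      φ P * φ Q + φ Q * φ P = quasiExt W φ (P * Q + Q * P))
    {P Q : H →L[ℂ] H} (hPW : P ∈ W) (hQW : Q ∈ W) (hP : IsStarProjection P)
    (hQ : IsStarProjection Q) :
    ((2 : ℝ) • φ P - φ 1) * ((2 : ℝ) • φ Q - φ 1) + ((2 : ℝ) • φ Q - φ 1) * ((2 : ℝ) • φ P - φ 1) =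
      quasiExt W φ ((2 : ℝ) • 1 - (4 : ℝ) • ((P - Q) * (P - Q))) := by
  have hd := isSelfAdjoint_mul_self (hP.isSelfAdjoint.sub hQ.isSelfAdjoint)
  have hdW := mul_mem (sub_mem hPW hQW) (sub_mem hPW hQW)
  rw [anticommutator_symmetries (hφ P hPW hP).isIdempotentElem (hφ Q hQW hQ).isIdempotentElem
    (hφ 1 (one_mem W) (.one _)).isIdempotentElem (map_one_mul_proj hφ hPW hP)
    (map_mul_one_proj hφ hPW hP) (map_one_mul_proj hφ hQW hQ) (map_mul_one_proj hφ hQW hQ),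
    quasiExt_sub hφ ((IsSelfAdjoint.all _).smul (.one _)) (real_smul_mem (one_mem W) _)
      ((IsSelfAdjoint.all _).smul hd) (real_smul_mem hdW _)
      ((Commute.one_left _).smul_left _), quasiExt_smul hφ (.one _) (one_mem W),
    quasiExt_smul hφ hd hdW, quasiExt_proj hφ (one_mem W) (.one _),
    quasiExt_sq_sub_proj hφ hJ hPW hQW hP hQ]

/-- Put `p = 2P - 1`, `r = 2R - 1`, `S = a p + b r`. Its square `a² + b² + ab(pr + rp)` commutes
with `a, b, P, R`, so in `S = w (2L - 1)` the modulus `w` commutes with them too. The pairings of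
`S` with `p` and `r` and the value of `w²` are relations between commuting operators, so `ψ`
preserves them, and the Gram computation gives `ψ S = ψ a (2 φ P - φ 1) + ψ b (2 φ R - φ 1)`. -/
theorem quasiExt_mul_proj_add_mul_proj
    (hφ : ∀ P ∈ W, IsStarProjection P → IsStarProjection (φ P))
    (hJ : ∀ P ∈ W, ∀ Q ∈ W, IsStarProjection P → IsStarProjection Q →
      φ P * φ Q + φ Q * φ P = quasiExt W φ (P * Q + Q * P))
    {P R a b : H →L[ℂ] H} (hPW : P ∈ W) (hRW : R ∈ W) (hP : IsStarProjection P)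
    (hR : IsStarProjection R) (haW : a ∈ W) (hbW : b ∈ W) (ha : IsSelfAdjoint a)
    (hb : IsSelfAdjoint b) (hab : Commute a b) (haP : Commute a P) (haR : Commute a R)
    (hbP : Commute b P) (hbR : Commute b R) :
    quasiExt W φ (a * P + b * R) = quasiExt W φ a * φ P + quasiExt W φ b * φ R := by
  have sym : ∀ {c Q : H →L[ℂ] H}, Commute c Q → Commute c ((2 : ℝ) • Q - 1) := fun h =>
    (h.smul_right _).sub_right (Commute.one_right _)
  have symsa : ∀ {Q : H →L[ℂ] H}, IsStarProjection Q → IsSelfAdjoint ((2 : ℝ) • Q - 1) :=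
    fun h => ((IsSelfAdjoint.all (2 : ℝ)).smul h.isSelfAdjoint).sub (.one _)
  have symW : ∀ {Q : H →L[ℂ] H}, Q ∈ W → ((2 : ℝ) • Q - 1) ∈ W := fun h =>
    sub_mem (real_smul_mem h _) (one_mem W)
  have hUU : ∀ {Q : H →L[ℂ] H}, IsStarProjection Q → ((2 : ℝ) • Q - 1) * ((2 : ℝ) • Q - 1) = 1 :=
    fun h => symmetry_mul_self h.isIdempotentElem .one (one_mul _) (mul_one _)
  have huu : ∀ {Q : H →L[ℂ] H}, Q ∈ W → IsStarProjection Q →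
      ((2 : ℝ) • φ Q - φ 1) * ((2 : ℝ) • φ Q - φ 1) = φ 1 := fun h h' =>
    symmetry_mul_self (hφ _ h h').isIdempotentElem (hφ 1 (one_mem W) (.one _)).isIdempotentElem
      (map_one_mul_proj hφ h h') (map_mul_one_proj hφ h h')
  have hac : ∀ {Q Q' : H →L[ℂ] H}, IsStarProjection Q → IsStarProjection Q' →
      ((2 : ℝ) • Q - 1) * ((2 : ℝ) • Q' - 1) + ((2 : ℝ) • Q' - 1) * ((2 : ℝ) • Q - 1) =
        (2 : ℝ) • 1 - (4 : ℝ) • ((Q - Q') * (Q - Q')) := fun h h' =>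
    anticommutator_symmetries h.isIdempotentElem h'.isIdempotentElem .one (one_mul _) (mul_one _)
      (one_mul _) (mul_one _)
  have kksa : ∀ {Q Q' : H →L[ℂ] H}, IsStarProjection Q → IsStarProjection Q' →
      IsSelfAdjoint ((2 : ℝ) • 1 - (4 : ℝ) • ((Q - Q') * (Q - Q'))) := fun h h' =>
    ((IsSelfAdjoint.all _).smul (.one _)).sub ((IsSelfAdjoint.all _).smul
      (isSelfAdjoint_mul_self (h.isSelfAdjoint.sub h'.isSelfAdjoint)))
  have kkW : ∀ {Q Q' : H →L[ℂ] H}, Q ∈ W → Q' ∈ W →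
      ((2 : ℝ) • 1 - (4 : ℝ) • ((Q - Q') * (Q - Q'))) ∈ W := fun h h' =>
    sub_mem (real_smul_mem (one_mem W) _) (real_smul_mem (mul_mem (sub_mem h h') (sub_mem h h')) _)
  have kkc : ∀ {c Q Q' : H →L[ℂ] H}, Commute c Q → Commute c Q' →
      Commute c ((2 : ℝ) • 1 - (4 : ℝ) • ((Q - Q') * (Q - Q'))) := fun h h' =>
    ((Commute.one_right _).smul_right _).sub_right
      (((h.sub_right h').mul_right (h.sub_right h')).smul_right _)
  set S := a * ((2 : ℝ) • P - 1) + b * ((2 : ℝ) • R - 1) with hSdef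
  set k := (2 : ℝ) • (1 : H →L[ℂ] H) - (4 : ℝ) • ((P - R) * (P - R)) with hk
  have hSsa : IsSelfAdjoint S := ((ha.commute_iff (symsa hP)).1 (sym haP)).add
    ((hb.commute_iff (symsa hR)).1 (sym hbR))
  have hSW : S ∈ W := add_mem (mul_mem haW (symW hPW)) (mul_mem hbW (symW hRW))
  have hSS : S * S = a * a + b * b + a * b * k :=
    combination_mul_self (mul_one a) (mul_one b) hab (sym haP) (sym haR) (sym hbP) (sym hbR)
      (hUU hP) (hUU hR) (hac hP hR)
  have hak : Commute a k := kkc haP haR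
  have hbk : Commute b k := kkc hbP hbR
  have hkP : Commute k P := by
    have := commute_sq_sub_left hP.isIdempotentElem hR.isIdempotentElem
    exact (((Commute.one_right _).smul_right _).sub_right (this.smul_right _)).symm
  have hkR : Commute k R := by
    have := commute_sq_sub_right hP.isIdempotentElem hR.isIdempotentElem
    exact (((Commute.one_right _).smul_right _).sub_right (this.smul_right _)).symm
  have hSSc : ∀ {c}, Commute c a → Commute c b → Commute c k → Commute (S * S) c := by
    intro c h1 h2 h3
    rw [hSS]
    exact ((((h1.mul_right h1).add_right (h2.mul_right h2)).add_right
      ((h1.mul_right h2).mul_right h3))).symm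
  have hSa : Commute S a :=
    (((Commute.refl a).mul_right (sym haP)).add_right (hab.mul_right (sym haR))).symm
  have hSb : Commute S b :=
    ((hab.symm.mul_right (sym hbP)).add_right ((Commute.refl b).mul_right (sym hbR))).symm
  obtain ⟨L, w, hLW, hL, hwW, hw, hwL, hS, hww, hcL, hcw⟩ := exists_sign_decomposition hSsa hSW
  have hwa : Commute w a := hcw a (hSSc (Commute.refl a) hab hak)
  have hwb : Commute w b := hcw b (hSSc hab.symm (Commute.refl b) hbk)
  have hwP : Commute w P := hcw P (hSSc haP.symm hbP.symm hkP.symm)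
  have hwR : Commute w R := hcw R (hSSc haR.symm hbR.symm hkR.symm)
  have haL : Commute a L := hcL a hSa
  have hbL : Commute b L := hcL b hSb
  have hkW : k ∈ W := kkW hPW hRW
  have hksa : IsSelfAdjoint k := kksa hP hR
  have hbksa := (hb.commute_iff hksa).1 hbk
  have haksa := (ha.commute_iff hksa).1 hak
  have habsa := (ha.commute_iff hb).1 hab
  -- With `l = 2L - 1` and `p = 2P - 1` the left side is `w (l p + p l) = S p + p S`, because `w`
  -- commutes with `p`.
  have mulLP : w * ((2 : ℝ) • 1 - (4 : ℝ) • ((L - P) * (L - P))) = (2 : ℝ) • a + b * k := by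
    rw [← hac hL hP, mul_add, ← mul_assoc, ← hS, ← mul_assoc, (sym hwP).eq, mul_assoc, ← hS, hSdef,
      combination_anticommutator (sym haP) (sym hbP) (hUU hP), hac hP hR]
  have mulLR : w * ((2 : ℝ) • 1 - (4 : ℝ) • ((L - R) * (L - R))) = (2 : ℝ) • b + a * k := by
    rw [← hac hL hR, mul_add, ← mul_assoc, ← hS, ← mul_assoc, (sym hwR).eq, mul_assoc, ← hS, hSdef,
      add_comm (a * _), combination_anticommutator (sym hbR) (sym haR) (hUU hR), add_comm (_ * _),
      hac hP hR]
  set ψ := quasiExt W φ with hψ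
  have cm : ∀ {A Q}, IsSelfAdjoint A → A ∈ W → Q ∈ W → IsStarProjection Q → Commute A Q →
      Commute (ψ A) ((2 : ℝ) • φ Q - φ 1) := by
    intro A Q h1 h2 h3 h4 h5
    rw [← quasiExt_symmetry hφ h3 h4]
    exact quasiExt_commute hφ h1 h2 (symsa h4) (symW h3) (sym h5)
  have key := gram_mul_self_eq_zero (x := ψ w) (y := ψ a) (z := ψ b) (l := (2 : ℝ) • φ L - φ 1)
    (p := (2 : ℝ) • φ P - φ 1) (r := (2 : ℝ) • φ R - φ 1) (e := φ 1)
    (quasiExt_mul_one hφ hw hwW) (quasiExt_mul_one hφ ha haW) (quasiExt_mul_one hφ hb hbW)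
    (quasiExt_commute hφ hw hwW ha haW hwa) (quasiExt_commute hφ hw hwW hb hbW hwb)
    (quasiExt_commute hφ ha haW hb hbW hab) (cm hw hwW hLW hL hwL) (cm hw hwW hPW hP hwP)
    (cm hw hwW hRW hR hwR) (cm ha haW hLW hL haL) (cm ha haW hPW hP haP) (cm ha haW hRW hR haR)
    (cm hb hbW hLW hL hbL) (cm hb hbW hPW hP hbP) (cm hb hbW hRW hR hbR)
    (huu hLW hL) (huu hPW hP) (huu hRW hR)
    (quasiExt_anticommutator hφ hJ hLW hPW hL hP) (quasiExt_anticommutator hφ hJ hLW hRW hL hR)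
    (quasiExt_anticommutator hφ hJ hPW hRW hP hR)
    (by rw [← quasiExt_mul hφ hw hwW (kksa hL hP) (kkW hLW hPW) (kkc hwL hwP), mulLP,
          quasiExt_add hφ ((IsSelfAdjoint.all _).smul ha) (real_smul_mem haW _) hbksa
            (mul_mem hbW hkW) ((hab.mul_right hak).smul_left _), quasiExt_smul hφ ha haW,
          quasiExt_mul hφ hb hbW hksa hkW hbk])
    (by rw [← quasiExt_mul hφ hw hwW (kksa hL hR) (kkW hLW hRW) (kkc hwL hwR), mulLR,
          quasiExt_add hφ ((IsSelfAdjoint.all _).smul hb) (real_smul_mem hbW _) haksa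
            (mul_mem haW hkW) ((hab.symm.mul_right hbk).smul_left _), quasiExt_smul hφ hb hbW,
          quasiExt_mul hφ ha haW hksa hkW hak])
    (by
      have hbb := isSelfAdjoint_mul_self hb
      have haa := isSelfAdjoint_mul_self ha
      have haab : Commute (a * a) (b * b) := (hab.mul_right hab).mul_left (hab.mul_right hab)
      have habk : Commute (a * b) k := hak.mul_left hbk
      have haab' : Commute (a * b) a := (Commute.refl a).mul_left hab.symm
      have habb' : Commute (a * b) b := hab.mul_left (Commute.refl b)
      rw [← quasiExt_mul hφ hw hwW hw hwW (Commute.refl w), hww, hSS,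
        quasiExt_add hφ (haa.add hbb) (add_mem (mul_mem haW haW) (mul_mem hbW hbW))
          ((habsa.commute_iff hksa).1 habk) (mul_mem (mul_mem haW hbW) hkW)
          (((haab'.mul_right haab').add_right (habb'.mul_right habb')).symm.mul_right
            (((hak.mul_left hak).add_left (hbk.mul_left hbk)))),
        quasiExt_add hφ haa (mul_mem haW haW) hbb (mul_mem hbW hbW) haab,
        quasiExt_mul hφ ha haW ha haW (Commute.refl a),
        quasiExt_mul hφ hb hbW hb hbW (Commute.refl b),
        quasiExt_mul hφ habsa (mul_mem haW hbW) hksa hkW habk,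
        quasiExt_mul hφ ha haW hb hbW hab])
  have usa : ∀ {Q}, Q ∈ W → IsStarProjection Q → IsSelfAdjoint ((2 : ℝ) • φ Q - φ 1) :=
    fun h h' => ((IsSelfAdjoint.all (2 : ℝ)).smul (hφ _ h h').isSelfAdjoint).sub
      (hφ 1 (one_mem W) (.one _)).isSelfAdjoint
  have psa : ∀ {A Q}, IsSelfAdjoint A → A ∈ W → Q ∈ W → IsStarProjection Q → Commute A Q →
      IsSelfAdjoint (ψ A * ((2 : ℝ) • φ Q - φ 1)) := fun h1 h2 h3 h4 h5 =>
    ((isSelfAdjoint_quasiExt hφ h1 h2).commute_iff (usa h3 h4)).1 (cm h1 h2 h3 h4 h5)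
  have hGsa := (psa hw hwW hLW hL hwL).sub ((psa ha haW hPW hP haP).add (psa hb hbW hRW hR hbR))
  -- The difference of the two sides is self-adjoint with square zero.
  have hG : ψ w * ((2 : ℝ) • φ L - φ 1) =
      ψ a * ((2 : ℝ) • φ P - φ 1) + ψ b * ((2 : ℝ) • φ R - φ 1) := by
    rw [← sub_eq_zero, ← CStarRing.star_mul_self_eq_zero_iff, hGsa.star_eq]
    exact key
  have hψS : ψ S = ψ a * ((2 : ℝ) • φ P - φ 1) + ψ b * ((2 : ℝ) • φ R - φ 1) := by
    rw [← hG, ← quasiExt_symmetry hφ hLW hL,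
      ← quasiExt_mul hφ hw hwW (symsa hL) (symW hLW) (sym hwL), ← hS]
  have hfin : a * P + b * R = (2⁻¹ : ℝ) • (S + (a + b)) := by
    rw [hSdef, mul_sub, mul_sub, mul_smul_comm, mul_smul_comm, mul_one, mul_one]
    module
  rw [hψ] at hψS ⊢
  rw [hfin, quasiExt_smul hφ (hSsa.add (ha.add hb)) (add_mem hSW (add_mem haW hbW)),
    quasiExt_add hφ hSsa hSW (ha.add hb) (add_mem haW hbW) (hSa.add_right hSb),
    quasiExt_add hφ ha haW hb hbW hab, hψS, mul_sub, mul_sub, mul_smul_comm, mul_smul_comm,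
    quasiExt_mul_one hφ ha haW, quasiExt_mul_one hφ hb hbW]
  module

/-- After `conj_sub_smul_eq`, the term `cC` commutes with the rest and splits off; the remaining `aP
+ bR` has coefficients commuting with `P` and `R`. -/
theorem quasiExt_conj_sub_smul (hφ : ∀ P ∈ W, IsStarProjection P → IsStarProjection (φ P))
    (hJ : ∀ P ∈ W, ∀ Q ∈ W, IsStarProjection P → IsStarProjection Q →
      φ P * φ Q + φ Q * φ P = quasiExt W φ (P * Q + Q * P))
    {P R : H →L[ℂ] H} (hPW : P ∈ W) (hRW : R ∈ W) (hP : IsStarProjection P)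
    (hR : IsStarProjection R) (c : ℝ) :
    quasiExt W φ ((P - c • (1 : H →L[ℂ] H)) * R * (P - c • (1 : H →L[ℂ] H))) =
      (φ P - c • (1 : K →L[ℂ] K)) * φ R * (φ P - c • (1 : K →L[ℂ] K)) := by
  have hd := isSelfAdjoint_mul_self (hP.isSelfAdjoint.sub hR.isSelfAdjoint)
  have hdW := mul_mem (sub_mem hPW hRW) (sub_mem hPW hRW)
  have hcP := commute_sq_sub_left hP.isIdempotentElem hR.isIdempotentElem
  have hcR := commute_sq_sub_right hP.isIdempotentElem hR.isIdempotentElem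
  rw [conj_sub_smul_eq hP.isIdempotentElem hR.isIdempotentElem,
    conj_sub_smul_eq (hφ P hPW hP).isIdempotentElem (hφ R hRW hR).isIdempotentElem]
  set C := (P - R) * (P - R) with hC
  set a := (1 - c) • (1 : H →L[ℂ] H) - C with ha
  set b := (c ^ 2 - c) • (1 : H →L[ℂ] H) with hb
  have e1 : (1 - c) • P - C * P + (c ^ 2 - c) • R = a * P + b * R := by
    rw [ha, hb, sub_mul, smul_mul_assoc, smul_mul_assoc, one_mul, one_mul]
  have hs1 : ∀ r : ℝ, IsSelfAdjoint (r • (1 : H →L[ℂ] H)) := fun r =>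
    (IsSelfAdjoint.all _).smul (.one _)
  have h1W : ∀ r : ℝ, r • (1 : H →L[ℂ] H) ∈ W := fun r => real_smul_mem (one_mem W) r
  have h1c : ∀ (r : ℝ) (T : H →L[ℂ] H), Commute (r • (1 : H →L[ℂ] H)) T := fun r T =>
    (Commute.one_left T).smul_left r
  have haP : Commute a P := (h1c _ _).sub_left hcP.symm
  have haR : Commute a R := (h1c _ _).sub_left hcR.symm
  have hasa : IsSelfAdjoint a := (hs1 _).sub hd
  have haW : a ∈ W := sub_mem (h1W _) hdW
  have hCa : Commute C a := (h1c _ _).symm.sub_right (Commute.refl C)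
  have hsum : IsSelfAdjoint (a * P + b * R) := ((hasa.commute_iff hP.isSelfAdjoint).1 haP).add
    (((hs1 _).commute_iff hR.isSelfAdjoint).1 (h1c _ _))
  have hψa : quasiExt W φ a = (1 - c) • φ 1 - (φ P - φ R) * (φ P - φ R) := by
    rw [ha, quasiExt_sub hφ (hs1 _) (h1W _) hd hdW (h1c _ _),
      quasiExt_smul hφ (.one _) (one_mem W), quasiExt_proj hφ (one_mem W) (.one _), hC,
      quasiExt_sq_sub_proj hφ hJ hPW hRW hP hR]
  have hψb : quasiExt W φ b = (c ^ 2 - c) • φ 1 := by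
    rw [hb, quasiExt_smul hφ (.one _) (one_mem W), quasiExt_proj hφ (one_mem W) (.one _)]
  rw [e1, quasiExt_add hφ ((IsSelfAdjoint.all c).smul hd) (real_smul_mem hdW _) hsum
    (add_mem (mul_mem haW hPW) (mul_mem (h1W _) hRW))
    (((hCa.mul_right hcP.symm).add_right ((h1c _ C).symm.mul_right hcR.symm)).smul_left c),
    quasiExt_smul hφ hd hdW, hC, quasiExt_sq_sub_proj hφ hJ hPW hRW hP hR,
    quasiExt_mul_proj_add_mul_proj hφ hJ hPW hRW hP hR haW (h1W _) hasa (hs1 _) (h1c _ _).symm haP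
      haR (h1c _ _) (h1c _ _), hψa, ← hb, hψb, sub_mul ((1 - c) • φ 1), smul_mul_assoc, smul_mul_assoc,
    map_one_mul_proj hφ hPW hP, map_one_mul_proj hφ hRW hR]

end TwoProjectionsCalculus

/-! ### Transfer of small compressions and norm continuity of the extension -/

section Additivity

variable {H : Type*} [NormedAddCommGroup H] [InnerProductSpace ℂ H] [CompleteSpace H]
  {K : Type*} [NormedAddCommGroup K] [InnerProductSpace ℂ K] [CompleteSpace K]
  {W : VonNeumannAlgebra H} {φ : (H →L[ℂ] H) →ₗ[ℂ] (K →L[ℂ] K)}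

theorem mul_spectralProj_nonneg {B : H →L[ℂ] H} (hB : 0 ≤ B) {a b : ℝ} (hab : a ≤ b) :
    0 ≤ B * spectralProj B a b := by
  have hF := spectralProj_isStarProjection B a b
  have hc : Commute B (spectralProj B a b) :=
    commute_spectralProj hB.isSelfAdjoint (Commute.refl B) hab
  have := star_left_conjugate_nonneg hB (spectralProj B a b)
  rwa [hF.isSelfAdjoint.star_eq, ← hc.eq, mul_assoc, hF.isIdempotentElem.eq] at this

theorem mul_spectralProj_le_self {B : H →L[ℂ] H} (hB : 0 ≤ B) {a b : ℝ} (hab : a ≤ b) :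
    B * spectralProj B a b ≤ B := by
  have hF := (spectralProj_isStarProjection B a b).one_sub
  have hc : Commute B (1 - spectralProj B a b) := (Commute.one_right B).sub_right
    (commute_spectralProj hB.isSelfAdjoint (Commute.refl B) hab)
  have := star_left_conjugate_nonneg hB (1 - spectralProj B a b)
  rw [hF.isSelfAdjoint.star_eq, ← hc.eq, mul_assoc, hF.isIdempotentElem.eq, mul_sub, mul_one] at this
  exact sub_nonneg.1 this

/-- Chebyshev's inequality for operators: `a F ≤ B F ≤ B` for the spectral projection `F`,
compressed by `E`. -/
theorem smul_norm_conj_spectralProj_le {B E : H →L[ℂ] H} (hB : 0 ≤ B) (hE : IsStarProjection E)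
    {a b : ℝ} (ha : 0 ≤ a) (hab : a ≤ b) :
    a * ‖E * spectralProj B a b * E‖ ≤ ‖E * B * E‖ := by
  have h1 := (smul_spectralProj_le hB.isSelfAdjoint hab).trans (mul_spectralProj_le_self hB hab)
  have h2 := star_left_conjugate_le_conjugate h1 E
  have h3 : 0 ≤ star E * (a • spectralProj B a b) * E :=
    star_left_conjugate_nonneg (smul_nonneg ha (spectralProj_isStarProjection B a b).nonneg) E
  have h4 := CStarAlgebra.norm_le_norm_of_nonneg_of_le h3 h2
  rwa [hE.isSelfAdjoint.star_eq, mul_smul_comm, smul_mul_assoc, norm_smul, Real.norm_of_nonneg ha]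
    at h4

/-- With `F` the spectral projection, `ψ (BF) = φ F ψ(BF) φ F` has norm at most `b`, and the two
outer factors `φ E φ F` and its adjoint contribute `‖φ E φ F‖² ≤ ‖EFE‖`. -/
theorem norm_conj_quasiExt_mul_spectralProj_le
    (hφ : ∀ P ∈ W, IsStarProjection P → IsStarProjection (φ P))
    (hJ : ∀ P ∈ W, ∀ Q ∈ W, IsStarProjection P → IsStarProjection Q →
      φ P * φ Q + φ Q * φ P = quasiExt W φ (P * Q + Q * P))
    {B E : H →L[ℂ] H} (hB : 0 ≤ B) (hBW : B ∈ W) (hE : IsStarProjection E) (hEW : E ∈ W)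
    {a b : ℝ} (hab : a ≤ b) (hb : 0 ≤ b) :
    ‖φ E * quasiExt W φ (B * spectralProj B a b) * φ E‖ ≤ ‖E * spectralProj B a b * E‖ * b := by
  have hF := spectralProj_isStarProjection B a b
  have hFW := spectralProj_mem W hBW a b
  have hBsa := hB.isSelfAdjoint
  have hc : Commute B (spectralProj B a b) := commute_spectralProj hBsa (Commute.refl B) hab
  have h0 := mul_spectralProj_nonneg hB hab
  have h1 : ‖B * spectralProj B a b‖ ≤ b := by
    rw [CStarAlgebra.norm_le_iff_le_algebraMap _ hb h0]
    refine (mul_spectralProj_le hBsa hab).trans ?_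
    rw [Algebra.algebraMap_eq_smul_one]
    exact smul_le_smul_of_nonneg_left hF.le_one hb
  have hBFW := mul_mem hBW hFW
  have h2 : quasiExt W φ (B * spectralProj B a b) = φ (spectralProj B a b) *
      quasiExt W φ (B * spectralProj B a b) * φ (spectralProj B a b) := by
    have hcc : Commute (spectralProj B a b) (B * spectralProj B a b) :=
      hc.symm.mul_right (Commute.refl _)
    rw [← quasiExt_proj hφ hFW hF, ← quasiExt_mul hφ hF.isSelfAdjoint hFW h0.isSelfAdjoint hBFW hcc,
      hcc.eq, mul_assoc, hF.isIdempotentElem.eq,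
      ← quasiExt_mul hφ h0.isSelfAdjoint hBFW hF.isSelfAdjoint hFW hcc.symm, mul_assoc,
      hF.isIdempotentElem.eq]
  have h3 : ‖φ (spectralProj B a b) * φ E‖ = ‖φ E * φ (spectralProj B a b)‖ := by
    rw [← norm_star, star_mul, (hφ E hEW hE).isSelfAdjoint.star_eq,
      (hφ _ hFW hF).isSelfAdjoint.star_eq]
  have h4 := norm_quasiExt_le hφ h0.isSelfAdjoint hBFW
  have h5 := norm_map_mul_map_le hφ hJ hEW hFW hE hF
  calc ‖φ E * quasiExt W φ (B * spectralProj B a b) * φ E‖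
      = ‖(φ E * φ (spectralProj B a b)) * quasiExt W φ (B * spectralProj B a b) *
          (φ (spectralProj B a b) * φ E)‖ := by
        conv_lhs => rw [h2]
        simp only [mul_assoc]
    _ ≤ ‖φ E * φ (spectralProj B a b)‖ * ‖quasiExt W φ (B * spectralProj B a b)‖ *
          ‖φ (spectralProj B a b) * φ E‖ := (norm_mul_le _ _).trans
        (mul_le_mul_of_nonneg_right (norm_mul_le _ _) (norm_nonneg _))
    _ = ‖φ E * φ (spectralProj B a b)‖ ^ 2 * ‖quasiExt W φ (B * spectralProj B a b)‖ := by
        rw [h3]; ring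
    _ ≤ _ := mul_le_mul h5 (h4.trans h1) (norm_nonneg _) (norm_nonneg _)

/-- Cut the spectrum of `B` at `s²` and `s`. The bottom window contributes at most `s²`; on the
other two the Chebyshev bound on `‖EFE‖` times the upper end of the window is again of order `s²`.
The second cut is essential: a single cut at `s^(3/2)` yields only order `s^(3/2)`, which does not
decay when summed over the blocks of a partition. -/
theorem norm_conj_quasiExt_le (hφ : ∀ P ∈ W, IsStarProjection P → IsStarProjection (φ P))
    (hJ : ∀ P ∈ W, ∀ Q ∈ W, IsStarProjection P → IsStarProjection Q →
      φ P * φ Q + φ Q * φ P = quasiExt W φ (P * Q + Q * P))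
    {B E : H →L[ℂ] H} (hB : 0 ≤ B) (hBW : B ∈ W) (hE : IsStarProjection E) (hEW : E ∈ W)
    {M κ s : ℝ} (hM : ‖B‖ ≤ M) (hs : 0 < s) (hs1 : s ≤ 1)
    (h : ‖E * B * E‖ ≤ κ * s ^ 3) :
    ‖φ E * quasiExt W φ B * φ E‖ ≤ (1 + κ + κ * (M + 1)) * s ^ 2 := by
  have hBsa := hB.isSelfAdjoint
  have hM0 : 0 ≤ M := (norm_nonneg _).trans hM
  have l1 : (-1 : ℝ) ≤ s ^ 2 := by nlinarith
  have l2 : s ^ 2 ≤ s := by nlinarith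
  have l3 : s ≤ M + 1 := by linarith
  have hW : ∀ a b, spectralProj B a b ∈ W := fun a b => spectralProj_mem W hBW a b
  have hp : ∀ a b, IsStarProjection (spectralProj B a b) := spectralProj_isStarProjection B
  -- The windows start below 0 to include the kernel of `B`; `M + 1` exceeds both `‖B‖` and `s`.
  have hone : spectralProj B (-1) (s ^ 2) + spectralProj B (s ^ 2) s + spectralProj B s (M + 1) =
      1 := by
    rw [spectralProj_add hBsa l1 l2, spectralProj_add hBsa (l1.trans l2) l3]
    exact spectralProj_eq_one hBsa (c := 0) (by simpa using hB) (by norm_num) (by linarith)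
      (by linarith)
  have hcc : ∀ {a b}, a ≤ b → ∀ {a' b'}, a' ≤ b' →
      Commute (B * spectralProj B a b) (B * spectralProj B a' b') := by
    intro a b hab a' b' hab'
    have c1 : Commute B (spectralProj B a b) := commute_spectralProj hBsa (Commute.refl B) hab
    have c2 : Commute B (spectralProj B a' b') := commute_spectralProj hBsa (Commute.refl B) hab'
    have c3 : Commute (spectralProj B a b) (spectralProj B a' b') :=
      commute_spectralProj hBsa c1 hab'
    exact ((Commute.refl B).mul_right c2).mul_left (c1.symm.mul_right c3)
  have hψ : quasiExt W φ B = quasiExt W φ (B * spectralProj B (-1) (s ^ 2)) +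
      quasiExt W φ (B * spectralProj B (s ^ 2) s) +
        quasiExt W φ (B * spectralProj B s (M + 1)) := by
    have n1 := (mul_spectralProj_nonneg hB l1).isSelfAdjoint
    have n2 := (mul_spectralProj_nonneg hB l2).isSelfAdjoint
    have n3 := (mul_spectralProj_nonneg hB l3).isSelfAdjoint
    rw [← quasiExt_add hφ n1 (mul_mem hBW (hW _ _)) n2 (mul_mem hBW (hW _ _)) (hcc l1 l2),
      ← quasiExt_add hφ (n1.add n2) (add_mem (mul_mem hBW (hW _ _)) (mul_mem hBW (hW _ _))) n3
        (mul_mem hBW (hW _ _)) ((hcc l1 l3).add_left (hcc l2 l3)), ← mul_add, ← mul_add, hone,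
      mul_one]
  have p1 : ‖φ E * quasiExt W φ (B * spectralProj B (-1) (s ^ 2)) * φ E‖ ≤ s ^ 2 := by
    refine (norm_conj_quasiExt_mul_spectralProj_le hφ hJ hB hBW hE hEW l1 (by positivity)).trans ?_
    have n1 : ∀ {Q : H →L[ℂ] H}, IsStarProjection Q → ‖Q‖ ≤ 1 := fun hQ => hQ.norm_le
    have : ‖E * spectralProj B (-1) (s ^ 2) * E‖ ≤ 1 :=
      (norm_mul_le _ _).trans (mul_le_one₀ ((norm_mul_le _ _).trans
        (mul_le_one₀ (n1 hE) (norm_nonneg _) (n1 (hp _ _)))) (norm_nonneg _) (n1 hE))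
    exact mul_le_of_le_one_left (by positivity) this
  have p2 : ‖φ E * quasiExt W φ (B * spectralProj B (s ^ 2) s) * φ E‖ ≤ κ * s ^ 2 := by
    refine (norm_conj_quasiExt_mul_spectralProj_le hφ hJ hB hBW hE hEW l2 hs.le).trans ?_
    have h1 := (smul_norm_conj_spectralProj_le hB hE (by positivity) l2).trans h
    have h2 : ‖E * spectralProj B (s ^ 2) s * E‖ ≤ κ * s := by
      have : 0 < s ^ 2 := by positivity
      refine le_of_mul_le_mul_left ?_ this
      calc _ ≤ _ := h1
        _ = _ := by ring
    calc _ ≤ κ * s * s := mul_le_mul_of_nonneg_right h2 hs.le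
      _ = _ := by ring
  have p3 : ‖φ E * quasiExt W φ (B * spectralProj B s (M + 1)) * φ E‖ ≤
      κ * (M + 1) * s ^ 2 := by
    refine (norm_conj_quasiExt_mul_spectralProj_le hφ hJ hB hBW hE hEW l3 (by linarith)).trans ?_
    have h1 := (smul_norm_conj_spectralProj_le hB hE hs.le l3).trans h
    have h2 : ‖E * spectralProj B s (M + 1) * E‖ ≤ κ * s ^ 2 := by
      refine le_of_mul_le_mul_left ?_ hs
      calc _ ≤ _ := h1
        _ = _ := by ring
    calc _ ≤ κ * s ^ 2 * (M + 1) := mul_le_mul_of_nonneg_right h2 (by linarith)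
      _ = _ := by ring
  rw [hψ, mul_add, mul_add, add_mul, add_mul]
  refine (norm_add_le _ _).trans ((add_le_add_left (norm_add_le _ _) _).trans ?_)
  linarith

/-- Both squared norms are compressions, of `ψ (D²) = (ψ D)²` by `φ E` and of `D²` by `E`, so the
positive case applies to `D²`. -/
theorem norm_quasiExt_mul_proj_sq_le
    (hφ : ∀ P ∈ W, IsStarProjection P → IsStarProjection (φ P))
    (hJ : ∀ P ∈ W, ∀ Q ∈ W, IsStarProjection P → IsStarProjection Q →
      φ P * φ Q + φ Q * φ P = quasiExt W φ (P * Q + Q * P))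
    {D E : H →L[ℂ] H} (hD : IsSelfAdjoint D) (hDW : D ∈ W) (hE : IsStarProjection E) (hEW : E ∈ W)
    {M κ s : ℝ} (hM : ‖D‖ ≤ M) (hs : 0 < s) (hs1 : s ≤ 1)
    (h : ‖D * E‖ ^ 2 ≤ κ * s ^ 3) :
    ‖quasiExt W φ D * φ E‖ ^ 2 ≤ (1 + κ + κ * (M ^ 2 + 1)) * s ^ 2 := by
  have hpos : 0 ≤ D * D := by
    have := star_mul_self_nonneg D
    rwa [hD.star_eq] at this
  have h1 : ‖quasiExt W φ D * φ E‖ ^ 2 = ‖φ E * quasiExt W φ (D * D) * φ E‖ := by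
    rw [sq, ← CStarRing.norm_star_mul_self, star_mul, (hφ E hEW hE).isSelfAdjoint.star_eq,
      (isSelfAdjoint_quasiExt hφ hD hDW).star_eq, quasiExt_mul hφ hD hDW hD hDW (Commute.refl D)]
    simp only [mul_assoc]
  have h2 : ‖E * (D * D) * E‖ = ‖D * E‖ ^ 2 := by
    rw [sq, ← CStarRing.norm_star_mul_self, star_mul, hE.isSelfAdjoint.star_eq, hD.star_eq]
    simp only [mul_assoc]
  rw [h1]
  refine norm_conj_quasiExt_le hφ hJ hpos (mul_mem hDW hDW) hE hEW ?_ hs hs1 (h2.trans_le h)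
  rw [sq]
  exact (norm_mul_le _ _).trans (mul_le_mul hM hM (norm_nonneg _) ((norm_nonneg _).trans hM))

theorem norm_sq_le_sum {F : ℕ → K →L[ℂ] K} {N : ℕ} (hF : ∀ j, IsStarProjection (F j))
    {Z : K →L[ℂ] K} (hZ : (∑ j ∈ Finset.range N, F j) * Z = Z) :
    ‖Z‖ ^ 2 ≤ ∑ j ∈ Finset.range N, ‖F j * Z‖ ^ 2 := by
  have h1 : star Z * Z = ∑ j ∈ Finset.range N, star (F j * Z) * (F j * Z) := by
    have h2 : star Z * Z = star Z * ((∑ j ∈ Finset.range N, F j) * Z) := by rw [hZ]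
    rw [h2, Finset.sum_mul, Finset.mul_sum]
    refine Finset.sum_congr rfl fun j _ => ?_
    rw [star_mul, (hF j).isSelfAdjoint.star_eq, mul_assoc, ← mul_assoc (F j),
      (hF j).isIdempotentElem.eq]
  rw [sq, ← CStarRing.norm_star_mul_self, h1]
  refine (norm_sum_le _ _).trans (Finset.sum_le_sum fun j _ => ?_)
  rw [CStarRing.norm_star_mul_self, sq]

/-- On a spectral block `E_k` of `A` of mesh `m⁻³`, both `A` and `B` are within `2 m⁻³` of the
scalar `t_k`. Squaring gives `4 s³` with `s = m⁻²`, so `ψ A` and `ψ B` each differ from that scalar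
on `φ E_k` by a squared error of order `s² = m⁻⁴`. Summing over the `2 M m³` blocks leaves order
`1/m`. -/
theorem norm_quasiExt_sub_sq_le (hφ : ∀ P ∈ W, IsStarProjection P → IsStarProjection (φ P))
    (hJ : ∀ P ∈ W, ∀ Q ∈ W, IsStarProjection P → IsStarProjection Q →
      φ P * φ Q + φ Q * φ P = quasiExt W φ (P * Q + Q * P))
    {A B : H →L[ℂ] H} (hA : IsSelfAdjoint A) (hAW : A ∈ W) (hB : IsSelfAdjoint B) (hBW : B ∈ W)
    {M m : ℕ} (hAM : ‖A‖ < M) (hBM : ‖B‖ < M) (hm : 0 < m) (h : ‖B - A‖ ≤ 1 / (m : ℝ) ^ 3) :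
    ‖quasiExt W φ B - quasiExt W φ A‖ ^ 2 ≤
      8 * M * (1 + 4 + 4 * ((2 * M : ℝ) ^ 2 + 1)) / m := by
  have hm' : (1 : ℝ) ≤ m := by exact_mod_cast hm
  obtain ⟨t, E, hE, hEW, -, hsum, ht, htE, -⟩ := exists_spectral_partition hA hAM (pow_pos hm 3)
  set c : ℝ := 1 + 4 + 4 * ((2 * M : ℝ) ^ 2 + 1) with hc
  have hFsum : ∑ k ∈ Finset.range (2 * M * m ^ 3), φ (E k) = φ 1 := by rw [← map_sum, hsum]
  have hφE : ∀ k, IsStarProjection (φ (E k)) := fun k => hφ _ (hEW k W hAW) (hE k)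
  have hs : (0 : ℝ) < 1 / (m : ℝ) ^ 2 := by positivity
  have hs1 : 1 / (m : ℝ) ^ 2 ≤ 1 := by
    rw [div_le_one (by positivity)]; exact one_le_pow₀ hm'
  have tsa : ∀ t : ℝ, IsSelfAdjoint (t • (1 : H →L[ℂ] H)) := fun t =>
    (IsSelfAdjoint.all t).smul (.one _)
  have tW : ∀ t : ℝ, t • (1 : H →L[ℂ] H) ∈ W := fun t => real_smul_mem (one_mem W) t
  have bound : ∀ C : H →L[ℂ] H, IsSelfAdjoint C → C ∈ W → ‖C‖ < M → ‖C - A‖ ≤ 1 / (m : ℝ) ^ 3 →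
      ∀ k ∈ Finset.range (2 * M * m ^ 3),
        ‖quasiExt W φ (C - t k • 1) * φ (E k)‖ ^ 2 ≤ c * (1 / (m : ℝ) ^ 2) ^ 2 := by
    intro C hC hCW hCM hCA k hk
    refine norm_quasiExt_mul_proj_sq_le hφ hJ (hC.sub (tsa _)) (sub_mem hCW (tW _)) (hE k)
      (hEW k W hAW) (M := 2 * M) ?_ hs hs1 ?_
    · refine (norm_sub_le _ _).trans ?_
      have : ‖t k • (1 : H →L[ℂ] H)‖ ≤ M := by
        rw [norm_smul, Real.norm_eq_abs]
        exact (mul_le_of_le_one_right (abs_nonneg _)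
          (IsStarProjection.norm_le (1 : H →L[ℂ] H) (.one _))).trans (ht k hk)
      linarith
    · have e1 : (C - t k • 1) * E k = (C - A) * E k + (A * E k - t k • E k) := by
        rw [sub_mul, sub_mul, smul_mul_assoc, one_mul]; abel
      have e2 : ‖(C - t k • 1) * E k‖ ≤ 2 * (1 / (m : ℝ) ^ 3) := by
        rw [e1]
        refine (norm_add_le _ _).trans ?_
        have h1 : ‖(C - A) * E k‖ ≤ 1 / (m : ℝ) ^ 3 := (norm_mul_le _ _).trans
          ((mul_le_of_le_one_right (norm_nonneg _) (IsStarProjection.norm_le _ (hE k))).trans hCA)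
        have h2 := htE k
        push_cast at h2
        linarith
      calc _ ≤ (2 * (1 / (m : ℝ) ^ 3)) ^ 2 := pow_le_pow_left₀ (norm_nonneg _) e2 2
        _ = _ := by field_simp; norm_num
  have hY : IsSelfAdjoint (quasiExt W φ B - quasiExt W φ A) :=
    (isSelfAdjoint_quasiExt hφ hB hBW).sub (isSelfAdjoint_quasiExt hφ hA hAW)
  have h1 := norm_sq_le_sum (F := fun k => φ (E k)) (N := 2 * M * m ^ 3) hφE
    (Z := quasiExt W φ B - quasiExt W φ A)
    (by rw [hFsum, mul_sub, quasiExt_one_mul hφ hB hBW, quasiExt_one_mul hφ hA hAW])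
  refine h1.trans ?_
  have h2 : ∀ k ∈ Finset.range (2 * M * m ^ 3),
      ‖φ (E k) * (quasiExt W φ B - quasiExt W φ A)‖ ^ 2 ≤ 4 * c * (1 / (m : ℝ) ^ 2) ^ 2 := by
    intro k hk
    have e0 : ‖φ (E k) * (quasiExt W φ B - quasiExt W φ A)‖ =
        ‖(quasiExt W φ B - quasiExt W φ A) * φ (E k)‖ := by
      rw [← norm_star, star_mul, hY.star_eq, (hφE k).isSelfAdjoint.star_eq]
    have e1 : (quasiExt W φ B - quasiExt W φ A) * φ (E k) =
        quasiExt W φ (B - t k • 1) * φ (E k) - quasiExt W φ (A - t k • 1) * φ (E k) := by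
      rw [quasiExt_sub hφ hB hBW (tsa _) (tW _) ((Commute.one_right _).smul_right _),
        quasiExt_sub hφ hA hAW (tsa _) (tW _) ((Commute.one_right _).smul_right _)]
      simp only [sub_mul]
      abel
    have b1 := bound B hB hBW hBM h k hk
    have b2 := bound A hA hAW hAM (by rw [sub_self, norm_zero]; positivity) k hk
    rw [e0, e1]
    have := norm_sub_le (quasiExt W φ (B - t k • 1) * φ (E k))
      (quasiExt W φ (A - t k • 1) * φ (E k))
    have n1 := norm_nonneg (quasiExt W φ (B - t k • 1) * φ (E k))
    have n2 := norm_nonneg (quasiExt W φ (A - t k • 1) * φ (E k))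
    have n3 := norm_nonneg (quasiExt W φ (B - t k • 1) * φ (E k) -
      quasiExt W φ (A - t k • 1) * φ (E k))
    calc _ ≤ (‖quasiExt W φ (B - t k • 1) * φ (E k)‖ +
          ‖quasiExt W φ (A - t k • 1) * φ (E k)‖) ^ 2 := pow_le_pow_left₀ n3 this 2
      _ ≤ 2 * (‖quasiExt W φ (B - t k • 1) * φ (E k)‖ ^ 2 +
          ‖quasiExt W φ (A - t k • 1) * φ (E k)‖ ^ 2) := add_sq_le
      _ ≤ _ := by linarith
  refine (Finset.sum_le_sum h2).trans ?_
  rw [Finset.sum_const, Finset.card_range, nsmul_eq_mul]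
  push_cast
  apply le_of_eq
  field_simp
  ring

theorem tendsto_quasiExt_of_tendsto
    (hφ : ∀ P ∈ W, IsStarProjection P → IsStarProjection (φ P))
    (hJ : ∀ P ∈ W, ∀ Q ∈ W, IsStarProjection P → IsStarProjection Q →
      φ P * φ Q + φ Q * φ P = quasiExt W φ (P * Q + Q * P))
    {A : H →L[ℂ] H} {B : ℕ → H →L[ℂ] H} (hA : IsSelfAdjoint A) (hAW : A ∈ W)
    (hB : ∀ l, IsSelfAdjoint (B l)) (hBW : ∀ l, B l ∈ W) (h : Tendsto B atTop (𝓝 A)) :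
    Tendsto (fun l => quasiExt W φ (B l)) atTop (𝓝 (quasiExt W φ A)) := by
  obtain ⟨M, hM⟩ := exists_nat_gt ‖A‖
  have hBM : ∀ᶠ l in atTop, ‖B l‖ < M := h.norm.eventually_lt_const hM
  rw [Metric.tendsto_atTop']
  intro ε hε
  set c : ℝ := 8 * M * (1 + 4 + 4 * ((2 * M : ℝ) ^ 2 + 1)) with hc
  obtain ⟨m, hm⟩ := exists_nat_gt (c / ε ^ 2)
  have hc0 : 0 ≤ c := by positivity
  have hm0 : (0 : ℝ) < m := lt_of_le_of_lt (by positivity) hm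
  have hnear : ∀ᶠ l in atTop, ‖B l - A‖ < 1 / (m : ℝ) ^ 3 := by
    have := Metric.tendsto_nhds.1 h (1 / (m : ℝ) ^ 3) (by positivity)
    simpa only [dist_eq_norm] using this
  obtain ⟨N, hN⟩ := eventually_atTop.1 (hBM.and hnear)
  refine ⟨N, fun l hl => ?_⟩
  have h1 := norm_quasiExt_sub_sq_le hφ hJ hA hAW (hB l) (hBW l) hM (hN l hl.le).1
    (by exact_mod_cast hm0) (hN l hl.le).2.le
  rw [dist_eq_norm]
  refine lt_of_pow_lt_pow_left₀ 2 hε.le (h1.trans_lt ?_)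
  rw [div_lt_iff₀ hm0]
  rwa [div_lt_iff₀ (by positivity), mul_comm] at hm

end Additivity

/-! ### Additivity along projections and boundedness on their span -/

theorem norm_mul_sub_smul_one_mul_sq {L : Type*} [NormedAddCommGroup L] [InnerProductSpace ℂ L]
    [CompleteSpace L] {p r e : L →L[ℂ] L} (hp : IsStarProjection p) (hr : IsStarProjection r)
    (he : IsStarProjection e) (c : ℝ) :
    ‖r * (p - c • 1) * e‖ ^ 2 = ‖e * ((p - c • 1) * r * (p - c • 1)) * e‖ := by
  have hsa : IsSelfAdjoint (p - c • (1 : L →L[ℂ] L)) :=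
    hp.isSelfAdjoint.sub ((IsSelfAdjoint.all c).smul (.one _))
  rw [sq, ← CStarRing.norm_star_mul_self, star_mul, star_mul, hr.isSelfAdjoint.star_eq,
    he.isSelfAdjoint.star_eq, hsa.star_eq]
  simp only [mul_assoc]
  rw [← mul_assoc r r, hr.isIdempotentElem.eq]

section LinearExtension

variable {H : Type*} [NormedAddCommGroup H] [InnerProductSpace ℂ H] [CompleteSpace H]
  {K : Type*} [NormedAddCommGroup K] [InnerProductSpace ℂ K] [CompleteSpace K]
  {W : VonNeumannAlgebra H} {φ : (H →L[ℂ] H) →ₗ[ℂ] (K →L[ℂ] K)}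

/-- Both squared norms are compressions, by `E` and `φ E`, of `(P - c) R (P - c)` and of its image
under `ψ`, which `quasiExt_conj_sub_smul` identifies. -/
theorem norm_map_mul_sub_smul_mul_map_sq_le
    (hφ : ∀ P ∈ W, IsStarProjection P → IsStarProjection (φ P))
    (hJ : ∀ P ∈ W, ∀ Q ∈ W, IsStarProjection P → IsStarProjection Q →
      φ P * φ Q + φ Q * φ P = quasiExt W φ (P * Q + Q * P))
    {P R E : H →L[ℂ] H} (hPW : P ∈ W) (hRW : R ∈ W) (hEW : E ∈ W) (hP : IsStarProjection P)
    (hR : IsStarProjection R) (hE : IsStarProjection E) {c M κ s : ℝ} (hM : |c| ≤ M) (hs : 0 < s)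
    (hs1 : s ≤ 1) (h : ‖R * (P - c • 1) * E‖ ^ 2 ≤ κ * s ^ 3) :
    ‖φ R * (φ P - c • 1) * φ E‖ ^ 2 ≤ (1 + κ + κ * ((1 + M) ^ 2 + 1)) * s ^ 2 := by
  have hsa : IsSelfAdjoint (P - c • (1 : H →L[ℂ] H)) :=
    hP.isSelfAdjoint.sub ((IsSelfAdjoint.all c).smul (.one _))
  have hpos : 0 ≤ (P - c • (1 : H →L[ℂ] H)) * R * (P - c • (1 : H →L[ℂ] H)) := by
    have := star_left_conjugate_nonneg hR.nonneg (P - c • (1 : H →L[ℂ] H))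
    rwa [hsa.star_eq] at this
  have hnorm : ‖P - c • (1 : H →L[ℂ] H)‖ ≤ 1 + M := by
    refine (norm_sub_le _ _).trans (add_le_add (IsStarProjection.norm_le _ hP) ?_)
    rw [norm_smul, Real.norm_eq_abs]
    exact (mul_le_of_le_one_right (abs_nonneg _)
      (IsStarProjection.norm_le (1 : H →L[ℂ] H) (.one _))).trans hM
  have hW : P - c • (1 : H →L[ℂ] H) ∈ W := sub_mem hPW (real_smul_mem (one_mem W) c)
  rw [norm_mul_sub_smul_one_mul_sq (hφ P hPW hP) (hφ R hRW hR) (hφ E hEW hE),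
    ← quasiExt_conj_sub_smul hφ hJ hPW hRW hP hR c]
  refine norm_conj_quasiExt_le hφ hJ hpos (mul_mem (mul_mem hW hRW) hW) hE hEW ?_ hs hs1
    ((norm_mul_sub_smul_one_mul_sq hP hR hE c).symm.trans_le h)
  have h0 : 0 ≤ 1 + M := (norm_nonneg _).trans hnorm
  calc _ ≤ ‖P - c • (1 : H →L[ℂ] H)‖ * ‖R‖ * ‖P - c • (1 : H →L[ℂ] H)‖ :=
        (norm_mul_le _ _).trans (mul_le_mul_of_nonneg_right (norm_mul_le _ _) (norm_nonneg _))
    _ ≤ (1 + M) * 1 * (1 + M) := by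
        gcongr
        exact IsStarProjection.norm_le _ hR
    _ = _ := by ring

/-- On `E` the operator `A` is the scalar `t`, and on a spectral block `R_j` of `T = A + lP` the
operator `T` is nearly `r_j`. Hence `l R_j (P - c) E = (T R_j - r_j R_j) E` is small for `c = (r_j -
t)/l`. The transfer estimate makes `φ R_j (φ P - c) φ E` small as well, and summing over the blocks
kills the defect `Z`. -/
theorem quasiExt_add_smul_proj_mul_map
    (hφ : ∀ P ∈ W, IsStarProjection P → IsStarProjection (φ P))
    (hJ : ∀ P ∈ W, ∀ Q ∈ W, IsStarProjection P → IsStarProjection Q →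
      φ P * φ Q + φ Q * φ P = quasiExt W φ (P * Q + Q * P))
    {A P E : H →L[ℂ] H} (hA : IsSelfAdjoint A) (hAW : A ∈ W) (hPW : P ∈ W)
    (hP : IsStarProjection P) (hEW : E ∈ W) (hE : IsStarProjection E) {t l : ℝ}
    (hAE : A * E = t • E) (hl : l ≠ 0) :
    (quasiExt W φ (A + l • P) - (quasiExt W φ A + l • φ P)) * φ E = 0 := by
  set T := A + l • P with hT
  have hTsa : IsSelfAdjoint T := hA.add ((IsSelfAdjoint.all l).smul hP.isSelfAdjoint)
  have hTW : T ∈ W := add_mem hAW (real_smul_mem hPW l)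
  have hEA : E * A = t • E := by
    have := congrArg star hAE
    rwa [star_mul, star_smul, hA.star_eq, hE.isSelfAdjoint.star_eq, star_trivial] at this
  have hψAE : quasiExt W φ A * φ E = t • φ E := by
    have hc : Commute A E := hAE.trans hEA.symm
    rw [← quasiExt_proj hφ hEW hE, ← quasiExt_mul hφ hA hAW hE.isSelfAdjoint hEW hc, hAE,
      quasiExt_smul hφ hE.isSelfAdjoint hEW]
  set Z := (quasiExt W φ T - (quasiExt W φ A + l • φ P)) * φ E with hZ
  have hZ1 : φ 1 * Z = Z := by
    rw [hZ, ← mul_assoc, mul_sub, mul_add, quasiExt_one_mul hφ hTsa hTW, quasiExt_one_mul hφ hA hAW,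
      mul_smul_comm, map_one_mul_proj hφ hPW hP]
  have hZ2 : Z = quasiExt W φ T * φ E - t • φ E - l • (φ P * φ E) := by
    rw [hZ, sub_mul, add_mul, hψAE, smul_mul_assoc]; abel
  obtain ⟨M, hM⟩ := exists_nat_gt ‖T‖
  set κ : ℝ := 1 / l ^ 2 with hκ
  set c₁ : ℝ := 1 + κ + κ * ((1 + (M + |t|) / |l|) ^ 2 + 1) with hc₁
  have hl' : 0 < |l| := abs_pos.2 hl
  have hκ0 : 0 ≤ κ := by positivity
  have hc₁0 : 0 ≤ c₁ := by positivity
  set c₂ : ℝ := 2 * M * (2 + 2 * l ^ 2 * c₁) with hc₂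
  have main : ∀ m : ℕ, 0 < m → ‖Z‖ ^ 2 ≤ c₂ / m := by
    intro m hm
    have hm' : (1 : ℝ) ≤ m := by exact_mod_cast hm
    have hm0 : (0 : ℝ) < m := by linarith
    obtain ⟨r, R, hR, hRW, hRc, hsum, hr, hrR, -⟩ :=
      exists_spectral_partition hTsa hM (pow_pos hm 3)
    push_cast at hrR
    have hRW' : ∀ j, R j ∈ W := fun j => hRW j W hTW
    have hφR : ∀ j, IsStarProjection (φ (R j)) := fun j => hφ _ (hRW' j) (hR j)
    have hs : (0 : ℝ) < 1 / (m : ℝ) ^ 2 := by positivity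
    have hs1 : 1 / (m : ℝ) ^ 2 ≤ 1 := by
      rw [div_le_one (by positivity)]; exact one_le_pow₀ hm'
    have hblock : ∀ j ∈ Finset.range (2 * M * m ^ 3),
        ‖φ (R j) * Z‖ ^ 2 ≤ (2 + 2 * l ^ 2 * c₁) / (m : ℝ) ^ 4 := by
      intro j hj
      set c : ℝ := (r j - t) / l with hc
      have hTR : Commute T (R j) := hRc j T (Commute.refl T)
      -- The scalar `c` makes the terms in `φ R_j φ E` cancel: `l c = r_j - t`. The first summand is
      -- small by contractivity of `ψ`, the second by the transfer estimate.
      have hsplit : φ (R j) * Z = (quasiExt W φ (T * R j - r j • R j)) * φ E -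
          l • (φ (R j) * (φ P - c • 1) * φ E) := by
        have hlc : l * c = r j - t := by rw [hc]; field_simp
        have hTRsa := (hTsa.commute_iff (hR j).isSelfAdjoint).1 hTR
        have e1 : quasiExt W φ (T * R j - r j • R j) =
            φ (R j) * quasiExt W φ T - r j • φ (R j) := by
          rw [quasiExt_sub hφ hTRsa (mul_mem hTW (hRW' j)) ((IsSelfAdjoint.all _).smul
            (hR j).isSelfAdjoint) (real_smul_mem (hRW' j) _)
            ((hTR.mul_left (Commute.refl _)).smul_right _), hTR.eq,
            quasiExt_mul hφ (hR j).isSelfAdjoint (hRW' j) hTsa hTW hTR.symm,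
            quasiExt_smul hφ (hR j).isSelfAdjoint (hRW' j), quasiExt_proj hφ (hRW' j) (hR j)]
        have e2 : l • (φ (R j) * (φ P - c • 1) * φ E) =
            l • (φ (R j) * φ P * φ E) - (r j - t) • (φ (R j) * φ E) := by
          rw [← hlc, mul_sub, sub_mul, smul_sub, mul_smul_comm, mul_one, smul_mul_assoc, smul_smul]
        rw [e1, e2, hZ2, mul_sub, mul_sub, sub_mul, mul_smul_comm, mul_smul_comm, smul_mul_assoc,
          ← mul_assoc, ← mul_assoc]
        module
      have b1 : ‖quasiExt W φ (T * R j - r j • R j) * φ E‖ ≤ 1 / (m : ℝ) ^ 3 := by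
        have hsa : IsSelfAdjoint (T * R j - r j • R j) :=
          ((hTsa.commute_iff (hR j).isSelfAdjoint).1 hTR).sub
            ((IsSelfAdjoint.all _).smul (hR j).isSelfAdjoint)
        have := norm_quasiExt_le hφ hsa (sub_mem (mul_mem hTW (hRW' j)) (real_smul_mem (hRW' j) _))
        exact (norm_mul_le _ _).trans ((mul_le_of_le_one_right (norm_nonneg _)
          (IsStarProjection.norm_le _ (hφ E hEW hE))).trans (this.trans (hrR j)))
      have hcM : |c| ≤ (M + |t|) / |l| := by
        rw [hc, abs_div]
        gcongr
        exact (abs_sub _ _).trans (by linarith [hr j hj])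
      have b2 : ‖φ (R j) * (φ P - c • 1) * φ E‖ ^ 2 ≤ c₁ * (1 / (m : ℝ) ^ 2) ^ 2 := by
        refine norm_map_mul_sub_smul_mul_map_sq_le hφ hJ hPW (hRW' j) hEW hP (hR j) hE hcM hs hs1 ?_
        have e1 : l • (R j * (P - c • 1) * E) = (T * R j - r j • R j) * E := by
          have hlc : l * c = r j - t := by rw [hc]; field_simp
          have e2 : l • (R j * (P - c • 1) * E) =
              R j * (l • P) * E - (l * c) • (R j * E) := by
            rw [mul_sub, sub_mul, smul_sub, mul_smul_comm, mul_one, smul_mul_assoc, smul_smul,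
              mul_smul_comm, smul_mul_assoc]
          have e3 : l • P = T - A := by rw [hT]; abel
          rw [e2, hlc, e3, mul_sub, sub_mul, mul_assoc _ A, hAE, mul_smul_comm, hTR.eq, sub_mul,
            smul_mul_assoc]
          module
        have e4 : |l| * ‖R j * (P - c • 1) * E‖ ≤ 1 / (m : ℝ) ^ 3 := by
          rw [← Real.norm_eq_abs, ← norm_smul, e1]
          exact (norm_mul_le _ _).trans ((mul_le_of_le_one_right (norm_nonneg _)
            (IsStarProjection.norm_le _ hE)).trans (hrR j))
        have e5 := pow_le_pow_left₀ (by positivity) e4 2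
        rw [mul_pow, sq_abs] at e5
        have hl2 : 0 < l ^ 2 := by positivity
        rw [hκ, div_mul_eq_mul_div, one_mul, le_div_iff₀ hl2, mul_comm]
        refine e5.trans_eq ?_
        field_simp
      rw [hsplit]
      set x := ‖quasiExt W φ (T * R j - r j • R j) * φ E‖ with hx
      set y := ‖φ (R j) * (φ P - c • 1) * φ E‖ with hy
      have b1' : x ^ 2 ≤ 1 / (m : ℝ) ^ 4 := by
        calc x ^ 2 ≤ (1 / (m : ℝ) ^ 3) ^ 2 := pow_le_pow_left₀ (norm_nonneg _) b1 2
          _ = 1 / (m : ℝ) ^ 6 := by rw [div_pow, one_pow, ← pow_mul]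
          _ ≤ 1 / (m : ℝ) ^ 4 := one_div_le_one_div_of_le (by positivity)
            (pow_le_pow_right₀ hm' (by norm_num))
      have b2' : y ^ 2 ≤ c₁ * (1 / (m : ℝ) ^ 4) := by
        refine b2.trans_eq ?_
        rw [div_pow, one_pow, ← pow_mul]
      calc _ ≤ (x + |l| * y) ^ 2 := by
            refine pow_le_pow_left₀ (norm_nonneg _) ((norm_sub_le _ _).trans_eq ?_) 2
            rw [norm_smul, Real.norm_eq_abs]
        _ ≤ 2 * (x ^ 2 + (|l| * y) ^ 2) := add_sq_le
        _ = 2 * (x ^ 2 + l ^ 2 * y ^ 2) := by rw [mul_pow, sq_abs]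
        _ ≤ 2 * (1 / (m : ℝ) ^ 4 + l ^ 2 * (c₁ * (1 / (m : ℝ) ^ 4))) := by gcongr
        _ = _ := by ring
    have h1 := norm_sq_le_sum (F := fun j => φ (R j)) (N := 2 * M * m ^ 3) hφR (Z := Z)
      (by rw [← map_sum, hsum, hZ1])
    refine h1.trans ((Finset.sum_le_sum hblock).trans ?_)
    rw [Finset.sum_const, Finset.card_range, nsmul_eq_mul]
    push_cast
    apply le_of_eq
    rw [hc₂]
    field_simp
  have hlim : Tendsto (fun m : ℕ => c₂ / (m : ℝ)) atTop (𝓝 0) :=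
    tendsto_const_div_atTop_nhds_zero_nat c₂
  have h0 : ‖Z‖ ^ 2 ≤ 0 := ge_of_tendsto hlim (eventually_atTop.2 ⟨1, fun m hm => main m hm⟩)
  have h2 : ‖Z‖ ^ 2 = 0 := le_antisymm h0 (sq_nonneg _)
  exact norm_eq_zero.1 (pow_eq_zero_iff two_ne_zero |>.1 h2)

/-- The defect is unchanged by `φ 1 = ∑ φ E_k` on the right, and each `φ E_k` annihilates it. -/
theorem quasiExt_add_smul_proj_of_simple
    (hφ : ∀ P ∈ W, IsStarProjection P → IsStarProjection (φ P))
    (hJ : ∀ P ∈ W, ∀ Q ∈ W, IsStarProjection P → IsStarProjection Q →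
      φ P * φ Q + φ Q * φ P = quasiExt W φ (P * Q + Q * P))
    {A P : H →L[ℂ] H} (hA : IsSelfAdjoint A) (hAW : A ∈ W) (hPW : P ∈ W)
    (hP : IsStarProjection P) {N : ℕ} {E : ℕ → H →L[ℂ] H} {t : ℕ → ℝ}
    (hEW : ∀ k, E k ∈ W) (hE : ∀ k, IsStarProjection (E k))
    (hsum : ∑ k ∈ Finset.range N, E k = 1) (hAE : ∀ k ∈ Finset.range N, A * E k = t k • E k)
    (l : ℝ) : quasiExt W φ (A + l • P) = quasiExt W φ A + l • φ P := by
  rcases eq_or_ne l 0 with rfl | hl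
  · simp
  have hTsa : IsSelfAdjoint (A + l • P) := hA.add ((IsSelfAdjoint.all l).smul hP.isSelfAdjoint)
  have hTW : A + l • P ∈ W := add_mem hAW (real_smul_mem hPW l)
  have h1 : (quasiExt W φ (A + l • P) - (quasiExt W φ A + l • φ P)) * φ 1 =
      quasiExt W φ (A + l • P) - (quasiExt W φ A + l • φ P) := by
    rw [sub_mul, add_mul, quasiExt_mul_one hφ hTsa hTW, quasiExt_mul_one hφ hA hAW, smul_mul_assoc,
      map_mul_one_proj hφ hPW hP]
  rw [← sub_eq_zero, ← h1, ← hsum, map_sum, Finset.mul_sum]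
  exact Finset.sum_eq_zero fun k hk =>
    quasiExt_add_smul_proj_mul_map hφ hJ hA hAW hPW hP (hEW k) (hE k) (hAE k hk) hl

/-- Approximate `A` by its spectral Riemann sums. The simple case applies to each of them, and norm
continuity of `ψ` passes to the limit at `A` and at `A + lP`, although the approximants need not
commute with `P`. -/
theorem quasiExt_add_smul_proj (hφ : ∀ P ∈ W, IsStarProjection P → IsStarProjection (φ P))
    (hJ : ∀ P ∈ W, ∀ Q ∈ W, IsStarProjection P → IsStarProjection Q →
      φ P * φ Q + φ Q * φ P = quasiExt W φ (P * Q + Q * P))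
    {A P : H →L[ℂ] H} (hA : IsSelfAdjoint A) (hAW : A ∈ W) (hPW : P ∈ W)
    (hP : IsStarProjection P) (l : ℝ) :
    quasiExt W φ (A + l • P) = quasiExt W φ A + l • φ P := by
  obtain ⟨M, hM⟩ := exists_nat_gt ‖A‖
  choose t E hE hEW hEc hsum ht htE hdist using
    fun n : ℕ => exists_spectral_partition hA hM (Nat.succ_pos n)
  set B : ℕ → H →L[ℂ] H := fun n => ∑ k ∈ Finset.range (2 * M * n.succ), t n k • E n k with hB
  have hBsa : ∀ n, IsSelfAdjoint (B n) := fun n =>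
    isSelfAdjoint_sum _ fun k _ => (IsSelfAdjoint.all _).smul (hE n k).isSelfAdjoint
  have hBW : ∀ n, B n ∈ W := fun n =>
    sum_mem fun k _ => real_smul_mem (hEW n k W hAW) _
  have hBA : Tendsto B atTop (𝓝 A) := by
    rw [tendsto_iff_norm_sub_tendsto_zero]
    refine squeeze_zero (fun _ => norm_nonneg _) (fun n => ?_)
      (tendsto_one_div_add_atTop_nhds_zero_nat (𝕜 := ℝ))
    rw [norm_sub_rev]
    simpa using hdist n
  have hBE : ∀ n, ∀ k ∈ Finset.range (2 * M * n.succ), B n * E n k = t n k • E n k := by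
    intro n k hk
    rw [hB, Finset.sum_mul, Finset.sum_eq_single k]
    · rw [smul_mul_assoc, (hE n k).isIdempotentElem.eq]
    · intro j hj hjk
      rw [smul_mul_assoc, mul_eq_zero_of_sum_eq_one (hE n) (hsum n) (Finset.mem_range.1 hj)
        (Finset.mem_range.1 hk) hjk, smul_zero]
    · exact fun h => absurd hk h
  have hlP : IsSelfAdjoint (l • P) := (IsSelfAdjoint.all l).smul hP.isSelfAdjoint
  have h1 := tendsto_quasiExt_of_tendsto hφ hJ (hA.add hlP) (add_mem hAW (real_smul_mem hPW l))
    (fun n => (hBsa n).add hlP) (fun n => add_mem (hBW n) (real_smul_mem hPW l))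
    (hBA.add_const (l • P))
  have h2 := (tendsto_quasiExt_of_tendsto hφ hJ hA hAW hBsa hBW hBA).add_const (l • φ P)
  refine tendsto_nhds_unique (h1.congr fun n => ?_) h2
  exact quasiExt_add_smul_proj_of_simple hφ hJ (hBsa n) (hBW n) hPW hP
    (fun k => hEW n k W hAW) (hE n) (hsum n) (hBE n) l

theorem quasiExt_sum_smul_proj (hφ : ∀ P ∈ W, IsStarProjection P → IsStarProjection (φ P))
    (hJ : ∀ P ∈ W, ∀ Q ∈ W, IsStarProjection P → IsStarProjection Q →
      φ P * φ Q + φ Q * φ P = quasiExt W φ (P * Q + Q * P))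
    {n : ℕ} (c : Fin n → ℝ) {P : Fin n → H →L[ℂ] H} (hPW : ∀ i, P i ∈ W)
    (hP : ∀ i, IsStarProjection (P i)) :
    quasiExt W φ (∑ i, c i • P i) = φ (∑ i, c i • P i) := by
  induction n with
  | zero => simp [quasiExt_proj hφ (zero_mem W) (.zero _)]
  | succ n ih =>
    rw [Fin.sum_univ_castSucc, quasiExt_add_smul_proj hφ hJ
      (isSelfAdjoint_sum _ fun i _ => (IsSelfAdjoint.all _).smul (hP _).isSelfAdjoint)
      (sum_mem fun i _ => real_smul_mem (hPW _) _) (hPW _) (hP _),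
      ih (fun i => c i.castSucc) (fun i => hPW _) (fun i => hP _), map_add,
      real_smul_eq_complex_smul (c (Fin.last n)) (P _), map_smul, real_smul_eq_complex_smul]

/-- The real and imaginary parts of `x` are real combinations of projections, where `φ` agrees with
the contractive `ψ`; the factor 2 comes from adding the two parts. -/
theorem norm_map_span_projections_le
    (hφ : ∀ P ∈ W, IsStarProjection P → IsStarProjection (φ P))
    (hJ : ∀ P ∈ W, ∀ Q ∈ W, IsStarProjection P → IsStarProjection Q →
      φ P * φ Q + φ Q * φ P = quasiExt W φ (P * Q + Q * P))
    {x : H →L[ℂ] H} (hx : x ∈ Submodule.span ℂ {P : H →L[ℂ] H | P ∈ W ∧ IsStarProjection P}) :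
    ‖φ x‖ ≤ 2 * ‖x‖ := by
  obtain ⟨n, f, g, rfl⟩ := Submodule.mem_span_set'.1 hx
  have hgW : ∀ i, (g i : H →L[ℂ] H) ∈ W := fun i => (g i).2.1
  have hg : ∀ i, IsStarProjection (g i : H →L[ℂ] H) := fun i => (g i).2.2
  set x := ∑ i, f i • (g i : H →L[ℂ] H) with hx
  set a := ∑ i, (f i).re • (g i : H →L[ℂ] H) with ha
  set b := ∑ i, (f i).im • (g i : H →L[ℂ] H) with hb
  have hxab : x = a + Complex.I • b := by
    rw [hx, ha, hb, Finset.smul_sum, ← Finset.sum_add_distrib]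
    refine Finset.sum_congr rfl fun i _ => ?_
    rw [real_smul_eq_complex_smul, real_smul_eq_complex_smul, smul_smul, ← add_smul]
    congr 1
    rw [mul_comm, Complex.re_add_im]
  have hasa : IsSelfAdjoint a :=
    isSelfAdjoint_sum _ fun i _ => (IsSelfAdjoint.all _).smul (hg i).isSelfAdjoint
  have hbsa : IsSelfAdjoint b :=
    isSelfAdjoint_sum _ fun i _ => (IsSelfAdjoint.all _).smul (hg i).isSelfAdjoint
  have haW : a ∈ W := sum_mem fun i _ => real_smul_mem (hgW i) _
  have hbW : b ∈ W := sum_mem fun i _ => real_smul_mem (hgW i) _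
  have hstar : star x = a - Complex.I • b := by
    rw [hxab, star_add, star_smul, hasa.star_eq, hbsa.star_eq, Complex.star_def, Complex.conj_I,
      neg_smul, sub_eq_add_neg]
  have hna : ‖a‖ ≤ ‖x‖ := by
    have h1 : (2 : ℂ) • a = x + star x := by rw [hstar, hxab]; module
    have h2 : ‖(2 : ℂ) • a‖ ≤ ‖x‖ + ‖x‖ := by
      rw [h1]; exact (norm_add_le _ _).trans_eq (by rw [norm_star])
    rw [norm_smul, Complex.norm_two] at h2
    linarith
  have hnb : ‖b‖ ≤ ‖x‖ := by
    have h1 : (2 * Complex.I : ℂ) • b = x - star x := by rw [hstar, hxab]; module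
    have h2 : ‖(2 * Complex.I : ℂ) • b‖ ≤ ‖x‖ + ‖x‖ := by
      rw [h1]; exact (norm_sub_le _ _).trans_eq (by rw [norm_star])
    rw [norm_smul, norm_mul, Complex.norm_two, Complex.norm_I] at h2
    linarith
  have h1 := norm_quasiExt_le hφ hasa haW
  have h2 := norm_quasiExt_le hφ hbsa hbW
  rw [quasiExt_sum_smul_proj hφ hJ _ hgW hg] at h1 h2
  rw [hxab, map_add, map_smul]
  refine (norm_add_le _ _).trans ?_
  rw [norm_smul, Complex.norm_I, one_mul, ← hxab]
  linarith

end LinearExtension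

/-! ### Dyadic Riemann sums and density of the span of projections -/

section Decomposition

variable {H : Type*} [NormedAddCommGroup H] [InnerProductSpace ℂ H] [CompleteSpace H]

theorem isClosed_coe (W : VonNeumannAlgebra H) : IsClosed (W : Set (H →L[ℂ] H)) := by
  rw [← W.commutant_commutant, VonNeumannAlgebra.coe_commutant]
  exact Set.isClosed_centralizer _

instance (W : VonNeumannAlgebra H) : CompleteSpace W :=
  (isClosed_coe W).completeSpace_coe

/-- The dyadic Riemann sum `S_l(A)` of the spectral resolution of `A`. -/
noncomputable def riemannSum (W : VonNeumannAlgebra H) (A : W) (l : ℕ) : W :=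
  ∑ k ∈ Finset.range (⌈(2 : ℝ) ^ l * ‖A‖⌉₊ + 1), (((k : ℝ) / 2 ^ l : ℝ) : ℂ) •
    ((spectralProjIn W A (((k : ℝ) - 1) / 2 ^ l) ((k : ℝ) / 2 ^ l) : Proj W) : W)

theorem coe_sum {ι : Type*} {W : VonNeumannAlgebra H} (s : Finset ι) (f : ι → W) :
    ((∑ i ∈ s, f i : W) : H →L[ℂ] H) = ∑ i ∈ s, (f i : H →L[ℂ] H) :=
  map_sum (AddSubgroupClass.subtype W) f s

theorem coe_riemannSum (W : VonNeumannAlgebra H) (A : W) (l : ℕ) :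
    (riemannSum W A l : H →L[ℂ] H) = ∑ k ∈ Finset.range (⌈(2 : ℝ) ^ l * ‖A‖⌉₊ + 1),
      ((k : ℝ) / 2 ^ l) • spectralProj (A : H →L[ℂ] H) (((k : ℝ) - 1) / 2 ^ l) ((k : ℝ) / 2 ^ l) := by
  rw [riemannSum, coe_sum]
  refine Finset.sum_congr rfl fun k _ => ?_
  rw [real_smul_eq_complex_smul]
  rfl

theorem norm_sub_coe_riemannSum_le {W : VonNeumannAlgebra H} {A : W}
    (hA : (0 : H →L[ℂ] H) ≤ A) (l : ℕ) :
    ‖(A : H →L[ℂ] H) - riemannSum W A l‖ ≤ (1 / 2) ^ l := by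
  have h2 : (0 : ℝ) < 2 ^ l := by positivity
  -- The nodes are shifted by one: the term `k = 0` has weight 0, but its interval `(-2⁻ˡ, 0]` is
  -- needed to cover the kernel of `A`. The last node is `⌈2ˡ ‖A‖⌉ / 2ˡ ≥ ‖A‖`.
  have h := norm_sub_riemannSum_le (A := (A : H →L[ℂ] H)) hA.isSelfAdjoint
    (t := fun k => ((k : ℝ) - 1) / 2 ^ l) (δ := (1 / 2) ^ l) (N := ⌈(2 : ℝ) ^ l * ‖A‖⌉₊ + 1)
    (fun i j hij => by
      have : (i : ℝ) ≤ j := by exact_mod_cast hij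
      simp only
      gcongr)
    (fun k => by
      rw [one_div_pow, ← sub_div, Nat.cast_add, Nat.cast_one]
      simp)
    (spectralProj_eq_one (c := 0) hA.isSelfAdjoint (by simpa using hA)
      (by simpa using div_neg_of_neg_of_pos (by norm_num : (-1 : ℝ) < 0) h2)
      (by
        gcongr
        simp)
      (by
        rw [le_div_iff₀ h2, Nat.cast_add, Nat.cast_one, add_sub_cancel_right, mul_comm]
        exact Nat.le_ceil _))
  rw [coe_riemannSum]
  simpa using h

theorem tendsto_coe_riemannSum {W : VonNeumannAlgebra H} {A : W} (hA : (0 : H →L[ℂ] H) ≤ A) :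
    Tendsto (fun l => (riemannSum W A l : H →L[ℂ] H)) atTop (𝓝 A) := by
  rw [tendsto_iff_norm_sub_tendsto_zero]
  refine squeeze_zero (fun _ => norm_nonneg _) (fun l => ?_)
    (tendsto_pow_atTop_nhds_zero_of_lt_one (r := 1 / 2) (by norm_num) (by norm_num))
  rw [norm_sub_rev]
  exact norm_sub_coe_riemannSum_le hA l

theorem tendsto_riemannSum {W : VonNeumannAlgebra H} {A : W} (hA : (0 : H →L[ℂ] H) ≤ A) :
    Tendsto (riemannSum W A) atTop (𝓝 A) :=
  tendsto_subtype_rng.2 (tendsto_coe_riemannSum hA)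

theorem coe_riemannSum_mem_simpleSpan {W : VonNeumannAlgebra H} {A : W}
    (hA : IsSelfAdjoint (A : H →L[ℂ] H)) (l : ℕ) :
    (riemannSum W A l : H →L[ℂ] H) ∈ simpleSpan W {(A : H →L[ℂ] H)} := by
  rw [coe_riemannSum]
  refine sum_mem fun k _ => ?_
  rw [real_smul_eq_complex_smul]
  refine Submodule.smul_mem _ _ (Submodule.subset_span ⟨spectralProj_mem W A.2 _ _,
    spectralProj_isStarProjection _ _ _, fun T hT => ?_⟩)
  refine commute_spectralProj hA (hT A rfl) ?_
  gcongr
  simp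

theorem rePos_nonneg (W : VonNeumannAlgebra H) (A : W) :
    (0 : H →L[ℂ] H) ≤ rePos W A := CFC.posPart_nonneg _

theorem reNeg_nonneg (W : VonNeumannAlgebra H) (A : W) :
    (0 : H →L[ℂ] H) ≤ reNeg W A := CFC.negPart_nonneg _

theorem imPos_nonneg (W : VonNeumannAlgebra H) (A : W) :
    (0 : H →L[ℂ] H) ≤ imPos W A := CFC.posPart_nonneg _

theorem imNeg_nonneg (W : VonNeumannAlgebra H) (A : W) :
    (0 : H →L[ℂ] H) ≤ imNeg W A := CFC.negPart_nonneg _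

theorem isSelfAdjoint_half_add_star (A : H →L[ℂ] H) :
    IsSelfAdjoint ((2 : ℂ)⁻¹ • (A + star A)) := by
  simp [IsSelfAdjoint, star_smul, add_comm]

theorem isSelfAdjoint_half_I_smul_star_sub (A : H →L[ℂ] H) :
    IsSelfAdjoint ((Complex.I / 2) • (star A - A)) := by
  rw [IsSelfAdjoint, star_smul, star_sub, star_star, ← neg_sub, smul_neg, ← neg_smul]
  simp [neg_div]

theorem coe_rePos_sub_reNeg (W : VonNeumannAlgebra H) (A : W) :
    (rePos W A : H →L[ℂ] H) - reNeg W A = (2 : ℂ)⁻¹ • ((A : H →L[ℂ] H) + star (A : H →L[ℂ] H)) :=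
  CFC.posPart_sub_negPart _ (isSelfAdjoint_half_add_star _)

theorem coe_imPos_sub_imNeg (W : VonNeumannAlgebra H) (A : W) :
    (imPos W A : H →L[ℂ] H) - imNeg W A =
      (Complex.I / 2) • (star (A : H →L[ℂ] H) - (A : H →L[ℂ] H)) :=
  CFC.posPart_sub_negPart _ (isSelfAdjoint_half_I_smul_star_sub _)

theorem eq_rePos_sub_reNeg_add (W : VonNeumannAlgebra H) (A : W) :
    A = (rePos W A - reNeg W A) + Complex.I • (imPos W A - imNeg W A) := by
  refine Subtype.ext ?_
  change (A : H →L[ℂ] H) = ((rePos W A : H →L[ℂ] H) - reNeg W A) +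
    Complex.I • ((imPos W A : H →L[ℂ] H) - imNeg W A)
  rw [coe_rePos_sub_reNeg, coe_imPos_sub_imNeg, smul_smul]
  have : Complex.I * (Complex.I / 2) = -(2 : ℂ)⁻¹ := by
    rw [← mul_div_assoc, Complex.I_mul_I]; norm_num [neg_div]
  rw [this]
  module

theorem dense_span_proj (W : VonNeumannAlgebra H) :
    Dense (Submodule.span ℂ (Set.range (Subtype.val : Proj W → W)) : Set W) := by
  have hpos : ∀ A : W, (0 : H →L[ℂ] H) ≤ A →
      A ∈ (Submodule.span ℂ (Set.range (Subtype.val : Proj W → W))).topologicalClosure := by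
    intro A hA
    refine mem_closure_of_tendsto (tendsto_riemannSum hA) (Eventually.of_forall fun l => ?_)
    exact sum_mem fun k _ => Submodule.smul_mem _ _ (Submodule.subset_span ⟨_, rfl⟩)
  intro A
  change A ∈ (Submodule.span ℂ (Set.range (Subtype.val : Proj W → W))).topologicalClosure
  rw [eq_rePos_sub_reNeg_add W A]
  exact add_mem (sub_mem (hpos _ (rePos_nonneg W A)) (hpos _ (reNeg_nonneg W A)))
    (Submodule.smul_mem _ _ (sub_mem (hpos _ (imPos_nonneg W A)) (hpos _ (imNeg_nonneg W A))))

end Decomposition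

/-! ### The extension of a family that comes from a continuous linear map -/

section Extension

variable {X : Type*} [MeasurableSpace X]
  {H : Type*} [NormedAddCommGroup H] [InnerProductSpace ℂ H] [CompleteSpace H]
  {K : Type*} [NormedAddCommGroup K] [InnerProductSpace ℂ K] [CompleteSpace K]
  {W₁ : VonNeumannAlgebra H} {W₂ : VonNeumannAlgebra K} {F : Proj W₁ → MSet X → W₂} {Δ : MSet X}

theorem ext_of_forall_proj {L L' : W₁ →L[ℂ] W₂} (h : ∀ P : Proj W₁, L P = L' P) : L = L' :=
  ContinuousLinearMap.ext_on (dense_span_proj W₁) (by rintro _ ⟨P, rfl⟩; exact h P)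

theorem riemannValue_eq_map {L : W₁ →L[ℂ] W₂} (hL : ∀ P : Proj W₁, L P = F P Δ) (A : W₁) (l : ℕ) :
    riemannValue F A Δ l = L (riemannSum W₁ A l) := by
  simp only [riemannValue, riemannSum, map_sum, map_smul, hL]

theorem posExtension_eq {L : W₁ →L[ℂ] W₂} (hL : ∀ P : Proj W₁, L P = F P Δ) {A : W₁}
    (hA : (0 : H →L[ℂ] H) ≤ A) : posExtension F A Δ = L A := by
  refine Tendsto.limUnder_eq ?_
  rw [funext (riemannValue_eq_map hL A)]
  exact (L.continuous.tendsto A).comp (tendsto_riemannSum hA)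

theorem extension_eq {L : W₁ →L[ℂ] W₂} (hL : ∀ P : Proj W₁, L P = F P Δ) (A : W₁) :
    extension F A Δ = L A := by
  conv_rhs => rw [eq_rePos_sub_reNeg_add W₁ A]
  simp only [extension, posExtension_eq hL (rePos_nonneg W₁ A),
    posExtension_eq hL (reNeg_nonneg W₁ A), posExtension_eq hL (imPos_nonneg W₁ A),
    posExtension_eq hL (imNeg_nonneg W₁ A), map_add, map_sub, map_smul]

end Extension

/-! ### Construction of the measure on a fixed set -/

section Construction

variable {X : Type*} [MeasurableSpace X]
  {H : Type*} [NormedAddCommGroup H] [InnerProductSpace ℂ H] [CompleteSpace H]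
  {K : Type*} [NormedAddCommGroup K] [InnerProductSpace ℂ K] [CompleteSpace K]
  {W₁ : VonNeumannAlgebra H} {W₂ : VonNeumannAlgebra K} {F : Proj W₁ → MSet X → W₂}

theorem sum_smul_eq_zero_of_real (hF : RespectsLinearRelations F) (Δ : MSet X)
    (s : Finset (Proj W₁)) (a : Proj W₁ → ℝ) (h : ∑ P ∈ s, (a P : ℂ) • (P : W₁) = 0) :
    ∑ P ∈ s, (a P : ℂ) • F P Δ = 0 := by
  have := hF s.card 0 (fun i => a (s.equivFin.symm i)) Fin.elim0
    (fun i => (s.equivFin.symm i : Proj W₁)) Fin.elim0 Δ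
  simp only [Finset.univ_eq_empty, Finset.sum_empty] at this
  have h1 := this ((by
    rw [Equiv.sum_comp s.equivFin.symm (fun P : s => (a P : ℂ) • ((P : Proj W₁) : W₁))]
    exact (Finset.sum_coe_sort s fun P : Proj W₁ => (a P : ℂ) • (P : W₁)).trans h))
  rw [Equiv.sum_comp s.equivFin.symm (fun P : s => (a P : ℂ) • F P Δ)] at h1
  exact (Finset.sum_coe_sort s fun P : Proj W₁ => (a P : ℂ) • F P Δ).symm.trans h1

/-- Projections being hermitian, the adjoint of a relation is the relation with conjugate
coefficients. Hence real and imaginary parts of the coefficients give relations separately, and the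
real condition suffices. -/
theorem sum_smul_eq_zero (hF : RespectsLinearRelations F) (Δ : MSet X)
    (s : Finset (Proj W₁)) (c : Proj W₁ → ℂ) (h : ∑ P ∈ s, c P • (P : W₁) = 0) :
    ∑ P ∈ s, c P • F P Δ = 0 := by
  have hstar : ∑ P ∈ s, star (c P) • (P : W₁) = 0 := by
    have := congrArg star h
    simp only [star_sum, star_zero] at this
    rw [← this]
    refine Finset.sum_congr rfl fun P _ => Subtype.ext ?_
    have hP : star ((P : W₁) : H →L[ℂ] H) = (P : W₁) :=
      congrArg Subtype.val P.2.isSelfAdjoint.star_eq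
    change star (c P) • ((P : W₁) : H →L[ℂ] H) = star (c P • ((P : W₁) : H →L[ℂ] H))
    rw [star_smul, hP]
  have hre : ∑ P ∈ s, ((c P).re : ℂ) • (P : W₁) = 0 := by
    have h2 : ∑ P ∈ s, ((c P).re : ℂ) • (P : W₁) =
        (2 : ℂ)⁻¹ • (∑ P ∈ s, c P • (P : W₁) + ∑ P ∈ s, star (c P) • (P : W₁)) := by
      rw [← Finset.sum_add_distrib, Finset.smul_sum]
      refine Finset.sum_congr rfl fun P _ => ?_
      rw [← add_smul, smul_smul, Complex.re_eq_add_conj, div_eq_inv_mul]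
      rfl
    rw [h2, h, hstar, add_zero, smul_zero]
  have him : ∑ P ∈ s, ((c P).im : ℂ) • (P : W₁) = 0 := by
    have h2 : ∑ P ∈ s, ((c P).im : ℂ) • (P : W₁) =
        (2 * Complex.I)⁻¹ • (∑ P ∈ s, c P • (P : W₁) - ∑ P ∈ s, star (c P) • (P : W₁)) := by
      rw [← Finset.sum_sub_distrib, Finset.smul_sum]
      refine Finset.sum_congr rfl fun P _ => ?_
      rw [← sub_smul, smul_smul, Complex.im_eq_sub_conj, div_eq_inv_mul]
      rfl
    rw [h2, h, hstar, sub_zero, smul_zero]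
  have h3 : ∑ P ∈ s, c P • F P Δ =
      ∑ P ∈ s, ((c P).re : ℂ) • F P Δ + Complex.I • ∑ P ∈ s, ((c P).im : ℂ) • F P Δ := by
    rw [Finset.smul_sum, ← Finset.sum_add_distrib]
    refine Finset.sum_congr rfl fun P _ => ?_
    rw [smul_smul, ← add_smul, mul_comm Complex.I, Complex.re_add_im]
  rw [h3, sum_smul_eq_zero_of_real hF Δ s _ hre, sum_smul_eq_zero_of_real hF Δ s _ him, smul_zero,
    add_zero]

/-- The map is forced on the span of the projections, where condition 1 makes it well defined. Off
that span it is an arbitrary algebraic extension, with no continuity; defining it on all of `B(H)`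
avoids carrying the domain along. -/
theorem exists_linearMap_eq (hF : RespectsLinearRelations F) (Δ : MSet X) :
    ∃ φ : (H →L[ℂ] H) →ₗ[ℂ] (K →L[ℂ] K),
      ∀ P : Proj W₁, φ ((P : W₁) : H →L[ℂ] H) = (F P Δ : K →L[ℂ] K) := by
  set T : (Proj W₁ →₀ ℂ) →ₗ[ℂ] (H →L[ℂ] H) :=
    Finsupp.linearCombination ℂ fun P : Proj W₁ => ((P : W₁) : H →L[ℂ] H) with hT
  set U : (Proj W₁ →₀ ℂ) →ₗ[ℂ] (K →L[ℂ] K) :=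
    Finsupp.linearCombination ℂ fun P : Proj W₁ => (F P Δ : K →L[ℂ] K) with hU
  have hker : T.ker ≤ U.ker := by
    intro x hx
    rw [LinearMap.mem_ker] at hx ⊢
    have h0 : ∑ P ∈ x.support, x P • (P : W₁) = 0 := by
      refine Subtype.ext ?_
      rw [coe_sum]
      exact hx
    have h1 := congrArg (Subtype.val : W₂ → K →L[ℂ] K) (sum_smul_eq_zero hF Δ x.support x h0)
    rw [coe_sum] at h1
    exact h1
  obtain ⟨φ, hφ⟩ := LinearMap.exists_extend
    ((T.ker.liftQ U hker) ∘ₗ (T.quotKerEquivRange.symm : T.range →ₗ[ℂ] _))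
  refine ⟨φ, fun P => ?_⟩
  have h1 : T (Finsupp.single P 1) = ((P : W₁) : H →L[ℂ] H) := by simp [hT]
  have h2 : U (Finsupp.single P 1) = (F P Δ : K →L[ℂ] K) := by simp [hU]
  have h3 := LinearMap.congr_fun hφ ⟨T (Finsupp.single P 1), LinearMap.mem_range_self _ _⟩
  rw [← h1, ← h2]
  refine h3.trans ?_
  have h4 : T.quotKerEquivRange.symm ⟨T (Finsupp.single P 1), LinearMap.mem_range_self _ _⟩ =
      T.ker.mkQ (Finsupp.single P 1) := by
    rw [LinearEquiv.symm_apply_eq]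
    rfl
  change T.ker.liftQ U hker (T.quotKerEquivRange.symm _) = _
  rw [h4]
  rfl

/-! ### Condition 3 read as a Jordan identity -/

section FixedSet

variable {φ : (H →L[ℂ] H) →ₗ[ℂ] (K →L[ℂ] K)} {Δ : MSet X}

theorem isStarProjection_map
    (hφF : ∀ P : Proj W₁, φ ((P : W₁) : H →L[ℂ] H) = (F P Δ : K →L[ℂ] K))
    (hF : ∀ P : Proj W₁, IsStarProjection (F P Δ)) (P : H →L[ℂ] H) (hPW : P ∈ W₁)
    (hP : IsStarProjection P) : IsStarProjection (φ P) := by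
  rw [hφF ⟨⟨P, hPW⟩, ⟨Subtype.ext hP.isIdempotentElem, Subtype.ext hP.isSelfAdjoint⟩⟩]
  have h := hF ⟨⟨P, hPW⟩, ⟨Subtype.ext hP.isIdempotentElem, Subtype.ext hP.isSelfAdjoint⟩⟩
  exact ⟨congrArg Subtype.val h.isIdempotentElem.eq, congrArg Subtype.val h.isSelfAdjoint.star_eq⟩

/-- The dyadic Riemann sums are simple operators in the bicommutant of `A` converging to `A`, so the
limit exists and is `ψ A`; it stays in `W₂` because `W₂` is norm closed. -/
theorem coe_posExtension
    (hφF : ∀ P : Proj W₁, φ ((P : W₁) : H →L[ℂ] H) = (F P Δ : K →L[ℂ] K))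
    (hF : ∀ P : Proj W₁, IsStarProjection (F P Δ)) {A : W₁} (hA : (0 : H →L[ℂ] H) ≤ A) :
    (posExtension F A Δ : K →L[ℂ] K) = quasiExt W₁ φ A := by
  have hval : ∀ l, (riemannValue F A Δ l : K →L[ℂ] K) = φ (riemannSum W₁ A l : H →L[ℂ] H) := by
    intro l
    rw [riemannValue, riemannSum, coe_sum, coe_sum, map_sum]
    refine Finset.sum_congr rfl fun k _ => ?_
    exact ((map_smul φ _ _).trans (congrArg _ (hφF _))).symm
  have h := tendsto_quasiExt_of_seq (isStarProjection_map hφF hF)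
    (pairwiseCommute_singleton (A : H →L[ℂ] H)) hA.isSelfAdjoint A.2 (mem_bicommutant rfl)
    (coe_riemannSum_mem_simpleSpan hA.isSelfAdjoint) (tendsto_coe_riemannSum hA)
  simp only [← hval] at h
  have hmem : quasiExt W₁ φ A ∈ W₂ :=
    (isClosed_coe W₂).mem_of_tendsto h (Eventually.of_forall fun l => (riemannValue F A Δ l).2)
  have h' : Tendsto (riemannValue F A Δ) atTop (𝓝 (⟨quasiExt W₁ φ A, hmem⟩ : W₂)) :=
    tendsto_subtype_rng.2 h
  exact congrArg Subtype.val h'.limUnder_eq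

/-- Positive and negative parts have product zero, so they commute and `ψ` recombines them into `ψ
(Re A) + i ψ (Im A)`. -/
theorem coe_extension
    (hφF : ∀ P : Proj W₁, φ ((P : W₁) : H →L[ℂ] H) = (F P Δ : K →L[ℂ] K))
    (hF : ∀ P : Proj W₁, IsStarProjection (F P Δ)) (A : W₁) :
    (extension F A Δ : K →L[ℂ] K) =
      quasiExt W₁ φ ((2 : ℂ)⁻¹ • ((A : H →L[ℂ] H) + star (A : H →L[ℂ] H))) +
      Complex.I • quasiExt W₁ φ ((Complex.I / 2) • (star (A : H →L[ℂ] H) - (A : H →L[ℂ] H))) := by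
  have hφ := isStarProjection_map hφF hF
  have hc : ∀ B : H →L[ℂ] H, IsSelfAdjoint B → Commute B⁺ B⁻ := fun B hB => by
    rw [commute_iff_eq, CFC.posPart_mul_negPart, CFC.negPart_mul_posPart]
  change ((posExtension F (rePos W₁ A) Δ : K →L[ℂ] K) - posExtension F (reNeg W₁ A) Δ) +
    Complex.I • ((posExtension F (imPos W₁ A) Δ : K →L[ℂ] K) - posExtension F (imNeg W₁ A) Δ) = _
  rw [coe_posExtension hφF hF (rePos_nonneg W₁ A), coe_posExtension hφF hF (reNeg_nonneg W₁ A),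
    coe_posExtension hφF hF (imPos_nonneg W₁ A), coe_posExtension hφF hF (imNeg_nonneg W₁ A),
    ← quasiExt_sub hφ (rePos_nonneg W₁ A).isSelfAdjoint (rePos W₁ A).2
      (reNeg_nonneg W₁ A).isSelfAdjoint (reNeg W₁ A).2 (hc _ (isSelfAdjoint_half_add_star _)),
    ← quasiExt_sub hφ (imPos_nonneg W₁ A).isSelfAdjoint (imPos W₁ A).2
      (imNeg_nonneg W₁ A).isSelfAdjoint (imNeg W₁ A).2 (hc _ (isSelfAdjoint_half_I_smul_star_sub _)),
    coe_rePos_sub_reNeg, coe_imPos_sub_imNeg]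

/-- Condition 3 gives `φ P φ Q = ψ (Re PQ) + i ψ (Im PQ)`. Taking adjoints changes the sign of the
second term, so the sum is `2 ψ (Re PQ) = ψ (PQ + QP)`. -/
theorem map_mul_map_add
    (hφF : ∀ P : Proj W₁, φ ((P : W₁) : H →L[ℂ] H) = (F P Δ : K →L[ℂ] K))
    (hF : ∀ P : Proj W₁, IsStarProjection (F P Δ)) (hM : IsMultiplicative F)
    (P : H →L[ℂ] H) (hPW : P ∈ W₁) (Q : H →L[ℂ] H) (hQW : Q ∈ W₁) (hP : IsStarProjection P)
    (hQ : IsStarProjection Q) : φ P * φ Q + φ Q * φ P = quasiExt W₁ φ (P * Q + Q * P) := by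
  have hφ := isStarProjection_map hφF hF
  set p : Proj W₁ := ⟨⟨P, hPW⟩, ⟨Subtype.ext hP.isIdempotentElem, Subtype.ext hP.isSelfAdjoint⟩⟩
  set q : Proj W₁ := ⟨⟨Q, hQW⟩, ⟨Subtype.ext hQ.isIdempotentElem, Subtype.ext hQ.isSelfAdjoint⟩⟩
  have hΔ : Δ ∩ Δ = Δ := Subtype.ext (Set.inter_self _)
  have h1 : φ P * φ Q = quasiExt W₁ φ ((2 : ℂ)⁻¹ • (P * Q + star (P * Q))) +
      Complex.I • quasiExt W₁ φ ((Complex.I / 2) • (star (P * Q) - P * Q)) := by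
    have h := congrArg (Subtype.val : W₂ → K →L[ℂ] K) (hM p q Δ Δ)
    rw [hΔ, coe_extension hφF hF] at h
    rw [show P = ((p : W₁) : H →L[ℂ] H) from rfl, show Q = ((q : W₁) : H →L[ℂ] H) from rfl,
      hφF, hφF]
    exact h
  have hmem : P * Q ∈ W₁ := mul_mem hPW hQW
  have hre : IsSelfAdjoint (quasiExt W₁ φ ((2 : ℂ)⁻¹ • (P * Q + star (P * Q)))) :=
    isSelfAdjoint_quasiExt hφ (isSelfAdjoint_half_add_star _)
      (SMulMemClass.smul_mem _ (add_mem hmem (star_mem hmem)))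
  have him : IsSelfAdjoint (quasiExt W₁ φ ((Complex.I / 2) • (star (P * Q) - P * Q))) :=
    isSelfAdjoint_quasiExt hφ (isSelfAdjoint_half_I_smul_star_sub _)
      (SMulMemClass.smul_mem _ (sub_mem (star_mem hmem) hmem))
  have h2 : φ Q * φ P = quasiExt W₁ φ ((2 : ℂ)⁻¹ • (P * Q + star (P * Q))) -
      Complex.I • quasiExt W₁ φ ((Complex.I / 2) • (star (P * Q) - P * Q)) := by
    have := congrArg star h1
    rw [star_mul, (hφ P hPW hP).isSelfAdjoint.star_eq, (hφ Q hQW hQ).isSelfAdjoint.star_eq,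
      star_add, star_smul, hre.star_eq, him.star_eq] at this
    rw [this, sub_eq_add_neg (quasiExt W₁ φ _), ← neg_smul, ← starRingEnd_apply, Complex.conj_I]
  have h3 : P * Q + Q * P = (2 : ℝ) • ((2 : ℂ)⁻¹ • (P * Q + star (P * Q))) := by
    rw [real_smul_eq_complex_smul, smul_smul, star_mul, hP.isSelfAdjoint.star_eq,
      hQ.isSelfAdjoint.star_eq]
    simp
  rw [h3, quasiExt_smul hφ (isSelfAdjoint_half_add_star _)
    (SMulMemClass.smul_mem _ (add_mem hmem (star_mem hmem))), h1, h2, two_smul]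
  abel

end FixedSet

/-- Formal combinations of projections map to `W₁` with dense range by `e`, and to `W₂` by `f`. The
bound `‖f x‖ ≤ 2 ‖e x‖` lets `f` descend to the range of `e` and extend by continuity. -/
theorem exists_continuousLinearMap_eq (hF : ∀ P : Proj W₁, IsSpectralMeasure W₂ (F P))
    (hR : RespectsLinearRelations F) (hM : IsMultiplicative F) (Δ : MSet X) :
    ∃ L : W₁ →L[ℂ] W₂, (∀ A, ‖L A‖ ≤ 2 * ‖A‖) ∧ ∀ P : Proj W₁, L P = F P Δ := by
  obtain ⟨φ, hφF⟩ := exists_linearMap_eq hR Δ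
  have hF' : ∀ P : Proj W₁, IsStarProjection (F P Δ) := fun P => (hF P).isStarProjection Δ
  set e : (Proj W₁ →₀ ℂ) →ₗ[ℂ] W₁ := Finsupp.linearCombination ℂ fun P : Proj W₁ => (P : W₁) with he
  set f : (Proj W₁ →₀ ℂ) →ₗ[ℂ] W₂ := Finsupp.linearCombination ℂ fun P : Proj W₁ => F P Δ with hf
  have hrange : (e.range : Set W₁) = Set.range e := rfl
  have hdense : DenseRange e := by
    rw [DenseRange, ← hrange, he, Finsupp.range_linearCombination]
    exact dense_span_proj W₁
  have hcoe : ∀ x, (f x : K →L[ℂ] K) = φ (e x : H →L[ℂ] H) := by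
    intro x
    rw [hf, he, Finsupp.linearCombination_apply, Finsupp.linearCombination_apply, Finsupp.sum,
      Finsupp.sum, coe_sum, coe_sum, map_sum]
    refine Finset.sum_congr rfl fun P _ => ?_
    exact ((map_smul φ _ _).trans (congrArg _ (hφF P))).symm
  have hnorm : ∀ x, ‖f x‖ ≤ 2 * ‖e x‖ := by
    intro x
    change ‖(f x : K →L[ℂ] K)‖ ≤ 2 * ‖(e x : H →L[ℂ] H)‖
    rw [hcoe]
    refine norm_map_span_projections_le (isStarProjection_map hφF hF')
      (map_mul_map_add hφF hF' hM) ?_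
    rw [he, Finsupp.linearCombination_apply, Finsupp.sum, coe_sum]
    exact sum_mem fun P _ => Submodule.smul_mem _ _ (Submodule.subset_span ⟨(P : W₁).2,
      congrArg Subtype.val P.2.isIdempotentElem.eq, congrArg Subtype.val P.2.isSelfAdjoint.star_eq⟩)
  refine ⟨f.extendOfNorm e, LinearMap.norm_extendOfNorm_apply_le hdense 2 hnorm, fun P => ?_⟩
  have := LinearMap.extendOfNorm_eq hdense ⟨2, hnorm⟩ (Finsupp.single P 1)
  simpa [he, hf] using this

end Construction

/-! ### Positivity and countable additivity -/

section Measure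

variable {X : Type*} [MeasurableSpace X]
  {H : Type*} [NormedAddCommGroup H] [InnerProductSpace ℂ H] [CompleteSpace H]
  {K : Type*} [NormedAddCommGroup K] [InnerProductSpace ℂ K] [CompleteSpace K]
  {W₁ : VonNeumannAlgebra H} {W₂ : VonNeumannAlgebra K} {F : Proj W₁ → MSet X → W₂}

/-- Countable additivity for the constant sequence `∅` makes a constant series summable, so its term
is zero. -/
theorem IsPositiveOperatorMeasure.apply_empty {E : MSet X → W₂}
    (hE : IsPositiveOperatorMeasure W₂ E) : E ∅ = 0 := by
  refine Subtype.ext (ContinuousLinearMap.ext fun k => ?_)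
  have h := hE.hasSum (fun _ => ∅) ∅ (fun i j _ => Set.disjoint_empty _)
    (Set.iUnion_empty (ι := ℕ)).symm k
  exact (summable_const_iff _).1 h.summable

theorem IsPositiveOperatorMeasure.sum_apply {E : MSet X → W₂}
    (hE : IsPositiveOperatorMeasure W₂ E) {D : ℕ → MSet X}
    (hD : Pairwise fun i j => Disjoint (D i : Set X) (D j : Set X)) (s : Finset ℕ) {U : MSet X}
    (hU : (U : Set X) = ⋃ j ∈ s, (D j : Set X)) : ∑ j ∈ s, E (D j) = E U := by
  classical
  refine Subtype.ext (ContinuousLinearMap.ext fun k => ?_)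
  have hcoe : ∀ j, ((if j ∈ s then D j else ∅ : MSet X) : Set X) = ⋃ _ : j ∈ s, (D j : Set X) := by
    intro j
    by_cases hj : j ∈ s
    · simp [hj]
    · simp only [hj, if_false, Set.iUnion_of_empty]
      rfl
  have h := hE.hasSum (fun j => if j ∈ s then D j else ∅) U (fun i j hij => ?_) ?_ k
  · have h2 : HasSum (fun j => (E (if j ∈ s then D j else ∅) : K →L[ℂ] K) k)
        (∑ j ∈ s, (E (if j ∈ s then D j else ∅) : K →L[ℂ] K) k) := by
      refine hasSum_sum_of_ne_finset_zero fun j hj => ?_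
      rw [if_neg hj, hE.apply_empty]
      rfl
    rw [h.unique h2, coe_sum, _root_.sum_apply]
    exact Finset.sum_congr rfl fun j hj => by rw [if_pos hj]
  · simp only [hcoe]
    exact (hD hij).mono (Set.iUnion_subset fun _ => subset_rfl)
      (Set.iUnion_subset fun _ => subset_rfl)
  · rw [hU]
    exact Set.iUnion_congr fun j => (hcoe j).symm

theorem map_nonneg_of_forall_proj {Δ : MSet X} {L : W₁ →L[ℂ] W₂} (hL : ∀ P : Proj W₁, L P = F P Δ)
    (hF : ∀ P : Proj W₁, (0 : K →L[ℂ] K) ≤ F P Δ) {A : W₁} (hA : (0 : H →L[ℂ] H) ≤ A) :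
    (0 : K →L[ℂ] K) ≤ L A := by
  have h : Tendsto (fun l => (L (riemannSum W₁ A l) : K →L[ℂ] K)) atTop (𝓝 (L A)) :=
    ((continuous_subtype_val.comp L.continuous).tendsto A).comp (tendsto_riemannSum hA)
  refine ge_of_tendsto' h fun l => ?_
  rw [← riemannValue_eq_map hL, riemannValue, coe_sum]
  refine Finset.sum_nonneg fun k _ => ?_
  change 0 ≤ (((k : ℝ) / 2 ^ l : ℝ) : ℂ) • (F _ Δ : K →L[ℂ] K)
  rw [← real_smul_eq_complex_smul]
  exact smul_nonneg (by positivity) (hF _)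

/-- Finite additivity holds on projections, hence on `W₁`, so every partial sum is the value of `M`
on a finite union and obeys the bound `C` uniformly. The partial sums are therefore equicontinuous
in `A`, the set of `A` where they converge to the right value is closed, and it contains the dense
span of the projections. -/
theorem hasSum_apply (hF : ∀ P : Proj W₁, IsSpectralMeasure W₂ (F P)) {M : MSet X → (W₁ →L[ℂ] W₂)}
    {C : ℝ} (hC : 0 ≤ C) (hM : ∀ Δ A, ‖M Δ A‖ ≤ C * ‖A‖) (hMF : ∀ Δ (P : Proj W₁), M Δ P = F P Δ)
    (D : ℕ → MSet X) (Δ : MSet X)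
    (hD : Pairwise fun i j => Disjoint (D i : Set X) (D j : Set X))
    (hΔ : (Δ : Set X) = ⋃ j, (D j : Set X)) (k : K) (A : W₁) :
    HasSum (fun j => (M (D j) A : K →L[ℂ] K) k) ((M Δ A : K →L[ℂ] K) k) := by
  set U : Finset ℕ → MSet X := fun s =>
    ⟨⋃ j ∈ s, (D j : Set X), s.measurableSet_biUnion fun j _ => (D j).2⟩ with hU
  have hsum : ∀ s B, ∑ j ∈ s, (M (D j) B : K →L[ℂ] K) k = (M (U s) B : K →L[ℂ] K) k := by
    intro s B
    have h1 : ∑ j ∈ s, M (D j) = M (U s) := by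
      refine ext_of_forall_proj fun P => ?_
      rw [_root_.sum_apply, hMF]
      simp only [hMF]
      exact (hF P).toIsPositiveOperatorMeasure.sum_apply hD s rfl
    rw [← h1, _root_.sum_apply, coe_sum, _root_.sum_apply]
  have hlip : ∀ s, LipschitzWith (C.toNNReal * ‖k‖₊)
      fun B => ∑ j ∈ s, (M (D j) B : K →L[ℂ] K) k := by
    intro s
    refine LipschitzWith.of_dist_le_mul fun B B' => ?_
    rw [hsum, hsum, dist_eq_norm, dist_eq_norm]
    have h1 : (M (U s) B : K →L[ℂ] K) k - (M (U s) B' : K →L[ℂ] K) k =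
        (M (U s) (B - B') : K →L[ℂ] K) k := by
      rw [map_sub]
      rfl
    rw [h1, NNReal.coe_mul, Real.coe_toNNReal C hC, coe_nnnorm, mul_right_comm]
    exact (ContinuousLinearMap.le_opNorm _ _).trans
      (mul_le_mul_of_nonneg_right (hM _ _) (norm_nonneg k))
  have hcont : Continuous fun B => (M Δ B : K →L[ℂ] K) k :=
    (ContinuousLinearMap.apply ℂ K k).continuous.comp
      (continuous_subtype_val.comp (M Δ).continuous)
  have hcl := (LipschitzWith.uniformEquicontinuous _ _ hlip).equicontinuous.isClosed_setOfPred_tendsto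
    (l := atTop) hcont
  have hspan : (Submodule.span ℂ (Set.range (Subtype.val : Proj W₁ → W₁)) : Set W₁) ⊆
      {B | HasSum (fun j => (M (D j) B : K →L[ℂ] K) k) ((M Δ B : K →L[ℂ] K) k)} := by
    intro B hB
    induction hB using Submodule.span_induction with
    | mem B hB =>
      obtain ⟨P, rfl⟩ := hB
      simp only [Set.mem_ofPred_eq, hMF]
      exact (hF P).hasSum D Δ hD hΔ k
    | zero => simp
    | add B B' _ _ hB hB' =>
      simp only [Set.mem_ofPred_eq, map_add]
      exact HasSum.add hB hB'
    | smul c B _ hB =>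
      simp only [Set.mem_ofPred_eq, map_smul]
      exact HasSum.const_smul c hB
  exact hcl.closure_subset_iff.2 hspan (dense_span_proj W₁ A)

end Measure

end SpectralFamily

/-! ### The characterization -/

theorem mainTheorem3 {X : Type*} [MeasurableSpace X]
    {H : Type*} [NormedAddCommGroup H] [InnerProductSpace ℂ H] [CompleteSpace H]
    {K : Type*} [NormedAddCommGroup K] [InnerProductSpace ℂ K] [CompleteSpace K]
    (W₁ : VonNeumannAlgebra H) (W₂ : VonNeumannAlgebra K)
    (F : SpectralFamily.Proj W₁ → SpectralFamily.MSet X → W₂)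
    (hF : ∀ P : SpectralFamily.Proj W₁, SpectralFamily.IsSpectralMeasure W₂ (F P)) :
    (∃! M : SpectralFamily.MSet X → (W₁ →L[ℂ] W₂),
        SpectralFamily.IsNonnegSpectralMeasure W₁ W₂ M ∧
          ∀ (P : SpectralFamily.Proj W₁) (Δ : SpectralFamily.MSet X), M Δ P = F P Δ) ↔
      (SpectralFamily.RespectsLinearRelations F ∧
        SpectralFamily.IsSetwiseBounded F ∧
        SpectralFamily.IsMultiplicative F) := by
  constructor
  · rintro ⟨M, ⟨hM, hMF⟩, -⟩
    -- The constant 1 works for every `Δ`, since the values are projections.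
    refine ⟨fun n m a b P Q Δ h => ?_, fun Δ => ⟨1, one_pos, fun P => ?_⟩, fun P Q Δ₁ Δ₂ => ?_⟩
    · simpa only [map_sum, map_smul, hMF] using congrArg (M Δ) h
    · have h := (hF P).isStarProjection Δ
      exact IsStarProjection.norm_le (F P Δ : K →L[ℂ] K)
        ⟨congrArg Subtype.val h.isIdempotentElem.eq, congrArg Subtype.val h.isSelfAdjoint.star_eq⟩
    · rw [SpectralFamily.extension_eq (fun P => hMF P _), ← hM.mul_eq, hMF, hMF]
  · rintro ⟨hR, -, hMul⟩
    choose M hM hMF using SpectralFamily.exists_continuousLinearMap_eq hF hR hMul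
    refine ⟨M, ⟨⟨fun A hA => ⟨fun Δ => ?_, fun D Δ hD hΔ k => ?_⟩, fun P => ?_,
      fun P Q Δ₁ Δ₂ => ?_⟩, fun P Δ => hMF Δ P⟩, fun M' hM' => funext fun Δ => ?_⟩
    · rw [← ContinuousLinearMap.nonneg_iff_isPositive] at hA ⊢
      exact SpectralFamily.map_nonneg_of_forall_proj (hMF Δ)
        (fun P => (ContinuousLinearMap.nonneg_iff_isPositive _).2 ((hF P).isPositive Δ)) hA
    · exact SpectralFamily.hasSum_apply hF zero_le_two hM hMF D Δ hD hΔ k A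
    · simpa only [hMF] using hF P
    -- Now that `M` is linear and continuous, the Riemann sum extension in condition 3 coincides
    -- with `M` itself, at `Δ₁ ∩ Δ₂` and the operator `PQ`.
    · rw [hMF, hMF, hMul, SpectralFamily.extension_eq (hMF _)]
    · exact SpectralFamily.ext_of_forall_proj fun P => by rw [hM'.2, hMF]
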